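/- **(The sparse Hamiltonian lemma.)** Let $(H_x)_x$ be a family of Hamiltonians, $H_x$ being a Hermitian $2^{n}\times 2^{n}$ matrix on $n=n_x$ qubits (for instance one Hamiltonian for each $n$). All polynomials below are uniform over the family. Rows and columns are indexed by $n$-bit strings, $\|\cdot\|$ is the spectral norm, a quantum circuit consists of arbitrary unitary gates on at most two qubits each, and its size is the number of its qubits (including ancillas) plus the number of its gates. Suppose that * (row-sparse) every row of $H_x$ has at most $\mathrm{poly}(n)$ non-zero entries; * (row-computable) for every $0<\delta<1$ there is a quantum circuit of size $\mathrm{poly}(n,1/\delta)$ that, given any row index $i$ as input, outputs with probability at least $2/3$ a list of pairs $(j,a_j)$ in which $j$ runs, once each, over the columns with $(H_x)_{i,j}\neq 0$, and $|a_j-(H_x)_{i,j}|\le\delta$ (the numbers $a_j$ being written in binary); * $\|H_x\|\le\mathrm{poly}(n)$. Then $H_x$ is simulatable: for every $t>0$ and every accuracy $0<\alpha<1$ there is a quantum circuit of size $\mathrm{poly}(n,t,1/\alpha)$, with ancilla qubits initialised to $|0\rangle$, whose unitary $C$ satisfies $\|C(\psi\otimes|0\rangle)-(e^{-iH_xt}\psi)\otimes|0\rangle\|\le\alpha$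 for every unit vector $\psi$. -/

import Mathlib

namespace SparseHamiltonian

/-! ### Quantum circuits

The computational basis of the qubits with labels in `W` is indexed by the bit strings `W → Bool`. -/

/-- An elementary gate on a register of qubits labelled by `W`: an arbitrary unitary applied to
at most two of the qubits. -/
structure Gate (W : Type) where
  arity : ℕ
  arity_le : arity ≤ 2
  wires : Fin arity ↪ W
  unitary : Matrix.unitaryGroup (Fin arity → Bool) ℂ

section

variable {W : Type} [Fintype W] [DecidableEq W]

open Classical in
/-- The action of a gate on the whole register: the given unitary on the qubits `g.wires`, tensored
with the identity on all other qubits. Rows are outputs, columns are inputs. -/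
noncomputable def Gate.matrix (g : Gate W) : Matrix (W → Bool) (W → Bool) ℂ :=
  fun y x =>
    if ∀ w, w ∉ Set.range g.wires → y w = x w then
      (g.unitary : Matrix (Fin g.arity → Bool) (Fin g.arity → Bool) ℂ)
        (fun k => y (g.wires k)) (fun k => x (g.wires k))
    else 0

/-- The unitary computed by a sequence of gates; the head of the list is applied first. -/
noncomputable def circuitMatrix : List (Gate W) → Matrix (W → Bool) (W → Bool) ℂ
  | [] => 1
  | g :: c => circuitMatrix c * g.matrix

/-- The size of a circuit: the number of its qubits (ancillas included) plus that of its gates. -/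
def circuitSize (c : List (Gate W)) : ℕ := Fintype.card W + c.length

end

/-! ### Families of Hamiltonians

`poly(n)` only has a meaning for families. A family may be indexed by any type `ι`, the member `x`
acting on `n x` qubits; all polynomials are uniform in `x`. The case `ι = ℕ`, `n = id` is that of
one Hamiltonian for every number of qubits. -/

/-- A family of Hamiltonians on qubits. -/
structure HamiltonianFamily (ι : Type*) where
  /-- the number of qubits -/
  n : ι → ℕ
  /-- the Hamiltonian, in the computational basis -/
  H : ∀ x, Matrix (Fin (n x) → Bool) (Fin (n x) → Bool) ℂ
  isHermitian : ∀ x, (H x).IsHermitian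

variable {ι : Type*}

/-- Row-sparse: the number of non-zero entries in every row is at most `poly(n)`. -/
def HamiltonianFamily.RowSparse (F : HamiltonianFamily ι) : Prop :=
  ∃ p : Polynomial ℝ, ∀ x i, (({j | F.H x i j ≠ 0} : Set _).ncard : ℝ) ≤ p.eval (F.n x : ℝ)

open scoped Matrix.Norms.L2Operator in
/-- The spectral norm (the operator norm induced by the `ℓ²` norm on states) is at most
`poly(n)`. -/
def HamiltonianFamily.NormBounded (F : HamiltonianFamily ι) : Prop :=
  ∃ p : Polynomial ℝ, ∀ x, ‖F.H x‖ ≤ p.eval (F.n x : ℝ)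

/-! ### Row-computability -/

/-- The qubits of one item `(j, a)` of a list of matrix entries: a flag telling whether the item is
present, the `n` bits of the column `j`, and `b` bits each for the real and the imaginary part
of `a`. -/
abbrev ItemWire (n b : ℕ) : Type := Unit ⊕ Fin n ⊕ Fin b ⊕ Fin b

/-- The qubits of a list with room for `s` items. -/
abbrev ListWire (s n b : ℕ) : Type := Fin s × ItemWire n b

section

variable {s n b : ℕ}

/-- The `r`-th place of the list is occupied. -/
def Present (z : ListWire s n b → Bool) (r : Fin s) : Prop := z (r, .inl ()) = true

/-- The column written in the `r`-th item. -/
def column (z : ListWire s n b → Bool) (r : Fin s) : Fin n → Bool :=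
  fun q => z (r, .inr (.inl q))

/-- The complex number written in the `r`-th item: two signed binary numbers (in two's complement)
with `f` binary digits after the point. -/
noncomputable def value (f : ℕ) (z : ListWire s n b → Bool) (r : Fin s) : ℂ :=
  ⟨(Int.ofBits fun k => z (r, .inr (.inr (.inl k))) : ℝ) / 2 ^ f,
    (Int.ofBits fun k => z (r, .inr (.inr (.inr k))) : ℝ) / 2 ^ f⟩

/-- `z` is a list `(j, H i j)` running over all non-zero entries of the `i`-th row of `H`, once
each, where the values are given up to an error `δ`. -/
def IsRowList (f : ℕ) (H : Matrix (Fin n → Bool) (Fin n → Bool) ℂ) (i : Fin n → Bool) (δ : ℝ)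
    (z : ListWire s n b → Bool) : Prop :=
  (∀ j, H i j ≠ 0 → ∃! r, Present z r ∧ column z r = j) ∧
    ∀ r, Present z r → H i (column z r) ≠ 0 ∧ ‖value f z r - H i (column z r)‖ ≤ δ

end

/-- The probability of reading `z` in the register `B` after the unitary `M` has been applied to
`x` in the register `A` and zeros in the registers `B` (output) and `C` (workspace). -/
noncomputable def outcomeProb {A B C : Type} [Fintype A] [DecidableEq A] [Fintype C] [DecidableEq C]
    (M : Matrix (A ⊕ B ⊕ C → Bool) (A ⊕ B ⊕ C → Bool) ℂ) (x : A → Bool) (z : B → Bool) : ℝ :=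
  ∑ a : A → Bool, ∑ c : C → Bool,
    ‖M (Sum.elim a (Sum.elim z c)) (Sum.elim x fun _ => false)‖ ^ 2

open Classical in
/-- Row-computable: for every accuracy `0 < δ < 1` there is a quantum circuit of size
`poly(n, 1/δ)` that, given any row index `i`, outputs with probability at least `2/3` a list
`(j, H i j)` running over the non-zero entries of row `i`, with values given up to `δ`. -/
def HamiltonianFamily.RowComputable (F : HamiltonianFamily ι) : Prop :=
  ∃ p : MvPolynomial (Fin 2) ℝ, ∀ x, ∀ δ : ℝ, 0 < δ → δ < 1 →
    ∃ (s b f m : ℕ) (c : List (Gate (Fin (F.n x) ⊕ ListWire s (F.n x) b ⊕ Fin m))),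
      (circuitSize c : ℝ) ≤ MvPolynomial.eval ![(F.n x : ℝ), 1 / δ] p ∧
      ∀ i : Fin (F.n x) → Bool,
        2 / 3 ≤ ∑ z with IsRowList f (F.H x) i δ z, outcomeProb (circuitMatrix c) i z

/-! ### Simulatable Hamiltonians -/

/-- The isometry `ψ ↦ ψ ⊗ |0⟩` that adjoins ancilla qubits in the state zero. -/
def adjoinZeros (A C : Type) [Fintype A] [DecidableEq A] [Fintype C] [DecidableEq C] :
    Matrix (A ⊕ C → Bool) (A → Bool) ℂ :=
  fun y x => if y = Sum.elim x (fun _ => false) then 1 else 0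

open scoped Matrix.Norms.L2Operator in
/-- Simulatable: for all `t > 0` and `0 < α < 1` there is a quantum circuit of size
`poly(n, t, 1/α)` that maps `ψ ⊗ |0⟩` to `e^{-iHt} ψ ⊗ |0⟩` up to an error `α` in the operator
norm. -/
def HamiltonianFamily.Simulatable (F : HamiltonianFamily ι) : Prop :=
  ∃ p : MvPolynomial (Fin 3) ℝ, ∀ x, ∀ t α : ℝ, 0 < t → 0 < α → α < 1 →
    ∃ (m : ℕ) (c : List (Gate (Fin (F.n x) ⊕ Fin m))),
      (circuitSize c : ℝ) ≤ MvPolynomial.eval ![(F.n x : ℝ), t, 1 / α] p ∧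
      ‖circuitMatrix c * adjoinZeros (Fin (F.n x)) (Fin m) -
          adjoinZeros (Fin (F.n x)) (Fin m) *
            NormedSpace.exp ((-(Complex.I * (t : ℂ))) • F.H x)‖ ≤ α

end SparseHamiltonian

/-!
Call an operator `M` on `n` qubits *block encoded* (`Enc`) by a circuit `C` if
`M = (I ⊗ ⟨0|) C (I ⊗ |0⟩)`, where the second register holds the ancillas. If `M` is close to a
unitary, then no norm is left for the other blocks, so that `C` almost returns its ancillas to zero
and acts like this unitary (`Enc.exists_circuit`). It is therefore enough to block encode an operator
near `e^{-iHt}`. Block encodings of operators multiply, and requiring further ancillas to return to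
zero gives a block encoding again (`Enc.mul`, `Enc.zeroBlock`).

They also turn the probabilistic row circuit into a deterministic object. Run the circuit, apply an
operator controlled by its outcome `z`, and undo the run: the block where the ancillas return to zero
is the *average* of the controlled operator over the outcomes `z` (`Enc.mix`, `Enc.mix_runs`). In this
way one encodes the operator taking `|i⟩|0⟩` to `∑ j, p i j |i⟩|i ⊕ j⟩`, where `p i j` is the
probability that the runs with input `i` have some computable property and show the column `j` in a
given place (`Enc.rowOp`). Adding the difference `i ⊕ j` to `i` yields `|j⟩|i ⊕ j⟩`, and the same
operation for the row `j` erases the difference; the matrix with entries `p' j i * p i j` is block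
encoded (`Enc.walk`).

The matrix `H` is a combination of such matrices, up to a small error. From `K` lists for the row `i`,
a column is accepted if it occurs in a majority of them, and the first item with this column leads
(`Lead`, `sum_lead`). Whether the entry is above a threshold is decided by a majority as well; summing
over `2N` thresholds for the real and for the imaginary part recovers the entry up to a multiple of
`δ` (`abs_sum_levels_sub_le`, `sum_reached`). By a Chernoff bound (`sum_not_good_le`) most of the
lists are correct with a probability exponentially close to one. Schur's test turns the bounds on the
entries into the bound `norm_sum_step_op_sub_le` in the spectral norm. The backward test matters here:
the rows produce few wrong columns each, but many rows might produce the same wrong column. With the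
test, a wrong entry is suppressed by either of two small probabilities, one of which is summable
over the columns and the other over the rows.

If a contraction `M`, controlled by a qubit, is block encoded, then so is
`cos θ - i sin θ (u M + ū M†) / 2` for `|u| = 1`, which agrees with `e^{-iθ(u M + ū M†)/2}` up to
`O(θ²)` (`Enc.rotation`). Multiplying these over all steps, and repeating this for `R` short times,
approximates `e^{-iHt}` (`Enc.trotter`). All the numbers that occur, that is, the accuracy, the
number of runs (logarithmic in the failure probability), the number of rounds and the costs of the
predicates, are polynomials in the data (`exists_enc_near_exp`, `PolyBdd`).
-/

set_option linter.unusedSectionVars false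

namespace SparseHamiltonian

/-! ### Operators on registers of qubits -/

/-- Two conditionals agree if their conditions are equivalent, whatever decision procedures they
use. Some definitions decide equality of bit strings classically, others do not. -/
lemma ite_congr_inst {α : Sort*} {p q : Prop} {ip : Decidable p} {iq : Decidable q} {a b c d : α}
    (h : p ↔ q) (hab : a = b) (hcd : c = d) : @ite α p ip a c = @ite α q iq b d := by
  subst hab hcd
  by_cases hq : q
  · rw [if_pos hq, if_pos (h.2 hq)]
  · rw [if_neg hq, if_neg fun hp => hq (h.1 hp)]

/-- Operators on a register of qubits labelled by `W`, in the computational basis. -/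
abbrev Op (W : Type) : Type := Matrix (W → Bool) (W → Bool) ℂ

section Lift

variable {W W' W'' V : Type}

open Classical in
/-- The operator `M` on the qubits in the range of `f`, tensored with the identity on the others. -/
noncomputable def lift (f : W ↪ W') (M : Op W) : Op W' :=
  fun y x => if ∀ w, w ∉ Set.range f → y w = x w then M (y ∘ f) (x ∘ f) else 0

/-- The classical map `σ` on bit strings as a `0`-`1` matrix; it is a permutation matrix when `σ` is
bijective. -/
def permMat [Fintype W] [DecidableEq W] (σ : (W → Bool) → (W → Bool)) : Op W :=
  fun y x => if y = σ x then 1 else 0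

lemma extend_apply_off {f : W ↪ W'} {v : W → Bool} {y : W' → Bool} {w : W'}
    (hw : w ∉ Set.range f) : Function.extend f v y w = y w :=
  Function.extend_apply' _ _ _ hw

lemma extend_comp_self (f : W ↪ W') (v : W → Bool) (y : W' → Bool) :
    Function.extend f v y ∘ f = v := by
  funext w; simp [f.injective.extend_apply]

lemma eq_extend_iff {f : W ↪ W'} {v : W → Bool} {y z : W' → Bool} :
    z = Function.extend f v y ↔ z ∘ f = v ∧ ∀ w, w ∉ Set.range f → y w = z w := by
  constructor
  · rintro rfl
    exact ⟨extend_comp_self f v y, fun w hw => (extend_apply_off hw).symm⟩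
  · rintro ⟨rfl, h⟩
    funext w
    by_cases hw : w ∈ Set.range f
    · obtain ⟨u, rfl⟩ := hw
      simp [f.injective.extend_apply]
    · rw [extend_apply_off hw, h w hw]

/-- The strings that agree with `y` off the range of `f` are those obtained from `y` by overwriting
the qubits in this range. -/
lemma sum_agree_off [Fintype W] [DecidableEq W] [Fintype W'] [DecidableEq W'] (f : W ↪ W')
    (y : W' → Bool) (P : (W' → Bool) → Prop) [DecidablePred P]
    (hP : ∀ z, P z ↔ ∀ w, w ∉ Set.range f → y w = z w) (F : (W' → Bool) → ℂ) :
    ∑ z, (if P z then F z else 0) = ∑ v : W → Bool, F (Function.extend f v y) := by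
  rw [← Finset.sum_filter]
  refine Finset.sum_nbij' (fun z => z ∘ f) (fun v => Function.extend f v y) ?_ ?_ ?_ ?_ ?_
  · intros; simp
  · intro v _
    simp only [Finset.mem_filter, Finset.mem_univ, true_and, hP]
    intro w hw
    rw [extend_apply_off hw]
  · intro z hz
    simp only [Finset.mem_filter, Finset.mem_univ, true_and, hP] at hz
    exact (eq_extend_iff.2 ⟨rfl, hz⟩).symm
  · intro v _
    exact extend_comp_self f v y
  · intro z hz
    simp only [Finset.mem_filter, Finset.mem_univ, true_and, hP] at hz
    rw [← eq_extend_iff.2 ⟨rfl, hz⟩]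

variable [Fintype W] [DecidableEq W] [Fintype W'] [DecidableEq W'] [Fintype W''] [DecidableEq W'']

lemma lift_mul_apply (f : W ↪ W') (A : Op W) (M : Op W') (y x : W' → Bool) :
    (lift f A * M) y x = ∑ v, A (y ∘ f) v * M (Function.extend f v y) x := by
  classical
  rw [Matrix.mul_apply]
  simp only [lift, ite_mul, zero_mul]
  rw [sum_agree_off f y _ (fun _ => Iff.rfl)]
  simp [extend_comp_self]

lemma mul_lift_apply (f : W ↪ W') (A : Op W) (M : Op W') (y x : W' → Bool) :
    (M * lift f A) y x = ∑ v, M y (Function.extend f v x) * A v (x ∘ f) := by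
  classical
  rw [Matrix.mul_apply]
  simp only [lift, mul_ite, mul_zero]
  rw [sum_agree_off f x _ (fun z => by simp only [eq_comm])]
  simp [extend_comp_self]

lemma lift_mul (f : W ↪ W') (A B : Op W) : lift f (A * B) = lift f A * lift f B := by
  classical
  ext y x
  rw [lift_mul_apply]
  simp only [lift, extend_comp_self]
  by_cases h : ∀ w, w ∉ Set.range f → y w = x w
  · rw [if_pos h, Matrix.mul_apply]
    refine Finset.sum_congr rfl fun v _ => ?_
    rw [if_pos]
    intro w hw
    rw [extend_apply_off hw, h w hw]
  · rw [if_neg h]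
    refine (Finset.sum_eq_zero fun v _ => ?_).symm
    rw [if_neg, mul_zero]
    intro h'
    exact h fun w hw => by rw [← h' w hw, extend_apply_off hw]

lemma lift_permMat (f : W ↪ W') (σ : (W → Bool) → (W → Bool)) :
    lift f (permMat σ) = permMat fun x => Function.extend f (σ (x ∘ f)) x := by
  classical
  ext y x
  simp only [lift, permMat, eq_extend_iff, ← ite_and]
  refine ite_congr_inst ?_ rfl rfl
  rw [and_comm]
  simp only [eq_comm]

lemma permMat_id : permMat (id : (W → Bool) → (W → Bool)) = 1 := by
  ext y x
  simp [permMat, Matrix.one_apply]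

lemma mul_permMat_apply (σ : (W → Bool) → (W → Bool)) (M : Op W) (y x : W → Bool) :
    (M * permMat σ) y x = M y (σ x) := by
  simp [Matrix.mul_apply, permMat]

/-- A product with an involutive permutation matrix on the left; `mul_permMat_apply` on the right
holds for every map. -/
lemma permMat_mul_apply {σ : (W → Bool) → (W → Bool)} (hσ : Function.Involutive σ) (M : Op W)
    (y x : W → Bool) : (permMat σ * M) y x = M (σ y) x := by
  rw [Matrix.mul_apply, Finset.sum_eq_single (σ y)]
  · simp [permMat, hσ y]
  · intro z _ hz
    simp only [permMat]
    rw [if_neg, zero_mul]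
    rintro rfl
    exact hz (hσ z).symm
  · simp

lemma permMat_mul_permMat (σ τ : (W → Bool) → (W → Bool)) :
    permMat σ * permMat τ = permMat (σ ∘ τ) := by
  ext y x
  rw [mul_permMat_apply]
  rfl

lemma lift_one (f : W ↪ W') : lift f (1 : Op W) = 1 := by
  rw [← permMat_id, lift_permMat, ← permMat_id]
  congr 1
  funext x
  exact (eq_extend_iff.2 ⟨rfl, fun _ _ => rfl⟩).symm

lemma lift_conjTranspose (f : W ↪ W') (A : Op W) : lift f A.conjTranspose = (lift f A).conjTranspose := by
  ext y x
  simp only [lift, Matrix.conjTranspose_apply]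
  split_ifs with h h' h'
  · rfl
  · exact absurd (fun w hw => (h w hw).symm) h'
  · exact absurd (fun w hw => (h' w hw).symm) h
  · simp

lemma lift_lift (g : W' ↪ W'') (f : W ↪ W') (A : Op W) :
    lift g (lift f A) = lift (f.trans g) A := by
  ext y x
  simp only [lift, ← ite_and]
  refine ite_congr_inst ?_ rfl rfl
  constructor
  · rintro ⟨h1, h2⟩ w hw
    by_cases hg : w ∈ Set.range g
    · obtain ⟨u, rfl⟩ := hg
      refine h2 u fun ⟨v, hv⟩ => hw ⟨v, by simp [hv]⟩
    · exact h1 w hg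
  · intro h
    refine ⟨fun w hw => h w ?_, fun w hw => h (g w) ?_⟩
    · rintro ⟨v, rfl⟩
      exact hw ⟨f v, rfl⟩
    · rintro ⟨v, hv⟩
      exact hw ⟨v, g.injective hv⟩

lemma lift_equiv_apply (e : W ≃ W') (A : Op W) (y x : W' → Bool) :
    lift e.toEmbedding A y x = A (y ∘ e) (x ∘ e) := by
  simp only [lift]
  rw [if_pos]
  · rfl
  · intro w hw
    exact absurd ⟨e.symm w, by simp⟩ hw

lemma lift_refl (A : Op W) : lift (Function.Embedding.refl W) A = A := by
  ext y x
  exact lift_equiv_apply (Equiv.refl W) A y x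

open Classical in
lemma lift_inl_apply (A : Op W) (y x : W → Bool) (y' x' : V → Bool) :
    lift (Function.Embedding.inl : W ↪ W ⊕ V) A (Sum.elim y y') (Sum.elim x x') =
      if y' = x' then A y x else 0 := by
  unfold lift
  refine ite_congr_inst ?_ rfl rfl
  constructor
  · intro h
    funext v
    exact h (.inr v) (by simp)
  · rintro rfl (w | v) hw
    · exact absurd ⟨w, rfl⟩ hw
    · rfl

lemma lift_mem_unitary (f : W ↪ W') {A : Op W} (hA : A ∈ Matrix.unitaryGroup (W → Bool) ℂ) :
    lift f A ∈ Matrix.unitaryGroup (W' → Bool) ℂ := by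
  rw [Matrix.mem_unitaryGroup_iff] at hA ⊢
  rw [Matrix.star_eq_conjTranspose] at hA ⊢
  rw [← lift_conjTranspose, ← lift_mul, hA, lift_one]

end Lift

/-! ### Exact circuits -/

section Circ

variable {W W' V : Type} [Fintype W] [DecidableEq W] [Fintype W'] [DecidableEq W']
  [Fintype V] [DecidableEq V]

/-- `M` is computed by a circuit of at most `k` gates, without ancillas. -/
def Circ (M : Op W) (k : ℕ) : Prop :=
  ∃ c : List (Gate W), circuitMatrix c = M ∧ c.length ≤ k

lemma Gate.matrix_eq_lift (g : Gate W) : g.matrix = lift g.wires g.unitary.1 := by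
  ext y x
  exact ite_congr_inst Iff.rfl rfl rfl

lemma circuitMatrix_append (c d : List (Gate W)) :
    circuitMatrix (c ++ d) = circuitMatrix d * circuitMatrix c := by
  induction c with
  | nil => simp [circuitMatrix]
  | cons g c ih => simp [circuitMatrix, ih, mul_assoc]

lemma Circ.one : Circ (1 : Op W) 0 := ⟨[], rfl, le_rfl⟩

lemma Circ.mul {A B : Op W} {a b : ℕ} (hA : Circ A a) (hB : Circ B b) : Circ (A * B) (a + b) := by
  obtain ⟨c, rfl, hc⟩ := hA
  obtain ⟨d, rfl, hd⟩ := hB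
  exact ⟨d ++ c, circuitMatrix_append d c, by simp; omega⟩

lemma Circ.of_gate (g : Gate W) : Circ g.matrix 1 := ⟨[g], by simp [circuitMatrix], by simp⟩

/-- Unitaries on at most two qubits are single gates, whatever their qubits are called. -/
lemma Circ.lift_unitary (f : V ↪ W) {M : Op V} (hM : M ∈ Matrix.unitaryGroup (V → Bool) ℂ)
    (hV : Fintype.card V ≤ 2) : Circ (lift f M) 1 := by
  let e := (Fintype.equivFin V).symm
  have h := Circ.of_gate (W := W) ⟨Fintype.card V, hV, e.toEmbedding.trans f,
    ⟨lift e.symm.toEmbedding M, lift_mem_unitary _ hM⟩⟩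
  rw [Gate.matrix_eq_lift] at h
  simp only [lift_lift] at h
  have he : e.symm.toEmbedding.trans (e.toEmbedding.trans f) = f := by
    ext v; simp
  rwa [he] at h

lemma Circ.lift {M : Op W} {k : ℕ} (h : Circ M k) (f : W ↪ W') : Circ (lift f M) k := by
  obtain ⟨c, rfl, hc⟩ := h
  refine ⟨c.map fun g => ⟨g.arity, g.arity_le, g.wires.trans f, g.unitary⟩, ?_, by simpa using hc⟩
  clear hc
  induction c with
  | nil => simp [circuitMatrix, lift_one]
  | cons g c ih =>
    simp only [List.map_cons, circuitMatrix, lift_mul, ih, Gate.matrix_eq_lift, lift_lift]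

/-- A circuit is run backwards by reversing the order of its gates and inverting each of them. -/
lemma Circ.conjTranspose {M : Op W} {k : ℕ} (h : Circ M k) : Circ M.conjTranspose k := by
  obtain ⟨c, rfl, hc⟩ := h
  refine ⟨(c.map fun g => ⟨g.arity, g.arity_le, g.wires, star g.unitary⟩).reverse, ?_,
    by simpa using hc⟩
  clear hc
  induction c with
  | nil => simp [circuitMatrix]
  | cons g c ih =>
    simp only [List.map_cons, List.reverse_cons, circuitMatrix_append, ih, circuitMatrix, one_mul,
      Matrix.conjTranspose_mul, Gate.matrix_eq_lift, ← lift_conjTranspose]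
    rfl

lemma Circ.mem_unitary {M : Op W} {k : ℕ} (h : Circ M k) :
    M ∈ Matrix.unitaryGroup (W → Bool) ℂ := by
  obtain ⟨c, rfl, -⟩ := h
  induction c with
  | nil => exact one_mem _
  | cons g c ih =>
    rw [circuitMatrix, Gate.matrix_eq_lift]
    exact mul_mem ih (lift_mem_unitary g.wires g.unitary.2)

end Circ

/-! ### Block encodings -/

section Enc

variable {W W' V : Type} [Fintype W] [DecidableEq W] [Fintype W'] [DecidableEq W']
  [Fintype V] [DecidableEq V]

/-- The bit string `x`, continued by zeros on the qubits `V`. -/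
def padZero (V : Type) (x : W → Bool) : W ⊕ V → Bool := Sum.elim x fun _ => false

/-- The block `(I ⊗ ⟨0|) M (I ⊗ |0⟩)` of an operator `M`, with zeros in the register `V`. -/
def zeroBlock (M : Op (W ⊕ V)) : Op W := fun y x => M (padZero V y) (padZero V x)

/-- `M` is block encoded by a circuit of size at most `S`: it is the block `(I ⊗ ⟨0|) C (I ⊗ |0⟩)`
of the unitary `C` of the circuit. The size counts ancillas and gates, but not the qubits in `W`. -/
def Enc (M : Op W) (S : ℕ) : Prop :=
  ∃ (A : Type) (_ : Fintype A) (_ : DecidableEq A) (C : Op (W ⊕ A)) (k : ℕ),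
    Circ C k ∧ Fintype.card A + k ≤ S ∧ zeroBlock C = M

lemma Enc.mono {M : Op W} {S T : ℕ} (h : Enc M S) (hST : S ≤ T) : Enc M T := by
  obtain ⟨A, _, _, C, k, hC, hS, rfl⟩ := h
  exact ⟨A, _, _, C, k, hC, hS.trans hST, rfl⟩

lemma Circ.enc {M : Op W} {k : ℕ} (h : Circ M k) : Enc M k := by
  refine ⟨Empty, inferInstance, inferInstance, _, k, h.lift Function.Embedding.inl, by simp, ?_⟩
  ext y x
  rw [zeroBlock, padZero, padZero, lift_inl_apply, if_pos rfl]

lemma Enc.one : Enc (1 : Op W) 0 := Circ.one.enc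

/-- Block encodings multiply when each factor is given ancillas of its own: the ancillas of one
factor stay zero while the other acts. -/
lemma Enc.mul {M N : Op W} {S T : ℕ} (hM : Enc M S) (hN : Enc N T) : Enc (M * N) (S + T) := by
  obtain ⟨A, _, _, C, k, hC, hS, rfl⟩ := hM
  obtain ⟨B, _, _, D, l, hD, hT, rfl⟩ := hN
  let f : W ⊕ A ↪ W ⊕ (A ⊕ B) :=
    Function.Embedding.sumMap (Function.Embedding.refl W) Function.Embedding.inl
  let g : W ⊕ B ↪ W ⊕ (A ⊕ B) :=
    Function.Embedding.sumMap (Function.Embedding.refl W) Function.Embedding.inr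
  refine ⟨A ⊕ B, inferInstance, inferInstance, _, k + l, (hC.lift f).mul (hD.lift g),
    by simp; omega, ?_⟩
  ext y x
  rw [zeroBlock, lift_mul_apply, Matrix.mul_apply, ← (Equiv.sumArrowEquivProdArrow W A Bool).symm.sum_comp,
    Fintype.sum_prod_type]
  refine Finset.sum_congr rfl fun w _ => ?_
  rw [Finset.sum_eq_single fun _ => false]
  · congr 1
    · simp only [zeroBlock]
      congr 1
      funext u; rcases u with u | u <;> rfl
    · have h : Function.extend f ((Equiv.sumArrowEquivProdArrow W A Bool).symm
          (w, fun _ => false)) (padZero (A ⊕ B) y) = padZero (A ⊕ B) w := by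
        symm
        rw [eq_extend_iff]
        constructor
        · funext u; rcases u with u | u <;> rfl
        · rintro (u | u | u) hu
          · exact absurd ⟨.inl u, rfl⟩ hu
          · exact absurd ⟨.inr u, rfl⟩ hu
          · rfl
      rw [h, SparseHamiltonian.lift, if_pos]
      · simp only [zeroBlock]
        congr 1 <;> · funext u; rcases u with u | u <;> rfl
      · rintro (u | u | u) hu <;> first | rfl | exact absurd ⟨.inl u, rfl⟩ hu
  · intro a _ ha
    rw [SparseHamiltonian.lift, if_neg, mul_zero]
    intro h
    apply ha
    funext u
    have := h (.inr (.inl u)) (by rintro ⟨v | v, hv⟩ <;> simp [g] at hv)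
    have h2 : (Function.extend f ((Equiv.sumArrowEquivProdArrow W A Bool).symm (w, a))
        (padZero (A ⊕ B) y)) (f (.inr u)) = a u := by
      rw [f.injective.extend_apply]; rfl
    rw [← h2]
    exact this
  · simp

lemma Enc.lift {M : Op W} {S : ℕ} (h : Enc M S) (f : W ↪ W') : Enc (lift f M) S := by
  obtain ⟨A, _, _, C, k, hC, hS, rfl⟩ := h
  refine ⟨A, _, _, _, k, hC.lift (Function.Embedding.sumMap f (Function.Embedding.refl A)), hS, ?_⟩
  ext y x
  simp only [zeroBlock, SparseHamiltonian.lift]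
  refine ite_congr_inst ⟨fun h w hw => ?_, ?_⟩ ?_ rfl
  · refine h (.inl w) ?_
    rintro ⟨u | u, hu⟩
    · exact hw ⟨u, by simpa using hu⟩
    · simp at hu
  · rintro h (w | a) hw
    · refine h w fun ⟨u, hu⟩ => hw ⟨.inl u, by simp [hu]⟩
    · exact absurd ⟨.inr a, rfl⟩ hw
  · congr 1 <;> · funext u; rcases u with u | u <;> rfl

lemma Enc.zeroBlock {M : Op (W ⊕ V)} {S : ℕ} (h : Enc M S) :
    Enc (zeroBlock M) (S + Fintype.card V) := by
  obtain ⟨A, _, _, C, k, hC, hS, rfl⟩ := h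
  refine ⟨V ⊕ A, inferInstance, inferInstance, _, k,
    hC.lift (Equiv.sumAssoc W V A).toEmbedding, by simp; omega, ?_⟩
  ext y x
  simp only [SparseHamiltonian.zeroBlock, lift_equiv_apply]
  congr 1 <;> · funext u; rcases u with (u | u) | u <;> rfl

lemma Enc.pow {M : Op W} {S : ℕ} (h : Enc M S) (r : ℕ) : Enc (M ^ r) (r * S) := by
  induction r with
  | zero => simpa using Enc.one
  | succ r ih =>
    rw [pow_succ, Nat.succ_mul]
    exact ih.mul h

lemma Enc.list_prod {l : List (Op W)} {S : ℕ} (h : ∀ M ∈ l, Enc M S) :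
    Enc l.prod (l.length * S) := by
  induction l with
  | nil => simpa using Enc.one
  | cons M l ih =>
    rw [List.prod_cons, List.length_cons, Nat.succ_mul, add_comm]
    exact (h M (by simp)).mul (ih fun N hN => h N (by simp [hN]))

end Enc

/-! ### Controlled operators -/

section Ctrl

variable {W W' V Q : Type} [Fintype W] [DecidableEq W] [Fintype W'] [DecidableEq W']
  [Fintype V] [DecidableEq V] [Fintype Q] [DecidableEq Q]

/-- The operator that applies `g w` to the register `V` when the register `W` contains `w`, and does
not change `W`. -/
def ctrl (g : (W → Bool) → Op V) : Op (W ⊕ V) :=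
  fun y x => if y ∘ Sum.inl = x ∘ Sum.inl then g (x ∘ Sum.inl) (y ∘ Sum.inr) (x ∘ Sum.inr) else 0

/-- The classical map that adds `F q`, evaluated on the register `W`, to each qubit `q` of the
register `Q`. -/
def multiXor (F : Q → (W → Bool) → Bool) (x : W ⊕ Q → Bool) : W ⊕ Q → Bool :=
  Sum.elim (x ∘ Sum.inl) fun q => x (.inr q) ^^ F q (x ∘ Sum.inl)

lemma sum_sum_type (F : (W ⊕ V → Bool) → ℂ) :
    ∑ z, F z = ∑ w : W → Bool, ∑ v : V → Bool, F (Sum.elim w v) := by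
  rw [← (Equiv.sumArrowEquivProdArrow W V Bool).symm.sum_comp, Fintype.sum_prod_type]
  rfl

lemma sum_unit_type (F : (Unit → Bool) → ℂ) :
    ∑ z, F z = F (fun _ => true) + F (fun _ => false) := by
  rw [← (Equiv.funUnique Unit Bool).symm.sum_comp, Fintype.sum_bool]
  rfl

lemma ctrl_elim (g : (W → Bool) → Op V) (w w' : W → Bool) (v v' : V → Bool) :
    ctrl g (Sum.elim w' v') (Sum.elim w v) = if w' = w then g w v' v else 0 := rfl

lemma Op.ext_sum {M N : Op (W ⊕ V)}
    (h : ∀ w' v' w v, M (Sum.elim w' v') (Sum.elim w v) = N (Sum.elim w' v') (Sum.elim w v)) :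
    M = N := by
  ext y x
  rw [← Sum.elim_comp_inl_inr y, ← Sum.elim_comp_inl_inr x]
  exact h _ _ _ _

lemma ctrl_mul (g h : (W → Bool) → Op V) : ctrl g * ctrl h = ctrl fun w => g w * h w := by
  refine Op.ext_sum fun w' v' w v => ?_
  rw [Matrix.mul_apply, sum_sum_type]
  simp only [ctrl_elim, mul_ite, ite_mul, zero_mul, mul_zero]
  rw [Finset.sum_comm]
  simp only [Finset.sum_ite_eq', Finset.mem_univ, if_true, Matrix.mul_apply]
  split_ifs with h
  · subst h; rfl
  · simp

lemma ctrl_one : ctrl (fun _ : W → Bool => (1 : Op V)) = 1 := by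
  refine Op.ext_sum fun w' v' w v => ?_
  rw [ctrl_elim, Matrix.one_apply, Matrix.one_apply, ← ite_and]
  exact ite_congr_inst (by rw [Sum.elim_eq_iff]) rfl rfl

lemma ctrl_conjTranspose (g : (W → Bool) → Op V) :
    (ctrl g).conjTranspose = ctrl fun w => (g w).conjTranspose := by
  refine Op.ext_sum fun w' v' w v => ?_
  simp only [Matrix.conjTranspose_apply, ctrl_elim]
  by_cases h : w' = w
  · subst h; simp
  · rw [if_neg h, if_neg (Ne.symm h), star_zero]

lemma ctrl_mem_unitary {g : (W → Bool) → Op V}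
    (hg : ∀ w, g w ∈ Matrix.unitaryGroup (V → Bool) ℂ) :
    ctrl g ∈ Matrix.unitaryGroup (W ⊕ V → Bool) ℂ := by
  rw [Matrix.mem_unitaryGroup_iff, Matrix.star_eq_conjTranspose, ctrl_conjTranspose, ctrl_mul,
    ← ctrl_one]
  congr 1
  funext w
  simpa [Matrix.star_eq_conjTranspose] using Matrix.mem_unitaryGroup_iff.1 (hg w)

lemma multiXor_inr (F : Q → (W → Bool) → Bool) (x : W ⊕ Q → Bool) (q : Q) :
    multiXor F x (.inr q) = (x (.inr q) ^^ F q (x ∘ Sum.inl)) := rfl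

lemma padZero_inr (y : W → Bool) (v : V) : padZero V y (.inr v) = false := rfl

lemma padZero_comp_inl (y : W → Bool) : padZero V y ∘ Sum.inl = y := rfl

lemma multiXor_involutive (F : Q → (W → Bool) → Bool) : Function.Involutive (multiXor F) := by
  intro x
  funext w
  rcases w with w | q
  · rfl
  · change ((x (.inr q) ^^ F q (x ∘ Sum.inl)) ^^ F q (x ∘ Sum.inl)) = x (.inr q)
    simp

/-- An involution gives a unitary matrix that is its own inverse. -/
lemma permMat_mem_unitary {σ : (W → Bool) → (W → Bool)} (hσ : Function.Involutive σ) :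
    permMat σ ∈ Matrix.unitaryGroup (W → Bool) ℂ := by
  have h : (permMat σ).conjTranspose = permMat σ := by
    ext y x
    simp only [Matrix.conjTranspose_apply, permMat, apply_ite star, star_one, star_zero]
    exact ite_congr_inst ⟨fun h => by rw [h, hσ], fun h => by rw [h, hσ]⟩ rfl rfl
  rw [Matrix.mem_unitaryGroup_iff, Matrix.star_eq_conjTranspose, h, permMat_mul_permMat,
    hσ.comp_self, permMat_id]

lemma lift_multiXor (f : W ↪ W') (F : Q → (W → Bool) → Bool) :
    lift (f.sumMap (Function.Embedding.refl Q)) (permMat (multiXor F)) =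
      permMat (multiXor fun q x => F q (x ∘ f)) := by
  rw [lift_permMat]
  congr 1
  funext x
  symm
  rw [eq_extend_iff]
  constructor
  · funext u; rcases u with u | u <;> rfl
  · rintro (u | u) hu
    · rfl
    · exact absurd ⟨.inr u, rfl⟩ hu

lemma ctrl_permMat_xor (F : Q → (W → Bool) → Bool) :
    permMat (multiXor F) = ctrl fun w => permMat fun v q => v q ^^ F q w := by
  refine Op.ext_sum fun w' v' w v => ?_
  rw [ctrl_elim]
  unfold permMat
  rw [← ite_and]
  refine ite_congr_inst ?_ rfl rfl
  rw [multiXor, Sum.elim_eq_iff]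
  rfl

/-- The two-qubit gate obtained by controlling a one-qubit gate can be conditioned on any predicate
that can be computed: compute it into an ancilla, control the gate by that ancilla, uncompute. -/
lemma Enc.ctrl_of_xor {f : (W → Bool) → Bool} {S : ℕ}
    (h : Enc (permMat (multiXor fun _ : Unit => f)) S) {U : Op Unit}
    (hU : U ∈ Matrix.unitaryGroup (Unit → Bool) ℂ) :
    Enc (ctrl fun w => if f w then U else 1) (2 * S + 2) := by
  let i : W ↪ W ⊕ Unit := Function.Embedding.inl
  let j : Unit ⊕ Unit ↪ (W ⊕ Unit) ⊕ Unit :=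
    ⟨Sum.elim (fun _ => .inr ()) (fun _ => .inl (.inr ())), by
      rintro (u | u) (v | v) huv <;> simp at huv <;> rfl⟩
  have h1 := h.lift (i.sumMap (Function.Embedding.refl Unit))
  rw [lift_multiXor] at h1
  have h2 : Circ (SparseHamiltonian.lift j (ctrl fun b : Unit → Bool => if b () then U else 1)) 1 := by
    refine Circ.lift_unitary j (ctrl_mem_unitary fun b => ?_) (by simp)
    split_ifs
    · exact hU
    · exact one_mem _
  have h3 := ((h1.mul h2.enc).mul h1).zeroBlock
  refine Enc.mono (S := S + 1 + S + Fintype.card Unit) ?_ (by simp; omega)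
  convert h3 using 1
  ext y x
  rw [SparseHamiltonian.zeroBlock, mul_permMat_apply, permMat_mul_apply (multiXor_involutive _)]
  have hz : ∀ z : W ⊕ Unit → Bool, multiXor (fun (_ : Unit) (x : W ⊕ Unit → Bool) => f (x ∘ i))
      (padZero Unit z) = Sum.elim z fun _ => f (z ∘ Sum.inl) := by
    intro z
    funext u
    rcases u with u | u
    · rfl
    · exact Bool.false_xor _
  rw [hz, hz, SparseHamiltonian.lift, ctrl, ctrl]
  by_cases hyx : y ∘ Sum.inl = x ∘ Sum.inl
  · have h1 : (Sum.elim y fun _ => f (y ∘ Sum.inl)) ∘ j ∘ Sum.inl =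
        (Sum.elim x fun _ : Unit => f (x ∘ Sum.inl)) ∘ j ∘ Sum.inl := by
      funext u
      exact congrArg f hyx
    rw [if_pos hyx]
    symm
    refine (if_pos ?_).trans (if_pos h1)
    · rintro ((w | u) | u) hw
      · exact congrFun hyx w
      · exact absurd ⟨.inr u, rfl⟩ hw
      · exact absurd ⟨.inl u, rfl⟩ hw
  · rw [if_neg hyx]
    symm
    refine if_neg fun hw => ?_
    apply hyx
    funext w
    refine hw (.inl (.inl w)) ?_
    rintro ⟨u | u, hu⟩
    · exact nomatch (show (Sum.inr () : (W ⊕ Unit) ⊕ Unit) = .inl (.inl w) from hu)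
    · exact nomatch (show (Sum.inl (.inr ()) : (W ⊕ Unit) ⊕ Unit) = .inl (.inl w) from hu)

/-- A square root of the one-qubit gate `NOT`. -/
noncomputable def sqrtNot : Op Unit :=
  fun y x => if y () = x () then (1 + Complex.I) / 2 else (1 - Complex.I) / 2

lemma Op.ext_unit {M N : Op Unit} (h : ∀ a b, M (fun _ => a) (fun _ => b) = N (fun _ => a) fun _ => b) :
    M = N := by
  ext y x
  exact h (y ()) (x ())

lemma funUnit_eq_iff {a b : Bool} : ((fun _ : Unit => a) = fun _ => b) ↔ a = b :=
  ⟨fun h => congrFun h (), fun h => h ▸ rfl⟩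

lemma sqrtNot_mul_self : sqrtNot * sqrtNot = permMat fun v q => !v q := by
  refine Op.ext_unit fun a b => ?_
  have h : permMat (fun (v : Unit → Bool) q => !v q) (fun _ => a) (fun _ => b) =
      if a = !b then 1 else 0 := ite_congr_inst funUnit_eq_iff rfl rfl
  rw [Matrix.mul_apply, sum_unit_type, h]
  unfold sqrtNot
  have := Complex.I_sq
  cases a <;> cases b <;> simp <;> ring_nf <;> simp <;> norm_num

lemma sqrtNot_mul_conjTranspose : sqrtNot * sqrtNot.conjTranspose = 1 := by
  refine Op.ext_unit fun a b => ?_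
  have h : (1 : Op Unit) (fun _ => a) (fun _ => b) = if a = b then 1 else 0 := by
    rw [Matrix.one_apply]
    exact ite_congr_inst funUnit_eq_iff rfl rfl
  rw [Matrix.mul_apply, sum_unit_type, h]
  simp only [Matrix.conjTranspose_apply]
  unfold sqrtNot
  have := Complex.I_sq
  cases a <;> cases b <;> simp <;> ring_nf <;> simp <;> norm_num

lemma sqrtNot_mem_unitary : sqrtNot ∈ Matrix.unitaryGroup (Unit → Bool) ℂ := by
  rw [Matrix.mem_unitaryGroup_iff]
  exact sqrtNot_mul_conjTranspose

end Ctrl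

/-! ### Computable predicates -/

section Comp

variable {W W' V Q : Type} [Fintype W] [DecidableEq W] [Fintype W'] [DecidableEq W']
  [Fintype V] [DecidableEq V] [Fintype Q] [DecidableEq Q]

open Classical in
/-- The predicate `P` on bit strings can be computed reversibly, that is, added to a further qubit,
with size at most `S`. Ancillas start and end in the state zero: a block encoding of a unitary does
not leave them in any other state. -/
def Comp (P : (W → Bool) → Prop) (S : ℕ) : Prop :=
  Enc (permMat (multiXor fun (_ : Unit) x => decide (P x))) S

lemma Comp.mono {P : (W → Bool) → Prop} {S T : ℕ} (h : Comp P S) (hST : S ≤ T) : Comp P T :=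
  Enc.mono h hST

lemma Comp.congr {P P' : (W → Bool) → Prop} {S : ℕ} (h : Comp P S) (hP : ∀ x, P x ↔ P' x) :
    Comp P' S := by
  have : P = P' := funext fun x => propext (hP x)
  exact this ▸ h

lemma Comp.comap {P : (W → Bool) → Prop} {S : ℕ} (h : Comp P S) (f : W ↪ W') :
    Comp (fun x => P (x ∘ f)) S := by
  have h1 := Enc.lift h (f.sumMap (Function.Embedding.refl Unit))
  rwa [lift_multiXor] at h1

/-- A predicate of at most one bit: together with the target qubit, a single gate computes it. -/
lemma Comp.of_card (P : (W → Bool) → Prop) (hW : Fintype.card W ≤ 1) : Comp P 1 := by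
  have h := Circ.lift_unitary (Function.Embedding.refl (W ⊕ Unit))
    (permMat_mem_unitary (multiXor_involutive fun (_ : Unit) x => open Classical in decide (P x)))
    (by simp; omega)
  rw [lift_refl] at h
  exact h.enc

lemma Comp.const (p : Prop) : Comp (fun _ : W → Bool => p) 1 :=
  (Comp.of_card (fun _ : Empty → Bool => p) (by simp)).comap ⟨Empty.elim, fun x => x.elim⟩

lemma Comp.var (w : W) : Comp (fun x : W → Bool => x w = true) 1 :=
  (Comp.of_card (fun x : Unit → Bool => x () = true) (by simp)).comap ⟨fun _ => w, fun _ _ _ => rfl⟩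

lemma Comp.xor {P R : (W → Bool) → Prop} {S T : ℕ} (hP : Comp P S) (hR : Comp R T) :
    Comp (fun x => Xor (P x) (R x)) (S + T) := by
  classical
  have h := Enc.mul hP hR
  rw [permMat_mul_permMat] at h
  unfold Comp
  convert h using 2
  funext x w
  rcases w with w | q
  · rfl
  · simp only [Function.comp_apply, multiXor_inr]
    change _ = ((x (Sum.inr q) ^^ decide (R (x ∘ Sum.inl))) ^^ decide (P (x ∘ Sum.inl)))
    by_cases hp : P (x ∘ Sum.inl) <;> by_cases hr : R (x ∘ Sum.inl) <;> simp [hp, hr, Xor]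

lemma Comp.not {P : (W → Bool) → Prop} {S : ℕ} (hP : Comp P S) :
    Comp (fun x => ¬ P x) (S + 1) :=
  (hP.xor (Comp.const True)).congr fun x => by simp only [Xor]; tauto

lemma Comp.iff {P R : (W → Bool) → Prop} {S T : ℕ} (hP : Comp P S) (hR : Comp R T) :
    Comp (fun x => P x ↔ R x) (S + T + 1) :=
  (hP.xor hR).not.congr fun x => by simp only [Xor]; tauto

/-- With `V` a square root of `NOT`, the conjunction is computed by
`NOT^(P ∧ R) = V^P V^R (V†)^(P ⊕ R)`. -/
lemma Comp.and {P R : (W → Bool) → Prop} {S T : ℕ} (hP : Comp P S) (hR : Comp R T) :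
    Comp (fun x => P x ∧ R x) (4 * (S + T) + 6) := by
  classical
  have h1 := Enc.ctrl_of_xor hP sqrtNot_mem_unitary
  have h2 := Enc.ctrl_of_xor hR sqrtNot_mem_unitary
  have h3 := Enc.ctrl_of_xor (hP.xor hR) (Unitary.star_mem sqrtNot_mem_unitary)
  refine Enc.mono (S := 2 * S + 2 + (2 * T + 2) + (2 * (S + T) + 2)) ?_ (by omega)
  convert (h1.mul h2).mul h3 using 1
  rw [ctrl_mul, ctrl_mul, ctrl_permMat_xor]
  congr 1
  funext w
  have hid : permMat (fun (v : Unit → Bool) q => v q ^^ false) = 1 := by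
    rw [← permMat_id]; congr 1; funext v q; simp
  by_cases hp : P w <;> by_cases hr : R w
  · simpa [hp, hr, Xor] using sqrtNot_mul_self.symm
  · simpa [hp, hr, Xor, Matrix.star_eq_conjTranspose, sqrtNot_mul_conjTranspose] using hid
  · simpa [hp, hr, Xor, Matrix.star_eq_conjTranspose, sqrtNot_mul_conjTranspose] using hid
  · simpa [hp, hr, Xor] using hid

/-- Conjunctions are arranged in a balanced tree: uncomputing doubles the cost at every level, so
that a linear chain would be exponentially expensive. -/
lemma Comp.list_all {S : ℕ} (k : ℕ) (l : List ((W → Bool) → Prop)) (hl : l.length ≤ 2 ^ k)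
    (h : ∀ P ∈ l, Comp P S) : Comp (fun x => ∀ P ∈ l, P x) (8 ^ k * (S + 2) - 1) := by
  induction k generalizing l with
  | zero =>
    match l, hl, h with
    | [], _, _ => exact ((Comp.const True).congr fun x => by simp).mono (by simp)
    | [P], _, h => exact ((h P (by simp)).congr fun x => by simp).mono (by simp)
  | succ k ih =>
    have h1 := ih (l.take (2 ^ k)) (by simp) fun P hP => h P (List.mem_of_mem_take hP)
    have h2 := ih (l.drop (2 ^ k)) (by simp; rw [pow_succ] at hl; omega)
      fun P hP => h P (List.mem_of_mem_drop hP)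
    refine ((h1.and h2).congr fun x => ?_).mono ?_
    · constructor
      · rintro ⟨ha, hb⟩ P hP
        rw [← List.take_append_drop (2 ^ k) l, List.mem_append] at hP
        exact hP.elim (ha P) (hb P)
      · exact fun ha => ⟨fun P hP => ha P (List.mem_of_mem_take hP),
          fun P hP => ha P (List.mem_of_mem_drop hP)⟩
    · have : 0 < 8 ^ k * (S + 2) := by positivity
      rw [pow_succ, mul_right_comm]
      omega

/-- The cost of a conjunction or disjunction of `N` predicates of cost `S`. -/
def bigCost (N S : ℕ) : ℕ := (2 * (N + 1)) ^ 3 * (S + 3)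

lemma Comp.forall_aux {ι : Type*} [Fintype ι] {P : ι → (W → Bool) → Prop} {S : ℕ}
    (h : ∀ i, Comp (P i) S) :
    Comp (fun x => ∀ i, P i x) ((2 * (Fintype.card ι + 1)) ^ 3 * (S + 2) - 1) := by
  set N := Fintype.card ι
  have hlt : N < 2 ^ (Nat.log 2 N + 1) := Nat.lt_pow_succ_log_self (by norm_num) N
  have hle : 2 ^ (Nat.log 2 N + 1) ≤ 2 * (N + 1) := by
    rw [pow_succ, mul_comm]
    by_cases hN : N = 0
    · simp [hN]
    · have := Nat.pow_log_le_self 2 hN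
      omega
  refine ((Comp.list_all (S := S) (Nat.log 2 N + 1) (Finset.univ.toList.map P) ?_ ?_).congr ?_).mono ?_
  · simpa using hlt.le
  · simpa using h
  · intro x; simp
  · refine Nat.sub_le_sub_right (Nat.mul_le_mul_right _ ?_) 1
    rw [show (8 : ℕ) = 2 ^ 3 by norm_num, ← pow_mul, mul_comm 3, pow_mul]
    exact Nat.pow_le_pow_left hle 3

lemma Comp.forall {ι : Type*} [Fintype ι] {P : ι → (W → Bool) → Prop} {S : ℕ}
    (h : ∀ i, Comp (P i) S) : Comp (fun x => ∀ i, P i x) (bigCost (Fintype.card ι) S) :=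
  (Comp.forall_aux h).mono ((Nat.sub_le _ _).trans (Nat.mul_le_mul_left _ (by omega)))

lemma Comp.exists {ι : Type*} [Fintype ι] {P : ι → (W → Bool) → Prop} {S : ℕ}
    (h : ∀ i, Comp (P i) S) : Comp (fun x => ∃ i, P i x) (bigCost (Fintype.card ι) S) := by
  refine ((Comp.forall_aux fun i => (h i).not).not.congr fun x => by simp).mono ?_
  have : 0 < (2 * (Fintype.card ι + 1)) ^ 3 * (S + 1 + 2) := by positivity
  unfold bigCost
  rw [show S + 3 = S + 1 + 2 by ring]
  omega

lemma Comp.imp {P R : (W → Bool) → Prop} {S T : ℕ} (hP : Comp P S) (hR : Comp R T) :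
    Comp (fun x => P x → R x) (4 * (S + T) + 11) :=
  ((hP.and hR.not).not.congr fun x => by tauto).mono (by omega)

open Classical in
/-- Several predicates of the register `W` can be added to the qubits of another register. -/
lemma Enc.multiXor {F : Q → (W → Bool) → Prop} {S : ℕ} (h : ∀ q, Comp (F q) S) :
    Enc (permMat (multiXor fun q x => decide (F q x))) (Fintype.card Q * S) := by
  suffices H : ∀ s : Finset Q, Enc (permMat (SparseHamiltonian.multiXor fun q x =>
      decide (q ∈ s ∧ F q x))) (s.card * S) by
    simpa using H Finset.univ
  intro s
  induction s using Finset.induction_on with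
  | empty =>
    refine Enc.mono (S := 0) ?_ (Nat.zero_le _)
    convert Enc.one using 1
    · rw [← permMat_id]
      congr 1
      funext x w
      rcases w with w | q <;> simp [SparseHamiltonian.multiXor]
    · infer_instance
  | insert a s ha ih =>
    have h1 := Enc.lift (h a) ((Function.Embedding.refl W).sumMap
      ⟨fun _ : Unit => a, fun _ _ _ => rfl⟩)
    rw [lift_permMat] at h1
    rw [Finset.card_insert_of_notMem ha, Nat.succ_mul]
    convert ih.mul h1 using 1
    rw [permMat_mul_permMat]
    congr 1
    funext x
    rw [Function.comp_apply]
    set v := Function.extend ((Function.Embedding.refl W).sumMap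
      ⟨fun _ : Unit => a, fun _ _ _ => rfl⟩) (SparseHamiltonian.multiXor
        (fun (_ : Unit) x => decide (F a x)) (x ∘ (Function.Embedding.refl W).sumMap
          ⟨fun _ : Unit => a, fun _ _ _ => rfl⟩)) x with hv
    have hv := eq_extend_iff.1 hv
    have hinl : v ∘ Sum.inl = x ∘ Sum.inl := by
      funext w
      exact congrFun hv.1 (.inl w)
    funext w
    rcases w with w | q
    · exact (congrFun hinl w).symm
    · simp only [SparseHamiltonian.multiXor, Sum.elim_inr, hinl]
      by_cases hq : q = a
      · subst hq
        have h2 : v (.inr q) = (x (.inr q) ^^ decide (F q (x ∘ Sum.inl))) := congrFun hv.1 (.inr ())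
        simp [h2, ha]
      · have h2 : x (.inr q) = v (.inr q) := by
          refine hv.2 (.inr q) ?_
          rintro ⟨u | u, hu⟩
          · simp at hu
          · exact hq (Sum.inr.inj (show (Sum.inr a : W ⊕ Q) = .inr q from hu)).symm
        simp [← h2, hq]

open Classical in
/-- The projection onto the bit strings with a computable property is block encoded: the negated
predicate is added to an ancilla, which is then required to be zero. -/
lemma Comp.proj {P : (W → Bool) → Prop} {S : ℕ} (h : Comp P S) :
    Enc (Matrix.diagonal fun x : W → Bool => if P x then (1 : ℂ) else 0) (S + 2) := by
  have h1 := Enc.zeroBlock h.not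
  refine Enc.mono (T := S + 2) ?_ (S := S + 1 + Fintype.card Unit) (by simp)
  convert h1 using 1
  ext y x
  unfold SparseHamiltonian.zeroBlock permMat
  rw [Matrix.diagonal_apply, ← ite_and]
  by_cases hyx : y = x
  · subst hyx
    by_cases hp : P y
    · rw [if_pos ⟨rfl, hp⟩, if_pos]
      funext w
      rcases w with w | w
      · rfl
      · simp [multiXor_inr, padZero_inr, padZero_comp_inl, hp]
    · rw [if_neg (fun h => hp h.2), if_neg]
      intro hw
      have := congrFun hw (.inr ())
      simp [multiXor_inr, padZero_inr, padZero_comp_inl, hp] at this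
  · rw [if_neg (fun h => hyx h.1), if_neg]
    intro hw
    exact hyx (funext fun w => congrFun hw (.inl w))

end Comp

/-! ### Averaging over the outcomes of a measurement -/

section Mix

variable {A B C D V W : Type} [Fintype A] [DecidableEq A] [Fintype B] [DecidableEq B]
  [Fintype C] [DecidableEq C] [Fintype D] [DecidableEq D] [Fintype V] [DecidableEq V]
  [Fintype W] [DecidableEq W]

lemma extend_inr_elim (v r : V → Bool) (x : W → Bool) :
    Function.extend (Function.Embedding.inr : V ↪ W ⊕ V) v (Sum.elim x r) = Sum.elim x v := by
  symm
  rw [eq_extend_iff]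
  refine ⟨rfl, ?_⟩
  rintro (w | w) hw
  · rfl
  · exact absurd ⟨w, rfl⟩ hw

lemma conj_lift_inr_apply (c : Op V) (G : Op (W ⊕ V)) (y x : W → Bool) (s r : V → Bool) :
    ((lift Function.Embedding.inr c).conjTranspose * G * lift Function.Embedding.inr c : Op (W ⊕ V))
      (Sum.elim y s) (Sum.elim x r) =
      ∑ ρ, ∑ ρ', star (c ρ' s) * G (Sum.elim y ρ') (Sum.elim x ρ) * c ρ r := by
  rw [mul_lift_apply]
  refine Finset.sum_congr rfl fun ρ _ => ?_
  rw [← lift_conjTranspose, lift_mul_apply, extend_inr_elim, Finset.sum_mul]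
  refine Finset.sum_congr rfl fun ρ' _ => ?_
  rw [extend_inr_elim]
  rfl

/-- A controlled operator that reads the registers `D` and `B` and acts on `V`, extended by the
identity to the registers `A` and `C`. -/
lemma lift_ctrl_apply (g : (D ⊕ B → Bool) → Op V) (h : (D ⊕ B) ⊕ V ↪ (D ⊕ V) ⊕ (A ⊕ (B ⊕ C)))
    (h1 : ∀ d, h (.inl (.inl d)) = .inl (.inl d)) (h2 : ∀ b, h (.inl (.inr b)) = .inr (.inr (.inl b)))
    (h3 : ∀ v, h (.inr v) = .inl (.inr v)) (d' d : D → Bool) (v' v : V → Bool)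
    (ρ' ρ : A ⊕ (B ⊕ C) → Bool) :
    lift h (ctrl g) (Sum.elim (Sum.elim d' v') ρ') (Sum.elim (Sum.elim d v) ρ) =
      if ρ' = ρ then if d' = d then g (Sum.elim d fun b => ρ (.inr (.inl b))) v' v else 0 else 0 := by
  have hh : ∀ (d : D → Bool) (v : V → Bool) (ρ : A ⊕ (B ⊕ C) → Bool),
      (Sum.elim (Sum.elim d v) ρ) ∘ h = Sum.elim (Sum.elim d fun b => ρ (.inr (.inl b))) v := by
    intro d v ρ
    funext w
    rcases w with (w | w) | w <;> simp [h1, h2, h3]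
  rw [lift, hh, hh, ctrl_elim]
  by_cases hρ : ρ' = ρ
  · subst hρ
    rw [if_pos rfl, if_pos]
    · exact ite_congr_inst (by rw [Sum.elim_eq_iff]; simp) rfl rfl
    · rintro ((w | w) | w) hw
      · exact absurd ⟨_, h1 w⟩ hw
      · exact absurd ⟨_, h3 w⟩ hw
      · rfl
  · rw [if_neg hρ]
    by_cases hd : d' = d ∧ (fun b => ρ' (.inr (.inl b))) = fun b => ρ (.inr (.inl b))
    · rw [if_neg]
      intro hw
      apply hρ
      funext w
      rcases w with w | w | w
      · refine hw (.inr (.inl w)) ?_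
        rintro ⟨(u | u) | u, hu⟩ <;> simp [h1, h2, h3] at hu
      · exact congrFun hd.2 w
      · refine hw (.inr (.inr (.inr w))) ?_
        rintro ⟨(u | u) | u, hu⟩ <;> simp [h1, h2, h3] at hu
    · rw [if_neg (c := _ = _), ite_self]
      rw [Sum.elim_eq_iff]
      exact hd

/-- Let a circuit produce `z` from `i` with probability `p i z`. Computing `z`, applying an operator
controlled by `z`, and uncomputing `z`, block encodes the average of that operator: the
superposition of all outcomes `z` and of the workspace is undone when the ancillas are required to
return to zero. -/
theorem Enc.mix {c : Op (A ⊕ (B ⊕ C))} {k : ℕ} (hc : Circ c k) (a : A ↪ D)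
    {g : (D ⊕ B → Bool) → Op V} {S : ℕ} (hg : Enc (ctrl g) S) :
    Enc (ctrl fun i : D → Bool => ∑ z, (outcomeProb c (i ∘ a) z : ℂ) • g (Sum.elim i z))
      (S + (3 * Fintype.card (A ⊕ (B ⊕ C)) + 2 * k)) := by
  classical
  -- the input of `c` is copied to fresh qubits, since `c` may destroy it
  let F : A ⊕ (B ⊕ C) → (D ⊕ V → Bool) → Prop :=
    Sum.elim (fun q x => x (.inl (a q)) = true) fun _ _ => False
  have hF : ∀ q, Comp (F q) 1 := by
    rintro (q | q)
    · exact Comp.var (Sum.inl (a q))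
    · exact Comp.const False
  have hP := Enc.multiXor hF
  let h : (D ⊕ B) ⊕ V ↪ (D ⊕ V) ⊕ (A ⊕ (B ⊕ C)) :=
    ⟨Sum.elim (Sum.elim (fun d => .inl (.inl d)) fun b => .inr (.inr (.inl b)))
      fun v => .inl (.inr v), by
      rintro ((u | u) | u) ((v | v) | v) huv <;> simp at huv <;> simp [huv]⟩
  have hN := hc.lift (Function.Embedding.inr : A ⊕ (B ⊕ C) ↪ (D ⊕ V) ⊕ (A ⊕ (B ⊕ C)))
  have hG := hg.lift h
  have H := ((hP.mul ((hN.conjTranspose.enc.mul hG).mul hN.enc)).mul hP).zeroBlock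
  refine Enc.mono (S := Fintype.card (A ⊕ (B ⊕ C)) * 1 + (k + S + k) +
    Fintype.card (A ⊕ (B ⊕ C)) * 1 + Fintype.card (A ⊕ (B ⊕ C))) ?_ (by omega)
  convert H using 1
  refine Op.ext_sum fun d' v' d v => ?_
  rw [SparseHamiltonian.zeroBlock, mul_permMat_apply, permMat_mul_apply (multiXor_involutive _)]
  have hpad : ∀ (d : D → Bool) (v : V → Bool),
      SparseHamiltonian.multiXor (fun q x => decide (F q x))
        (padZero (A ⊕ (B ⊕ C)) (Sum.elim d v)) =
      Sum.elim (Sum.elim d v) (Sum.elim (d ∘ a) fun _ => false) := by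
    intro d v
    funext w
    rcases w with w | w | w
    · rfl
    all_goals
      rw [multiXor_inr, padZero_inr, padZero_comp_inl, Bool.false_xor, Bool.eq_iff_iff,
        decide_eq_true_iff]
      simp [F]
  -- `c† g c` is summed over the states `ρ`, `ρ'` after the run; `g` is diagonal in these
  rw [hpad, hpad, conj_lift_inr_apply, ctrl_elim]
  simp only [lift_ctrl_apply g h (fun _ => rfl) (fun _ => rfl) (fun _ => rfl), mul_ite, ite_mul,
    mul_zero, zero_mul, Finset.sum_ite_eq', Finset.mem_univ, if_true]
  by_cases hd : d' = d
  · subst hd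
    simp only [if_true, outcomeProb, Matrix.sum_apply, Matrix.smul_apply, smul_eq_mul,
      sum_sum_type, Sum.elim_inr, Sum.elim_inl]
    rw [Finset.sum_comm]
    refine Finset.sum_congr rfl fun z _ => ?_
    push_cast
    rw [Finset.sum_mul]
    refine Finset.sum_congr rfl fun α _ => ?_
    rw [Finset.sum_mul]
    refine Finset.sum_congr rfl fun β _ => ?_
    rw [← Complex.conj_mul']
    simp only [starRingEnd_apply]
    ring
  · simp [hd]

/-- `Enc.mix` for independent runs of the circuit. -/
theorem Enc.mix_runs {c : Op (A ⊕ (B ⊕ C))} {k : ℕ} (hc : Circ c k) (a : A ↪ D) (K : ℕ)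
    {g : (D ⊕ Fin K × B → Bool) → Op V} {S : ℕ} (hg : Enc (ctrl g) S) :
    Enc (ctrl fun i : D → Bool => ∑ z : Fin K × B → Bool,
        ((∏ m, outcomeProb c (i ∘ a) (fun b => z (m, b)) : ℝ) : ℂ) • g (Sum.elim i z))
      (S + K * (3 * Fintype.card (A ⊕ (B ⊕ C)) + 2 * k)) := by
  induction K generalizing S with
  | zero =>
    have h := hg.lift ((Equiv.sumCongr (Equiv.sumEmpty D (Fin 0 × B)) (Equiv.refl V)).toEmbedding)
    refine Enc.mono (S := S) ?_ (by omega)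
    convert h using 1
    refine Op.ext_sum fun d' v' d v => ?_
    rw [lift_equiv_apply, ctrl_elim]
    simp only [Finset.univ_eq_empty, Finset.prod_empty, Complex.ofReal_one, one_smul,
      Matrix.sum_apply]
    have hz : ∀ (d : D → Bool) (v : V → Bool) (z : Fin 0 × B → Bool),
        Sum.elim d v ∘ (Equiv.sumCongr (Equiv.sumEmpty D (Fin 0 × B)) (Equiv.refl V)) =
          Sum.elim (Sum.elim d z) v := by
      intro d v z
      funext w
      rcases w with (w | w) | w
      · rfl
      · exact w.1.elim0
      · rfl
    rw [hz d v default, hz d' v' default, ctrl_elim, Fintype.sum_unique]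
    exact ite_congr_inst (by rw [Sum.elim_eq_iff]; simp)
      (congrArg (fun z => g (Sum.elim d z) v' v) (Subsingleton.elim _ _)) rfl
  | succ K ih =>
    let e : (D ⊕ Fin (K + 1) × B) ⊕ V ≃ ((D ⊕ Fin K × B) ⊕ B) ⊕ V :=
      Equiv.sumCongr (((Equiv.refl D).sumCongr
        (((finSuccEquiv K).trans (Equiv.optionEquivSumPUnit.{0} (Fin K))).prodCongr (Equiv.refl B) |>.trans
          ((Equiv.sumProdDistrib _ _ _).trans
            ((Equiv.refl _).sumCongr (Equiv.punitProd B))))).trans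
          (Equiv.sumAssoc _ _ _).symm) (Equiv.refl V)
    let cons : (Fin K × B → Bool) → (B → Bool) → Fin (K + 1) × B → Bool :=
      fun z z₀ q => Fin.cases (z₀ q.2) (fun m => z (m, q.2)) q.1
    have h1 := hg.lift e.toEmbedding
    have h2 : Enc (ctrl fun w : (D ⊕ Fin K × B) ⊕ B → Bool =>
        g (Sum.elim (fun d => w (.inl (.inl d)))
          (cons (fun q => w (.inl (.inr q))) fun b => w (.inr b)))) S := by
      convert h1 using 1
      refine Op.ext_sum fun w' v' w v => ?_
      have he : ∀ (w : (D ⊕ Fin K × B) ⊕ B → Bool) (v : V → Bool), Sum.elim w v ∘ e =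
          Sum.elim (Sum.elim (fun d => w (.inl (.inl d)))
            (cons (fun q => w (.inl (.inr q))) fun b => w (.inr b))) v := by
        intro w v
        funext u
        rcases u with (u | ⟨m, u⟩) | u
        · rfl
        · refine Fin.cases ?_ (fun m => ?_) m <;> rfl
        · rfl
      rw [lift_equiv_apply, ctrl_elim, he, he, ctrl_elim]
      refine ite_congr_inst ?_ rfl rfl
      constructor
      · rintro rfl; rfl
      · intro h
        rw [Sum.elim_eq_iff] at h
        funext u
        rcases u with (u | ⟨m, u⟩) | u
        · exact congrFun h.1 u
        · exact congrFun h.2 (m.succ, u)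
        · exact congrFun h.2 (0, u)
    have h3 := ih (h2.mix hc (a.trans Function.Embedding.inl))
    refine Enc.mono (S := S + (3 * Fintype.card (A ⊕ (B ⊕ C)) + 2 * k) +
      K * (3 * Fintype.card (A ⊕ (B ⊕ C)) + 2 * k)) ?_ (by ring_nf; omega)
    convert h3 using 1
    congr 1
    funext i
    let E : (Fin (K + 1) × B → Bool) ≃ (Fin K × B → Bool) × (B → Bool) :=
      { toFun := fun z => (fun q => z (q.1.succ, q.2), fun b => z (0, b))
        invFun := fun p => cons p.1 p.2
        left_inv := fun z => by
          funext ⟨m, b⟩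
          refine Fin.cases ?_ (fun m => ?_) m <;> rfl
        right_inv := fun p => rfl }
    rw [← E.symm.sum_comp, Fintype.sum_prod_type]
    refine Finset.sum_congr rfl fun z _ => ?_
    rw [Finset.smul_sum]
    refine Finset.sum_congr rfl fun z₀ _ => ?_
    rw [Fin.prod_univ_succ, smul_smul, mul_comm, Complex.ofReal_mul]
    rfl

end Mix

/-! ### Small rotations generated by a block encoded operator -/

section Rotation

variable {V W : Type} [Fintype V] [DecidableEq V] [Fintype W] [DecidableEq W]

/-- The Hadamard gate. -/
noncomputable def hadamard : Op Unit :=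
  fun y x => (if y () ∧ x () then -1 else 1) * ((√2)⁻¹ : ℝ)

/-- The rotation `exp(-iθ(u|0⟩⟨1| + ū|1⟩⟨0|))` of one qubit, for `|u| = 1`. -/
noncomputable def rot (θ : ℝ) (u : ℂ) : Op Unit :=
  fun y x => if y () = x () then (Real.cos θ : ℂ)
    else -(Complex.I * Real.sin θ) * (if x () then u else star u)

lemma hadamard_mem_unitary : hadamard ∈ Matrix.unitaryGroup (Unit → Bool) ℂ := by
  rw [Matrix.mem_unitaryGroup_iff, Matrix.star_eq_conjTranspose]
  refine Op.ext_unit fun a b => ?_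
  have h : (1 : Op Unit) (fun _ => a) (fun _ => b) = if a = b then 1 else 0 := by
    rw [Matrix.one_apply]
    exact ite_congr_inst funUnit_eq_iff rfl rfl
  have h2 : (((√2)⁻¹ : ℝ) : ℂ) * ((√2)⁻¹ : ℝ) = 1 / 2 := by
    rw [← Complex.ofReal_mul, ← mul_inv, Real.mul_self_sqrt (by norm_num)]
    norm_num
  rw [Matrix.mul_apply, sum_unit_type, h]
  simp only [Matrix.conjTranspose_apply, hadamard, star_mul', Complex.star_def, Complex.conj_ofReal]
  simp only [Complex.ofReal_inv] at h2
  cases a <;> cases b <;> simp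
  all_goals linear_combination 2 * h2

lemma rot_mem_unitary (θ : ℝ) {u : ℂ} (hu : u * star u = 1) :
    rot θ u ∈ Matrix.unitaryGroup (Unit → Bool) ℂ := by
  rw [Matrix.mem_unitaryGroup_iff, Matrix.star_eq_conjTranspose]
  refine Op.ext_unit fun a b => ?_
  have h : (1 : Op Unit) (fun _ => a) (fun _ => b) = if a = b then 1 else 0 := by
    rw [Matrix.one_apply]
    exact ite_congr_inst funUnit_eq_iff rfl rfl
  have hcs : (Real.cos θ : ℂ) ^ 2 + (Real.sin θ : ℂ) ^ 2 = 1 := by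
    exact_mod_cast congrArg (fun x : ℝ => (x : ℂ)) (Real.cos_sq_add_sin_sq θ)
  have hI := Complex.I_sq
  rw [Matrix.mul_apply, sum_unit_type, h]
  simp only [Matrix.conjTranspose_apply, rot, apply_ite star, star_mul', star_neg, Complex.star_def,
    Complex.conj_ofReal, Complex.conj_I, Complex.conj_conj] at hu ⊢
  cases a <;> cases b <;> simp [-Complex.ofReal_cos, -Complex.ofReal_sin]
  · linear_combination hcs - (Real.sin θ : ℂ) ^ 2 * u * (starRingEnd ℂ) u * hI +
      (Real.sin θ : ℂ) ^ 2 * hu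
  · ring
  · ring
  · linear_combination hcs - (Real.sin θ : ℂ) ^ 2 * u * (starRingEnd ℂ) u * hI +
      (Real.sin θ : ℂ) ^ 2 * hu

lemma lift_inl_elim (A : Op V) (y x : V → Bool) (y' x' : W → Bool) :
    lift (Function.Embedding.inl : V ↪ V ⊕ W) A (Sum.elim y y') (Sum.elim x x') =
      if y' = x' then A y x else 0 := by
  rw [lift_inl_apply]
  exact ite_congr_inst Iff.rfl rfl rfl

lemma lift_inr_elim (A : Op W) (y x : V → Bool) (y' x' : W → Bool) :
    lift (Function.Embedding.inr : W ↪ V ⊕ W) A (Sum.elim y y') (Sum.elim x x') =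
      if y = x then A y' x' else 0 := by
  unfold lift
  refine ite_congr_inst ⟨fun h => ?_, ?_⟩ rfl rfl
  · funext v
    exact h (.inl v) (by simp)
  · rintro rfl (w | v) hw
    · rfl
    · exact absurd ⟨v, rfl⟩ hw

/-- If a unitary has a diagonal entry `1`, then the rest of that column vanishes. -/
lemma unitary_column {ι : Type*} [Fintype ι] [DecidableEq ι] {C : Matrix ι ι ℂ}
    (hC : C ∈ Matrix.unitaryGroup ι ℂ) {x : ι} (hx : C x x = 1) (y : ι) :
    C y x = if y = x then 1 else 0 := by
  split_ifs with hy
  · rw [hy, hx]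
  · have h1 := congrFun (congrFun (Matrix.mem_unitaryGroup_iff'.1 hC) x) x
    rw [Matrix.star_eq_conjTranspose, Matrix.mul_apply, Matrix.one_apply_eq,
      ← Finset.add_sum_erase _ _ (Finset.mem_univ x)] at h1
    simp only [Matrix.conjTranspose_apply, hx, star_one, mul_one, add_eq_left] at h1
    have h2 : ∑ z ∈ Finset.univ.erase x, ‖C z x‖ ^ 2 = 0 := by
      have : ((∑ z ∈ Finset.univ.erase x, ‖C z x‖ ^ 2 : ℝ) : ℂ) = 0 := by
        rw [← h1]
        push_cast
        refine Finset.sum_congr rfl fun z _ => ?_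
        rw [← Complex.conj_mul', starRingEnd_apply]
      exact_mod_cast this
    have h3 := (Finset.sum_eq_zero_iff_of_nonneg fun z _ => by positivity).1 h2 y (by simp [hy])
    simpa using h3

/-- The bit string `y` with the qubit `w` flipped if `b` holds. -/
def flipAt (w : W) (b : Bool) (y : W → Bool) : W → Bool := Function.update y w (y w ^^ b)

lemma flipAt_flipAt (w : W) (b : Bool) (y : W → Bool) : flipAt w b (flipAt w b y) = y := by
  simp [flipAt]

/-- If `M`, controlled by a qubit, is block encoded by `C`, then `C† R C` with a rotation `R` of the
control qubit, started in `|+⟩` and required to return to it, block encodes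
`cos θ - i sin θ G`, where `G` is the Hermitian part of `u M`.

The control of `C` is a copy of the qubit `q` that is rotated, made before and removed after `C`.
Thus `C` cannot change `q`, even where its ancillas do not return to zero. -/
theorem Enc.rotation {M : Op W} {S : ℕ}
    (h : Enc (ctrl fun e : Unit → Bool => if e () then M else 1) S) (θ : ℝ) {u : ℂ}
    (hu : u * star u = 1) :
    Enc ((Real.cos θ : ℂ) • (1 : Op W) -
      (Complex.I * Real.sin θ / 2) • (u • M + star u • M.conjTranspose)) (2 * S + 9) := by
  obtain ⟨A, _, _, C, k, hC, hS, hCM⟩ := h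
  let Y := (Unit ⊕ W) ⊕ A
  let q : Y := .inl (.inl ())
  let g : (Unit → Bool) → Op Y := fun a y x => C (flipAt q (a ()) y) (flipAt q (a ()) x)
  have hN : Circ (ctrl g) (1 + k + 1) := by
    let j : Unit ⊕ Unit ↪ Unit ⊕ Y := (Function.Embedding.refl Unit).sumMap ⟨fun _ => q, fun _ _ _ => rfl⟩
    let F : Unit → (Unit → Bool) → Bool := fun _ x => x ()
    have h1 : Circ (SparseHamiltonian.lift j (permMat (SparseHamiltonian.multiXor F))) 1 :=
      Circ.lift_unitary j (permMat_mem_unitary (multiXor_involutive _)) (by simp)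
    have h2 := (h1.mul (hC.lift (Function.Embedding.inr : Y ↪ Unit ⊕ Y))).mul h1
    convert h2 using 1
    have hτ : ∀ (a : Unit → Bool) (y : Y → Bool),
        Function.extend j (SparseHamiltonian.multiXor F ((Sum.elim a y) ∘ j)) (Sum.elim a y) =
          Sum.elim a (flipAt q (a ()) y) := by
      intro a y
      symm
      rw [eq_extend_iff]
      constructor
      · funext w
        rcases w with w | w
        · rfl
        · change flipAt q (a ()) y q = _
          rw [flipAt, Function.update_self]
          rfl
      · rintro (w | w) hw
        · rfl
        · simp only [Sum.elim_inr, flipAt]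
          rw [Function.update_of_ne]
          rintro rfl
          exact hw ⟨.inr (), rfl⟩
    refine Op.ext_sum fun a' y' a y => ?_
    rw [lift_permMat, mul_permMat_apply, permMat_mul_apply, hτ, hτ, ctrl_elim, lift_inr_elim]
    · by_cases ha : a' = a
      · subst ha; rfl
      · rw [if_neg ha, if_neg ha]
    · intro x
      rw [← Sum.elim_comp_inl_inr x]
      simp only [hτ, flipAt_flipAt]
  have hT := hN.mul ((Circ.lift_unitary (Function.Embedding.refl Unit) hadamard_mem_unitary
    (by simp)).lift (Function.Embedding.inl : Unit ↪ Unit ⊕ Y))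
  have hR := (Circ.lift_unitary (Function.Embedding.refl Unit) (rot_mem_unitary θ hu)
    (by simp)).lift (Function.Embedding.inl : Unit ↪ Unit ⊕ Y)
  rw [lift_refl] at hT hR
  set T : Op (Unit ⊕ Y) := ctrl g * SparseHamiltonian.lift Function.Embedding.inl hadamard with hTdef
  let e : Unit ⊕ Y ≃ W ⊕ (Unit ⊕ (Unit ⊕ A)) :=
    { toFun := Sum.elim (fun _ => .inr (.inl ()))
        (Sum.elim (Sum.elim (fun _ => .inr (.inr (.inl ()))) .inl) fun a => .inr (.inr (.inr a)))
      invFun := Sum.elim (fun w => .inr (.inl (.inr w))) (Sum.elim .inl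
        (Sum.elim (fun _ => .inr (.inl (.inl ()))) fun a => .inr (.inr a)))
      left_inv := by rintro (w | (w | w) | w) <;> rfl
      right_inv := by rintro (w | w | w | w) <;> rfl }
  refine ⟨Unit ⊕ (Unit ⊕ A), inferInstance, inferInstance, _, _,
    ((hT.conjTranspose.mul hR).mul hT).lift e.toEmbedding, by simp; omega, ?_⟩
  -- the initial state of `Y`, for `x` in the register `W`
  let p : (W → Bool) → Y → Bool := fun x => padZero A (Sum.elim (fun _ => false) x)
  have hpe : ∀ x, padZero (Unit ⊕ (Unit ⊕ A)) x ∘ e = Sum.elim (fun _ => false) (p x) := by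
    intro x
    funext w
    rcases w with w | (w | w) | w <;> rfl
  have hpf : ∀ x, flipAt q true (p x) = padZero A (Sum.elim (fun _ => true) x) := by
    intro x
    funext w
    rcases w with (w | w) | w
    · simp [flipAt, q, p, padZero]
    · exact Function.update_of_ne (a := Sum.inl (Sum.inr w)) (by simp [q]) _ _
    · exact Function.update_of_ne (a := Sum.inr w) (by simp [q]) _ _
  have hff : ∀ y : Y → Bool, flipAt q false y = y := by intro y; simp [flipAt]
  have hCu := hC.mem_unitary
  have hcol : ∀ (y : Y → Bool) x, C y (p x) = if y = p x then 1 else 0 := by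
    intro y x
    refine unitary_column hCu ?_ y
    have := congrFun (congrFun hCM (Sum.elim (fun _ => false) x)) (Sum.elim (fun _ => false) x)
    rw [ctrl_elim] at this
    simpa [SparseHamiltonian.zeroBlock] using this
  have hK : ∀ y x, C (flipAt q true (p y)) (flipAt q true (p x)) = M y x := by
    intro y x
    have := congrFun (congrFun hCM (Sum.elim (fun _ => true) y)) (Sum.elim (fun _ => true) x)
    rw [ctrl_elim] at this
    rw [hpf, hpf]
    simpa [SparseHamiltonian.zeroBlock] using this
  have hTap : ∀ a y x, T (Sum.elim a y) (Sum.elim (fun _ => false) (p x)) =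
      g a y (p x) * ((√2)⁻¹ : ℝ) := by
    intro a y x
    rw [hTdef, Matrix.mul_apply, sum_sum_type, Finset.sum_eq_single a]
    · simp only [ctrl_elim, lift_inl_elim, if_true]
      rw [Finset.sum_eq_single (p x)]
      · simp [hadamard]
      · intro z _ hz; simp [hz]
      · simp
    · intro b _ hb
      refine Finset.sum_eq_zero fun z _ => ?_
      rw [ctrl_elim, if_neg (Ne.symm hb), zero_mul]
    · simp
  let G : (Unit → Bool) → (Unit → Bool) → Op Y := fun a' a y x =>
    ∑ z, star (C (flipAt q (a' ()) z) (flipAt q (a' ()) y)) *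
      C (flipAt q (a ()) z) (flipAt q (a ()) x)
  have hTT : ∀ a' a (y x : W → Bool), (∑ z, star (T (Sum.elim a' z) (Sum.elim (fun _ => false) (p y))) *
      T (Sum.elim a z) (Sum.elim (fun _ => false) (p x))) =
        (1 / 2 : ℂ) * G a' a (p y) (p x) := by
    intro a' a y x
    have h2 : (((√2)⁻¹ : ℝ) : ℂ) * ((√2)⁻¹ : ℝ) = 1 / 2 := by
      rw [← Complex.ofReal_mul, ← mul_inv, Real.mul_self_sqrt (by norm_num)]
      norm_num
    rw [Finset.mul_sum]
    refine Finset.sum_congr rfl fun z _ => ?_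
    rw [hTap, hTap, star_mul', Complex.star_def, Complex.conj_ofReal,
      ← h2]
    ring
  have hsum : ∀ F : (Y → Bool) → ℂ, ∑ z, F (flipAt q true z) = ∑ z, F z := fun F =>
    Equiv.sum_comp (Function.Involutive.toPerm (flipAt q true) (flipAt_flipAt q true)) F
  have hunit : ∀ y x : W → Bool, ∑ z, star (C z (p y)) * C z (p x) = if y = x then 1 else 0 := by
    intro y x
    simp only [hcol]
    rw [Finset.sum_eq_single (p y)]
    · simp only [if_true, star_one, one_mul]
      refine ite_congr_inst ⟨fun h => ?_, fun h => by rw [h]⟩ rfl rfl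
      funext w
      exact congrFun h (.inl (.inr w))
    · intro z _ hz; simp [hz]
    · simp
  have h00 : ∀ y x, G (fun _ => false) (fun _ => false) (p y) (p x) =
      if y = x then 1 else 0 := by
    intro y x
    simp only [G, hff]
    exact hunit y x
  have h11 : ∀ y x, G (fun _ => true) (fun _ => true) (p y) (p x) =
      if y = x then 1 else 0 := by
    intro y x
    simp only [G]
    rw [hsum fun z => star (C z (flipAt q true (p y))) * C z (flipAt q true (p x))]
    have := congrFun (congrFun (Matrix.mem_unitaryGroup_iff'.1 hCu) (flipAt q true (p y)))
      (flipAt q true (p x))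
    rw [Matrix.star_eq_conjTranspose, Matrix.mul_apply, Matrix.one_apply] at this
    refine this.trans (ite_congr_inst ⟨fun h => ?_, fun h => by rw [h]⟩ rfl rfl)
    funext w
    have h2 := congrArg (flipAt q true) h
    rw [flipAt_flipAt, flipAt_flipAt] at h2
    exact congrFun h2 (.inl (.inr w))
  have h01 : ∀ y x, G (fun _ => false) (fun _ => true) (p y) (p x) = M y x := by
    intro y x
    simp only [G, hff, hcol]
    rw [Finset.sum_eq_single (p y)]
    · simp [hK]
    · intro z _ hz; simp [hz]
    · simp
  have h10 : ∀ y x, G (fun _ => true) (fun _ => false) (p y) (p x) =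
      star (M x y) := by
    intro y x
    simp only [G, hff, hcol]
    rw [Finset.sum_eq_single (p x)]
    · simp [hK]
    · intro z _ hz; simp [hz]
    · simp
  ext y x
  rw [SparseHamiltonian.zeroBlock, lift_equiv_apply, hpe, hpe, Matrix.mul_assoc, Matrix.mul_apply]
  simp only [Matrix.mul_apply, Finset.mul_sum, Matrix.conjTranspose_apply]
  have hmain : (∑ z', ∑ z, star (T z' (Sum.elim (fun _ => false) (p y))) *
      (SparseHamiltonian.lift Function.Embedding.inl (rot θ u) z' z * T z (Sum.elim (fun _ => false) (p x)))) =
      ∑ a', ∑ a, rot θ u a' a * ∑ z, star (T (Sum.elim a' z) (Sum.elim (fun _ => false) (p y))) *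
        T (Sum.elim a z) (Sum.elim (fun _ => false) (p x)) := by
    rw [sum_sum_type]
    refine Finset.sum_congr rfl fun a' _ => ?_
    rw [Finset.sum_comm, sum_sum_type]
    refine Finset.sum_congr rfl fun a _ => ?_
    rw [Finset.mul_sum]
    refine Finset.sum_congr rfl fun z _ => ?_
    rw [Finset.sum_eq_single z]
    · rw [lift_inl_elim, if_pos rfl]; ring
    · intro w _ hw
      rw [lift_inl_elim, if_neg hw]; ring
    · simp
  rw [hmain]
  simp only [hTT, sum_unit_type, h00, h01, h10, h11, rot, Matrix.sub_apply, Matrix.smul_apply,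
    Matrix.add_apply, Matrix.one_apply, smul_eq_mul, Matrix.conjTranspose_apply]
  simp
  split_ifs <;> ring

end Rotation

/-! ### Walking along the entries of a row -/

section Step

variable {A B C D Z V W : Type} [Fintype A] [DecidableEq A] [Fintype B] [DecidableEq B]
  [Fintype C] [DecidableEq C] [Fintype D] [DecidableEq D] [Fintype V] [DecidableEq V]
  [Fintype W] [DecidableEq W] [Fintype Z] [DecidableEq Z]

/-- Bitwise addition modulo two. -/
def xorB (x y : D → Bool) : D → Bool := fun q => x q ^^ y q

lemma xorB_left_cancel (x y : D → Bool) : xorB x (xorB x y) = y := by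
  funext q; simp [xorB]

lemma eq_xorB_iff {x y z : D → Bool} : x = xorB y z ↔ z = xorB y x := by
  constructor
  · rintro rfl; rw [xorB_left_cancel]
  · rintro rfl; rw [xorB_left_cancel]

lemma xorB_comm (x y : D → Bool) : xorB x y = xorB y x := by
  funext q; simp [xorB, Bool.xor_comm]

lemma xorB_zero (x : D → Bool) : xorB x (fun _ => false) = x := by
  funext q; simp [xorB]

/-- The operator on registers `D`, control qubit, `D` which, if the control qubit is set, takes
`|i⟩|d⟩` to `∑ j, p i j |i⟩|d ⊕ i ⊕ j⟩`. Writing down the difference `i ⊕ j` makes it easy to go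
from `i` to `j` and back. -/
noncomputable def rowOp (p : (D → Bool) → (D → Bool) → ℝ) : Op (D ⊕ (Unit ⊕ D)) :=
  ctrl fun i => ctrl fun e => if e () then (fun d' d => (p i (xorB i (xorB d d')) : ℂ)) else 1

lemma rowOp_apply_true (p : (D → Bool) → (D → Bool) → ℝ) (i' i d' d : D → Bool) (e' : Unit → Bool) :
    rowOp p (Sum.elim i' (Sum.elim e' d')) (Sum.elim i (Sum.elim (fun _ => true) d)) =
      if i' = i then if e' = (fun _ => true) then (p i (xorB i (xorB d d')) : ℂ) else 0 else 0 := by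
  rw [rowOp, ctrl_elim]
  refine ite_congr_inst Iff.rfl ?_ rfl
  rw [ctrl_elim]
  exact ite_congr_inst Iff.rfl rfl rfl

lemma rowOp_apply_false (p : (D → Bool) → (D → Bool) → ℝ) (i' i d' d : D → Bool) (e' : Unit → Bool) :
    rowOp p (Sum.elim i' (Sum.elim e' d')) (Sum.elim i (Sum.elim (fun _ => false) d)) =
      if i' = i then if e' = (fun _ => false) then if d' = d then 1 else 0 else 0 else 0 := by
  rw [rowOp, ctrl_elim]
  refine ite_congr_inst Iff.rfl ?_ rfl
  rw [ctrl_elim]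
  refine ite_congr_inst Iff.rfl ?_ rfl
  simp [Matrix.one_apply]

lemma Enc.permMat_xorB : Enc (permMat fun x : D ⊕ (Unit ⊕ D) → Bool =>
    Sum.elim (xorB (x ∘ Sum.inl) (x ∘ Sum.inr ∘ Sum.inr)) (x ∘ Sum.inr)) (Fintype.card D) := by
  have h := (Enc.multiXor (Q := D) (F := fun q (x : Unit ⊕ D → Bool) => x (.inr q) = true)
    fun q => Comp.var (Sum.inr q : Unit ⊕ D)).lift (Equiv.sumComm (Unit ⊕ D) D).toEmbedding
  rw [lift_permMat, mul_one] at h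
  convert h using 2
  funext x
  rw [eq_extend_iff]
  refine ⟨?_, fun w hw => absurd ⟨(Equiv.sumComm (Unit ⊕ D) D).symm w, by simp⟩ hw⟩
  funext w
  rcases w with (w | w) | w
  · rfl
  · rfl
  · rw [multiXor_inr, Bool.eq_iff_iff]
    simp [xorB]

/-- Going from `i` to `j` with weight `p i j` and checking with weight `p' j i` that the way back
leads to `i`: the difference `i ⊕ j` is first written down, then added to `i`, and finally erased,
now that the first register contains `j`. Controlled by a qubit. -/
theorem Enc.walk {p p' : (D → Bool) → (D → Bool) → ℝ} {S T : ℕ} (hp : Enc (rowOp p) S)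
    (hp' : Enc (rowOp p') T) :
    Enc (ctrl fun e : Unit → Bool => if e () then (fun j i => ((p' j i * p i j : ℝ) : ℂ)
      : Op D) else 1) (S + T + 2 * Fintype.card D) := by
  let e : D ⊕ (Unit ⊕ D) ≃ (Unit ⊕ D) ⊕ D :=
    (Equiv.sumAssoc D Unit D).symm.trans ((Equiv.sumComm D Unit).sumCongr (Equiv.refl D))
  have H := (((hp'.mul Enc.permMat_xorB).mul hp).lift e.toEmbedding).zeroBlock
  refine Enc.mono (S := T + Fintype.card D + S + Fintype.card D) ?_ (by omega)
  convert H using 1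
  refine Op.ext_sum fun e' j ε i => ?_
  have hpe : ∀ (e' : Unit → Bool) (j : D → Bool), padZero D (Sum.elim e' j) ∘ e =
      Sum.elim j (Sum.elim e' fun _ => false) := by
    intro e' j
    funext w
    rcases w with w | w | w <;> rfl
  rw [SparseHamiltonian.zeroBlock, lift_equiv_apply, hpe, hpe, Matrix.mul_apply, sum_sum_type]
  simp only [sum_sum_type (W := Unit)]
  have hmid : ∀ (y : D ⊕ (Unit ⊕ D) → Bool) (i d : D → Bool) (e : Unit → Bool),
      (rowOp p' * permMat fun x : D ⊕ (Unit ⊕ D) → Bool => Sum.elim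
        (xorB (x ∘ Sum.inl) (x ∘ Sum.inr ∘ Sum.inr)) (x ∘ Sum.inr) : Op (D ⊕ (Unit ⊕ D))) y
        (Sum.elim i (Sum.elim e d)) = rowOp p' y (Sum.elim (xorB i d) (Sum.elim e d)) := by
    intro y i d e
    rw [mul_permMat_apply]
    rfl
  simp only [hmid]
  rw [ctrl_elim]
  rcases Bool.eq_false_or_eq_true (ε ()) with hε | hε
  · obtain rfl : ε = fun _ => true := funext fun _ => hε
    simp only [rowOp_apply_true]
    rw [Finset.sum_eq_single i, Finset.sum_eq_single fun _ => true]
    · simp only [rowOp_apply_true]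
      by_cases he : e' = fun _ => true
      · simp only [he, if_true]
        rw [Finset.sum_eq_single (xorB i j)]
        · rw [if_pos (xorB_left_cancel i j).symm, xorB_left_cancel]
          have h1 : xorB (fun _ => false) (xorB i j) = xorB i j := by
            rw [xorB_comm, xorB_zero]
          rw [h1, xorB_left_cancel, xorB_zero, xorB_comm i j, xorB_left_cancel]
          push_cast
          rfl
        · intro d _ hd
          rw [if_neg, zero_mul]
          intro h
          exact hd (eq_xorB_iff.1 h)
        · simp
      · simp [he]
    · intro b _ hb
      refine Finset.sum_eq_zero fun d _ => ?_
      simp [hb]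
    · simp
    · intro k _ hk
      refine Finset.sum_eq_zero fun b _ => Finset.sum_eq_zero fun d _ => ?_
      simp [hk]
    · simp
  · obtain rfl : ε = fun _ => false := funext fun _ => hε
    simp only [rowOp_apply_false]
    rw [Finset.sum_eq_single i, Finset.sum_eq_single fun _ => false]
    · simp only [if_true, rowOp_apply_false]
      rw [Finset.sum_eq_single fun _ => false]
      · by_cases he : e' = fun _ => false
        · simp [he, xorB_zero, Matrix.one_apply]
        · simp [he]
      · intro d _ hd; simp [hd]
      · simp
    · intro b _ hb
      refine Finset.sum_eq_zero fun d _ => ?_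
      simp [hb]
    · simp
    · intro k _ hk
      refine Finset.sum_eq_zero fun b _ => Finset.sum_eq_zero fun d _ => ?_
      simp [hk]
    · simp

lemma sum_outcomeProb {c : Op (A ⊕ (B ⊕ C))} {k : ℕ} (hc : Circ c k) (i : A → Bool) :
    ∑ z, outcomeProb c i z = 1 := by
  have h := congrFun (congrFun (Matrix.mem_unitaryGroup_iff'.1 hc.mem_unitary)
    (Sum.elim i fun _ => false)) (Sum.elim i fun _ => false)
  rw [Matrix.star_eq_conjTranspose, Matrix.mul_apply, Matrix.one_apply_eq, sum_sum_type] at h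
  simp only [sum_sum_type (W := B), Matrix.conjTranspose_apply, Complex.star_def,
    Complex.conj_mul'] at h
  rw [Finset.sum_comm] at h
  unfold outcomeProb
  exact_mod_cast h

/-- The probability of the outcomes `z` in independent runs of a circuit. -/
noncomputable def runsProb {K : ℕ} (c : Op (A ⊕ (B ⊕ C))) (i : A → Bool) (z : Fin K × B → Bool) : ℝ :=
  ∏ m, outcomeProb c i fun b => z (m, b)

lemma outcomeProb_nonneg (c : Op (A ⊕ (B ⊕ C))) (i : A → Bool) (z : B → Bool) :
    0 ≤ outcomeProb c i z := by
  unfold outcomeProb; positivity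

lemma runsProb_nonneg {K : ℕ} (c : Op (A ⊕ (B ⊕ C))) (i : A → Bool) (z : Fin K × B → Bool) :
    0 ≤ runsProb c i z :=
  Finset.prod_nonneg fun _ _ => outcomeProb_nonneg _ _ _

lemma sum_runsProb_mul {K : ℕ} (c : Op (A ⊕ (B ⊕ C))) (i : A → Bool) (φ : (B → Bool) → ℝ) :
    ∑ z : Fin K × B → Bool, runsProb c i z * ∏ m, φ (fun b => z (m, b)) =
      (∑ z, outcomeProb c i z * φ z) ^ K := by
  rw [← (Equiv.curry (Fin K) B Bool).symm.sum_comp]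
  simp only [runsProb, ← Finset.prod_mul_distrib]
  rw [← Fin.prod_const, Finset.prod_univ_sum]
  simp only [Fintype.piFinset_univ]
  rfl

lemma sum_runsProb {K : ℕ} {c : Op (A ⊕ (B ⊕ C))} {k : ℕ} (hc : Circ c k) (i : A → Bool) :
    ∑ z : Fin K × B → Bool, runsProb c i z = 1 := by
  have h := sum_runsProb_mul (K := K) c i fun _ => 1
  simpa [sum_outcomeProb hc] using h

open Classical in
/-- The row operator whose weights are the probabilities that `K` runs of a circuit with input `i`
satisfy `F` and that their outcome contains `j` on given wires. -/
theorem Enc.rowOp {c : Op (D ⊕ (B ⊕ C))} {k K : ℕ} (hc : Circ c k) {F : (Fin K × B → Bool) → Prop}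
    {S : ℕ} (hF : Comp F S) (col : D ↪ Fin K × B) :
    Enc (rowOp fun i j => ∑ z, if F z ∧ z ∘ col = j then runsProb c i z else 0)
      ((4 * S + 17) + 18 * Fintype.card D + K * (3 * Fintype.card (D ⊕ (B ⊕ C)) + 2 * k)) := by
  let W' := (D ⊕ Fin K × B) ⊕ Unit
  -- `W'` holds `i`, the outcomes of the runs, and the control qubit; `G` is the difference `i ⊕ j`
  let G : D → (W' → Bool) → Prop := fun q x =>
    x (.inr ()) = true ∧ Xor (x (.inl (.inr (col q))) = true) (x (.inl (.inl q)) = true)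
  have hG := Enc.multiXor (Q := D) (F := G) fun q =>
    (Comp.var (Sum.inr () : W')).and ((Comp.var (Sum.inl (Sum.inr (col q)) : W')).xor
      (Comp.var (Sum.inl (Sum.inl q) : W')))
  let i₀ : Fin K × B ↪ W' := Function.Embedding.inr.trans Function.Embedding.inl
  have hp := (((Comp.var (Sum.inr () : W')).imp (hF.comap i₀)).proj).lift
    (Function.Embedding.inl : W' ↪ W' ⊕ D)
  have h1 := (hp.mul hG).lift (Equiv.sumAssoc (D ⊕ Fin K × B) Unit D).toEmbedding
  let g : (D ⊕ Fin K × B → Bool) → Op (Unit ⊕ D) := fun w => ctrl fun e => if e () then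
    (fun d' d => if F (w ∘ Sum.inr) ∧ w ∘ Sum.inr ∘ col = xorB (w ∘ Sum.inl) (xorB d d') then 1 else 0)
    else 1
  have h2 : Enc (ctrl g) ((4 * S + 17) + 18 * Fintype.card D) := by
    refine Enc.mono (S := 4 * (1 + S) + 11 + 2 + Fintype.card D * (4 * (1 + (1 + 1)) + 6)) ?_ (by omega)
    convert h1 using 1
    refine Op.ext_sum fun w' v' w v => ?_
    rw [← Sum.elim_comp_inl_inr v, ← Sum.elim_comp_inl_inr v']
    generalize v ∘ Sum.inl = e
    generalize v ∘ Sum.inr = d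
    generalize v' ∘ Sum.inl = e'
    generalize v' ∘ Sum.inr = d'
    have ha : ∀ (w : D ⊕ Fin K × B → Bool) (e : Unit → Bool) (d : D → Bool),
        Sum.elim w (Sum.elim e d) ∘ (Equiv.sumAssoc (D ⊕ Fin K × B) Unit D) =
          Sum.elim (Sum.elim w e) d := by
      intro w e d
      funext u
      rcases u with (u | u) | u <;> rfl
    have hx : SparseHamiltonian.multiXor (fun q x => @decide (G q x) (Classical.propDecidable _))
        (Sum.elim (Sum.elim w e) d) =
        Sum.elim (Sum.elim w e) (fun q => d q ^^
          (e () && (w (.inr (col q)) ^^ w (.inl q)))) := by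
      funext u
      rcases u with u | u
      · rfl
      · rw [multiXor_inr, Sum.elim_inr]
        have : (Sum.elim (Sum.elim w e) d) ∘ Sum.inl = Sum.elim w e := rfl
        rw [this]
        simp only [Sum.elim_inr]
        congr 1
        rw [Bool.eq_iff_iff]
        refine (@decide_eq_true_iff _ (Classical.propDecidable _)).trans ?_
        change (e () = true ∧ Xor (w (.inr (col u)) = true) (w (.inl u) = true)) ↔ _
        cases w (.inr (col u)) <;> cases w (.inl u) <;> simp [Xor]
    rw [lift_equiv_apply, ha, ha, mul_permMat_apply, hx, lift_inl_elim, ctrl_elim]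
    simp only [g]
    rw [ctrl_elim, Matrix.diagonal_apply]
    by_cases hw : w' = w
    swap
    · have : ¬ Sum.elim w' e' = Sum.elim w e := fun h => hw (Sum.elim_eq_iff.1 h).1
      rw [if_neg hw, if_neg this, ite_self]
    by_cases he : e' = e
    swap
    · have : ¬ Sum.elim w' e' = Sum.elim w e := fun h => he (Sum.elim_eq_iff.1 h).2
      rw [if_neg he, if_neg this, ite_self, ite_self]
    subst hw he
    rw [if_pos rfl, if_pos rfl, if_pos rfl, ← ite_and]
    have hcomp : (Sum.elim w' e' : W' → Bool) ∘ i₀ = w' ∘ Sum.inr := rfl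
    rw [hcomp]
    rcases Bool.eq_false_or_eq_true (e' ()) with hε | hε
    · simp only [hε, Sum.elim_inr, true_implies, Bool.true_and]
      obtain rfl : e' = fun _ => true := funext fun _ => hε
      change (if F (w' ∘ Sum.inr) ∧ w' ∘ Sum.inr ∘ col = xorB (w' ∘ Sum.inl) (xorB d d')
        then (1 : ℂ) else 0) = _
      refine ite_congr_inst ?_ rfl rfl
      rw [and_comm]
      refine and_congr_left fun _ => ?_
      constructor
      · intro h
        funext q
        have := congrFun h q
        simp only [Function.comp_apply, xorB] at this
        rw [this]
        cases w' (Sum.inl q) <;> cases d q <;> cases d' q <;> rfl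
      · intro h
        funext q
        have := congrFun h q
        simp only [Function.comp_apply, xorB]
        rw [this]
        cases w' (Sum.inl q) <;> cases d q <;> cases w' (Sum.inr (col q)) <;> rfl
    · simp [hε, Matrix.one_apply]
  have h3 := h2.mix_runs hc (Function.Embedding.refl D) K
  convert h3 using 1
  rw [SparseHamiltonian.rowOp]
  congr 1
  funext i
  have hgi : ∀ z : Fin K × B → Bool, g (Sum.elim i z) = ctrl fun e => if e () then
      (fun d' d => if F z ∧ z ∘ col = xorB i (xorB d d') then 1 else 0) else 1 := fun z => rfl
  refine Op.ext_sum fun e' d' e d => ?_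
  simp only [hgi, Matrix.sum_apply, Matrix.smul_apply, smul_eq_mul]
  simp only [ctrl_elim]
  by_cases he : e' = e
  swap
  · simp [he]
  subst he
  simp only [if_true]
  rcases Bool.eq_false_or_eq_true (e' ()) with hε | hε
  · obtain rfl : e' = fun _ => true := funext fun _ => hε
    change ((∑ z, if F z ∧ z ∘ col = xorB i (xorB d d') then runsProb c i z else 0 : ℝ) : ℂ) =
      ∑ z : Fin K × B → Bool, ((runsProb c i z : ℝ) : ℂ) *
        (if F z ∧ z ∘ col = xorB i (xorB d d') then 1 else 0)
    push_cast
    refine Finset.sum_congr rfl fun z _ => ?_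
    by_cases hz : F z ∧ z ∘ col = xorB i (xorB d d')
    · rw [if_pos hz, if_pos hz, mul_one]
    · rw [if_neg hz, if_neg hz, mul_zero, Complex.ofReal_zero]
  · obtain rfl : e' = fun _ => false := funext fun _ => hε
    change (1 : Op D) d' d = ∑ z : Fin K × B → Bool, ((runsProb c i z : ℝ) : ℂ) * (1 : Op D) d' d
    rw [← Finset.sum_mul, ← Complex.ofReal_sum, sum_runsProb hc, Complex.ofReal_one, one_mul]

end Step

/-! ### Comparing binary numbers -/

/-- `a < t` if `t` has a `1` where `a` has a `0`, and they agree in all higher bits. -/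
lemma lt_iff_exists_testBit {b : ℕ} {a t : ℕ} (ha : a < 2 ^ b) (ht : t < 2 ^ b) :
    a < t ↔ ∃ i : Fin b, t.testBit i = true ∧ a.testBit i = false ∧
      ∀ j : Fin b, i < j → (a.testBit j = true ↔ t.testBit j = true) := by
  have key : ∀ {a t : ℕ}, a < 2 ^ b → t < 2 ^ b → ∀ i : Fin b, t.testBit i = true →
      a.testBit i = false → (∀ j : Fin b, i < j → (a.testBit j = true ↔ t.testBit j = true)) →
      a < t := by
    intro a t ha ht i h1 h2 h3
    refine Nat.lt_of_testBit i h2 h1 fun j hj => ?_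
    by_cases hjb : j < b
    · exact Bool.eq_iff_iff.2 (h3 ⟨j, hjb⟩ hj)
    · have hle : 2 ^ b ≤ 2 ^ j := Nat.pow_le_pow_right (by norm_num) (not_lt.1 hjb)
      rw [Nat.testBit_lt_two_pow (ha.trans_le hle), Nat.testBit_lt_two_pow (ht.trans_le hle)]
  refine ⟨fun hlt => ?_, fun ⟨i, h1, h2, h3⟩ => key ha ht i h1 h2 h3⟩
  let s : Finset (Fin b) := Finset.univ.filter fun i => a.testBit i ≠ t.testBit i
  have hs : s.Nonempty := by
    by_contra hs
    refine hlt.ne (Nat.eq_of_testBit_eq fun j => ?_)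
    by_cases hjb : j < b
    · by_contra hne
      exact hs ⟨⟨j, hjb⟩, by simpa [s] using hne⟩
    · have hle : 2 ^ b ≤ 2 ^ j := Nat.pow_le_pow_right (by norm_num) (not_lt.1 hjb)
      rw [Nat.testBit_lt_two_pow (ha.trans_le hle), Nat.testBit_lt_two_pow (ht.trans_le hle)]
  let i := s.max' hs
  have hi : a.testBit i ≠ t.testBit i := (Finset.mem_filter.1 (s.max'_mem hs)).2
  have habove : ∀ j : Fin b, i < j → a.testBit j = t.testBit j := by
    intro j hj
    by_contra hne
    exact absurd (s.le_max' j (Finset.mem_filter.2 ⟨Finset.mem_univ _, hne⟩)) (not_le.2 hj)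
  rcases hti : t.testBit i with _ | _
  · rw [hti] at hi
    have hai : a.testBit i = true := by simpa using hi
    exact absurd (key ht ha i hai hti fun j hj => by rw [habove j hj]) hlt.le.not_gt
  · rw [hti] at hi
    exact ⟨i, hti, by simpa using hi, fun j hj => by rw [habove j hj]⟩

section

variable {W W' : Type} [Fintype W] [DecidableEq W] [Fintype W'] [DecidableEq W']

lemma bigCost_mono {N N' S S' : ℕ} (hN : N ≤ N') (hS : S ≤ S') : bigCost N S ≤ bigCost N' S' := by
  unfold bigCost; gcongr

lemma Comp.forall_le {ι : Type*} [Fintype ι] {P : ι → (W → Bool) → Prop} {S Z : ℕ}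
    (hZ : Fintype.card ι ≤ Z) (h : ∀ i, Comp (P i) S) : Comp (fun x => ∀ i, P i x) (bigCost Z S) :=
  (Comp.forall h).mono (bigCost_mono hZ le_rfl)

lemma Comp.exists_le {ι : Type*} [Fintype ι] {P : ι → (W → Bool) → Prop} {S Z : ℕ}
    (hZ : Fintype.card ι ≤ Z) (h : ∀ i, Comp (P i) S) : Comp (fun x => ∃ i, P i x) (bigCost Z S) :=
  (Comp.exists h).mono (bigCost_mono hZ le_rfl)

lemma Comp.const_and {P : (W → Bool) → Prop} {S : ℕ} (p : Prop) (h : Comp P S) :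
    Comp (fun x => p ∧ P x) (S + 1) := by
  by_cases hp : p
  · exact (h.congr fun x => by simp [hp]).mono (by omega)
  · exact ((Comp.const False).congr fun x => by simp [hp]).mono (by omega)

lemma Comp.const_imp {P : (W → Bool) → Prop} {S : ℕ} (p : Prop) (h : Comp P S) :
    Comp (fun x => p → P x) (S + 1) := by
  by_cases hp : p
  · exact (h.congr fun x => by simp [hp]).mono (by omega)
  · exact ((Comp.const True).congr fun x => by simp [hp]).mono (by omega)

lemma Comp.or {P R : (W → Bool) → Prop} {S T : ℕ} (hP : Comp P S) (hR : Comp R T) :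
    Comp (fun x => P x ∨ R x) (4 * (S + T) + 15) :=
  ((hP.not.and hR.not).not.congr fun x => by tauto).mono (by omega)

/-- The cost of comparing a register of at most `Z` bits with a fixed natural number. -/
def natCost (Z : ℕ) : ℕ := bigCost Z (4 * (2 + bigCost Z 4) + 7) + 1

lemma Comp.le_ofBits {b Z : ℕ} (hb : b ≤ Z) (t : ℕ) :
    Comp (fun x : Fin b → Bool => t ≤ Nat.ofBits x) (natCost Z) := by
  by_cases ht : t < 2 ^ b
  swap
  · refine ((Comp.const False).congr fun x => ?_).mono (by unfold natCost; omega)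
    have := Nat.ofBits_lt_two_pow x
    rw [false_iff]
    omega
  have h : Comp (fun x : Fin b → Bool => ∃ i : Fin b, t.testBit i = true ∧ ¬ x i = true ∧
      ∀ j : Fin b, i < j → (x j = true ↔ t.testBit j = true))
      (bigCost Z (4 * (2 + bigCost Z 4) + 7)) :=
    Comp.exists_le (by simpa using hb) fun i => Comp.const_and _ ((Comp.var i).not.and
      (Comp.forall_le (by simpa using hb) fun j => Comp.const_imp _
        ((Comp.var j).iff (Comp.const _))))
  refine h.not.congr fun x => ?_
  rw [← not_lt, lt_iff_exists_testBit (Nat.ofBits_lt_two_pow x) ht, not_iff_not]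
  refine exists_congr fun i => and_congr_right fun _ => ?_
  simp only [Nat.testBit_ofBits_lt _ _ (Fin.is_lt _), Bool.not_eq_true, Fin.eta]

/-- The cost of comparing a signed binary number of at most `Z` bits with a fixed integer. -/
def intCost (Z : ℕ) : ℕ := 4 * (2 * (4 * (2 * natCost Z + 1) + 6)) + 15

/-- `Int.ofBits` is the two's complement: `2 ^ b` is subtracted if the number without sign is at
least half of that. -/
lemma Comp.le_intOfBits {b Z : ℕ} (hb : b ≤ Z) (t : ℤ) :
    Comp (fun x : Fin b → Bool => t ≤ Int.ofBits x) (intCost Z) := by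
  have h1 := Comp.le_ofBits hb ((2 ^ b + 1) / 2)
  have h2 := Comp.le_ofBits hb t.toNat
  have h3 := Comp.le_ofBits hb (t + 2 ^ b).toNat
  refine (((h1.not.and h2).or (h1.and h3)).congr fun x => ?_).mono (by unfold intCost; omega)
  have hpos : 0 < 2 ^ b := Nat.two_pow_pos b
  have hcast : ((2 ^ b : ℕ) : ℤ) = 2 ^ b := by push_cast; rfl
  rw [Int.ofBits]
  split_ifs with h
  · rw [Int.ofNat_eq_natCast]
    omega
  · rw [Int.subNatNat_eq_coe]
    omega

/-! ### Majority votes -/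

/-- More than half of the propositions hold. -/
def Maj {K : ℕ} (P : Fin K → Prop) : Prop := ∃ s : Finset (Fin K), K < 2 * s.card ∧ ∀ m ∈ s, P m

/-- Two majorities meet. -/
lemma Maj.and {K : ℕ} {P Q : Fin K → Prop} (hP : Maj P) (hQ : Maj Q) : ∃ m, P m ∧ Q m := by
  obtain ⟨s, hs, hP⟩ := hP
  obtain ⟨t, ht, hQ⟩ := hQ
  have h := Finset.card_union_add_card_inter s t
  have h' : (s ∪ t).card ≤ K := (Finset.card_le_univ _).trans_eq (Fintype.card_fin K)
  obtain ⟨m, hm⟩ : (s ∩ t).Nonempty := Finset.card_pos.1 (by omega)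
  exact ⟨m, hP m (Finset.mem_inter.1 hm).1, hQ m (Finset.mem_inter.1 hm).2⟩

lemma Maj.mono {K : ℕ} {P Q : Fin K → Prop} (hP : Maj P) (h : ∀ m, P m → Q m) : Maj Q := by
  obtain ⟨s, hs, hP⟩ := hP
  exact ⟨s, hs, fun m hm => h m (hP m hm)⟩

/-- The cost of a majority vote. -/
def majCost (Z S : ℕ) : ℕ := bigCost Z (bigCost Z (S + 1) + 1)

/-- The vote is a disjunction over all sets of voters. As `K` is only logarithmic in the other
parameters, it is affordable that there are `2 ^ K` of them. -/
lemma Comp.maj {K S Z : ℕ} (hK : 2 ^ K ≤ Z) {P : Fin K → (W → Bool) → Prop}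
    (h : ∀ m, Comp (P m) S) : Comp (fun x => Maj fun m => P m x) (majCost Z S) :=
  Comp.exists_le (by simpa using hK) fun _ => Comp.const_and _
    (Comp.forall_le (by simpa using Nat.lt_two_pow_self.le.trans hK)
      fun m => Comp.const_imp _ (h m))

end

/-! ### Reading the entries of a row off several lists -/

section Runs

variable {K s n b : ℕ}

/-- The outcome of the `m`-th of `K` runs. -/
def run (z : Fin K × ListWire s n b → Bool) (m : Fin K) : ListWire s n b → Bool := fun w => z (m, w)

/-- The wires that hold the column of an item. -/
def columnWires (κ : Fin K × Fin s) : Fin n ↪ Fin K × ListWire s n b :=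
  ⟨fun q => (κ.1, (κ.2, .inr (.inl q))), fun q q' h => by simpa using h⟩

lemma comp_columnWires (z : Fin K × ListWire s n b → Bool) (κ : Fin K × Fin s) :
    z ∘ columnWires κ = column (run z κ.1) κ.2 := rfl

/-- The `m`-th list contains an item with column `j` whose value has a property `P`. -/
def Listed (P : (ListWire s n b → Bool) → Fin s → Prop) (z : Fin K × ListWire s n b → Bool)
    (j : Fin n → Bool) (m : Fin K) : Prop :=
  ∃ r, Present (run z m) r ∧ column (run z m) r = j ∧ P (run z m) r

/-- More than half of the lists contain the column `j`. -/
def InMajority (z : Fin K × ListWire s n b → Bool) (j : Fin n → Bool) : Prop :=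
  Maj (Listed (fun _ _ => True) z j)

/-- The item `κ` is the first one with its column, and this column occurs in more than half of the
lists. Thus every such column has exactly one leading item. -/
def Lead (κ : Fin K × Fin s) (z : Fin K × ListWire s n b → Bool) : Prop :=
  Present (run z κ.1) κ.2 ∧
  (∀ κ', finProdFinEquiv κ' < finProdFinEquiv κ → ¬ (Present (run z κ'.1) κ'.2 ∧
    column (run z κ'.1) κ'.2 = column (run z κ.1) κ.2)) ∧
  InMajority z (column (run z κ.1) κ.2)

lemma existsUnique_lead {z : Fin K × ListWire s n b → Bool} {j : Fin n → Bool} (h : InMajority z j) :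
    ∃! κ, Lead κ z ∧ column (run z κ.1) κ.2 = j := by
  classical
  obtain ⟨m, ⟨r, h1, h2, -⟩, -⟩ := h.and h
  let t : Finset (Fin (K * s)) := Finset.univ.filter fun a =>
    Present (run z (finProdFinEquiv.symm a).1) (finProdFinEquiv.symm a).2 ∧
      column (run z (finProdFinEquiv.symm a).1) (finProdFinEquiv.symm a).2 = j
  have ht : t.Nonempty := ⟨finProdFinEquiv (m, r), Finset.mem_filter.2 ⟨Finset.mem_univ _, by
    rw [Equiv.symm_apply_apply]; exact ⟨h1, h2⟩⟩⟩
  have hmin := (Finset.mem_filter.1 (t.min'_mem ht)).2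
  refine ⟨finProdFinEquiv.symm (t.min' ht), ⟨⟨hmin.1, fun κ' hκ' h' => ?_, ?_⟩, hmin.2⟩, ?_⟩
  · rw [Equiv.apply_symm_apply] at hκ'
    refine absurd (t.min'_le (finProdFinEquiv κ') ?_) (not_le.2 hκ')
    simp only [t, Finset.mem_filter, Finset.mem_univ, true_and, Equiv.symm_apply_apply]
    exact ⟨h'.1, h'.2.trans hmin.2⟩
  · rw [hmin.2]; exact h
  · rintro κ ⟨⟨h3, h4, -⟩, h5⟩
    rw [Equiv.eq_symm_apply]
    refine le_antisymm ?_ (t.min'_le _ ?_)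
    · by_contra hlt
      refine h4 (finProdFinEquiv.symm (t.min' ht)) ?_ ⟨hmin.1, hmin.2.trans h5.symm⟩
      rw [Equiv.apply_symm_apply]
      exact not_le.1 hlt
    · simp only [t, Finset.mem_filter, Finset.mem_univ, true_and, Equiv.symm_apply_apply]
      exact ⟨h3, h5⟩

open Classical in
/-- Summing over all items, those that are leading count each accepted column once. -/
lemma sum_lead {z : Fin K × ListWire s n b → Bool} {j : Fin n → Bool} (p : ℝ) :
    ∑ κ, (if Lead κ z ∧ column (run z κ.1) κ.2 = j then p else 0) =
      if InMajority z j then p else 0 := by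
  split_ifs with h
  · obtain ⟨κ, hκ, huniq⟩ := existsUnique_lead h
    rw [Finset.sum_eq_single κ, if_pos hκ]
    · intro κ' _ hne
      exact if_neg fun h' => hne (huniq κ' h')
    · simp
  · refine Finset.sum_eq_zero fun κ _ => if_neg fun h' => h ?_
    rw [← h'.2]
    exact h'.1.2.2

/-- The real (`false`) or imaginary (`true`) part of a value, times `2 ^ f`. -/
def intPart (im : Bool) (z : ListWire s n b → Bool) (r : Fin s) : ℤ :=
  Int.ofBits fun k => z (r, .inr (.inr (if im then .inr k else .inl k)))

/-- More than half of the lists contain an item in the column `j` whose real (imaginary) part,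
times `2 ^ f`, is at least `c`. -/
def Above (im : Bool) (c : ℤ) (z : Fin K × ListWire s n b → Bool) (j : Fin n → Bool) : Prop :=
  Maj (Listed (fun y r => c ≤ intPart im y r) z j)

/-- The cost of `Listed`. -/
def listedCost (Z : ℕ) : ℕ :=
  bigCost Z (4 * (1 + (4 * (bigCost Z 3 + intCost Z) + 6)) + 6)

lemma Comp.column_eq {Z : ℕ} (hn : n ≤ Z) (κ κ' : Fin K × Fin s) :
    Comp (fun z : Fin K × ListWire s n b → Bool =>
      column (run z κ'.1) κ'.2 = column (run z κ.1) κ.2) (bigCost Z 3) := by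
  have h : Comp (fun z : Fin K × ListWire s n b → Bool => ∀ q, z (columnWires κ' q) = true ↔
      z (columnWires κ q) = true) (bigCost Z 3) :=
    Comp.forall_le (by simpa using hn) fun q => (Comp.var _).iff (Comp.var _)
  refine h.congr fun z => ?_
  rw [funext_iff]
  exact forall_congr' fun q => Bool.eq_iff_iff.symm

lemma Comp.present (κ : Fin K × Fin s) :
    Comp (fun z : Fin K × ListWire s n b → Bool => Present (run z κ.1) κ.2) 1 :=
  Comp.var (W := Fin K × ListWire s n b) (κ.1, (κ.2, Sum.inl ()))

lemma Comp.listed {Z : ℕ} (hn : n ≤ Z) (hs : s ≤ Z) {P : (ListWire s n b → Bool) → Fin s → Prop}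
    (m : Fin K) (hP : ∀ r, Comp (fun y => P y r) (intCost Z)) (κ : Fin K × Fin s) :
    Comp (fun z => Listed P z (column (run z κ.1) κ.2) m) (listedCost Z) := by
  have h : ∀ r, Comp (fun z : Fin K × ListWire s n b → Bool => P (run z m) r) (intCost Z) :=
    fun r => (hP r).comap (W' := Fin K × ListWire s n b) ⟨fun w => (m, w), fun w w' h => by simpa using h⟩
  exact Comp.exists_le (by simpa using hs) fun r => (Comp.present (m, r)).and
    ((Comp.column_eq hn κ (m, r)).and (h r))

lemma Comp.above {Z : ℕ} (hn : n ≤ Z) (hs : s ≤ Z) (hb : b ≤ Z) (hK : 2 ^ K ≤ Z) (im : Bool)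
    (c : ℤ) (κ : Fin K × Fin s) :
    Comp (fun z : Fin K × ListWire s n b → Bool => Above im c z (column (run z κ.1) κ.2))
      (majCost Z (listedCost Z)) := by
  let wires (r : Fin s) : Fin b ↪ ListWire s n b :=
    ⟨fun k => (r, .inr (.inr (if im then .inr k else .inl k))),
      fun k k' h => by cases im <;> simpa using h⟩
  have h : ∀ r, Comp (fun y : ListWire s n b → Bool => c ≤ intPart im y r) (intCost Z) := fun r =>
    (Comp.le_intOfBits hb c).comap (wires r)
  exact Comp.maj hK fun m => Comp.listed hn hs m h κ

/-- The cost of `Lead`. -/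
def leadCost (Z : ℕ) : ℕ :=
  4 * (1 + (4 * (bigCost (Z * Z) (4 * (1 + bigCost Z 3) + 8) + majCost Z (listedCost Z)) + 6)) + 6

lemma Comp.lead {Z : ℕ} (hn : n ≤ Z) (hs : s ≤ Z) (hK : 2 ^ K ≤ Z) (κ : Fin K × Fin s) :
    Comp (Lead (n := n) (b := b) κ) (leadCost Z) := by
  have hKZ : K ≤ Z := Nat.lt_two_pow_self.le.trans hK
  have h1 : ∀ r : Fin s, Comp (fun _ : ListWire s n b → Bool => True) (intCost Z) :=
    fun r => (Comp.const True).mono (by unfold intCost; omega)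
  exact (Comp.present κ).and ((Comp.forall_le (by simpa using Nat.mul_le_mul hKZ hs) fun κ' =>
    Comp.const_imp _ ((Comp.present κ').and (Comp.column_eq hn κ κ')).not).and
      (Comp.maj hK fun m => Comp.listed hn hs m h1 κ))

end Runs

/-! ### Estimating an entry by levels -/

open Classical in
/-- Layer-cake summation: the number of thresholds `l ≤ a`, for `l` between `-N + 1` and `N`,
recovers `a` up to an error, even if the comparison with `l` is only reliable up to `1`. -/
lemma abs_sum_levels_sub_le {N : ℕ} {V : Fin (2 * N) → Prop} {a : ℝ} (ha : |a| ≤ N)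
    (h1 : ∀ k : Fin (2 * N), (k : ℝ) - N + 1 ≤ a - 1 → V k)
    (h2 : ∀ k : Fin (2 * N), V k → (k : ℝ) - N + 1 ≤ a + 1) :
    |(∑ k, if V k then (1 : ℝ) else 0) - N - a| ≤ 2 := by
  rw [abs_le] at ha
  rw [Finset.sum_boole]
  have hup : ((Finset.univ.filter V).card : ℝ) ≤ a + N + 1 := by
    have : (Finset.univ.filter V).card ≤ (Finset.range (⌊a + N⌋₊ + 1)).card := by
      refine Finset.card_le_card_of_injOn (fun k => (k : ℕ)) ?_ (fun k _ l _ h => Fin.ext h)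
      intro k hk
      have h := h2 k (Finset.mem_filter.1 hk).2
      simp only [Finset.coe_range, Set.mem_Iio, Nat.lt_succ_iff]
      exact Nat.le_floor (by linarith)
    rw [Finset.card_range] at this
    have h3 : (⌊a + N⌋₊ : ℝ) ≤ a + N := Nat.floor_le (by linarith)
    have : ((Finset.univ.filter V).card : ℝ) ≤ (⌊a + N⌋₊ + 1 : ℕ) := by exact_mod_cast this
    push_cast at this
    linarith
  have hlow : a + N - 2 ≤ ((Finset.univ.filter V).card : ℝ) := by
    by_cases hneg : a + N - 2 < 0
    · exact hneg.le.trans (Nat.cast_nonneg _)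
    rw [not_lt] at hneg
    have h3 : (⌊a + N - 2⌋₊ : ℝ) ≤ a + N - 2 := Nat.floor_le hneg
    have hlt : ⌊a + N - 2⌋₊ + 1 ≤ 2 * N := by
      have : ((⌊a + N - 2⌋₊ + 1 : ℕ) : ℝ) ≤ (2 * N : ℕ) := by push_cast; linarith
      exact_mod_cast this
    have : (Finset.range (⌊a + N - 2⌋₊ + 1)).card ≤ (Finset.univ.filter V).card := by
      refine Finset.card_le_card_of_surjOn (fun k => (k : ℕ)) ?_
      intro k hk
      simp only [Finset.coe_range, Set.mem_Iio, Nat.lt_succ_iff] at hk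
      refine ⟨⟨k, by omega⟩, ?_, rfl⟩
      simp only [Finset.coe_filter, Finset.mem_univ, true_and, Set.mem_ofPred_eq]
      have hk' : (k : ℝ) ≤ ⌊a + N - 2⌋₊ := by exact_mod_cast hk
      exact h1 _ (by simp only; linarith)
    rw [Finset.card_range] at this
    have h4 := Nat.lt_floor_add_one (a + N - 2)
    have : ((⌊a + N - 2⌋₊ + 1 : ℕ) : ℝ) ≤ ((Finset.univ.filter V).card : ℝ) := by exact_mod_cast this
    push_cast at this
    linarith
  rw [abs_le]
  constructor <;> linarith

open Classical in
lemma abs_sum_levels_le {N : ℕ} (V : Fin (2 * N) → Prop) :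
    |(∑ k, if V k then (1 : ℝ) else 0) - N| ≤ N := by
  rw [Finset.sum_boole]
  have h : (Finset.univ.filter V).card ≤ 2 * N :=
    (Finset.card_le_univ _).trans_eq (Fintype.card_fin _)
  have h : ((Finset.univ.filter V).card : ℝ) ≤ 2 * N := by exact_mod_cast h
  rw [abs_le]
  constructor
  · linarith [(Nat.cast_nonneg (Finset.univ.filter V).card : (0 : ℝ) ≤ _)]
  · linarith

section Runs

variable {K s n b f N : ℕ} {H : Matrix (Fin n → Bool) (Fin n → Bool) ℂ} {i j : Fin n → Bool} {δ : ℝ}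
  {z : Fin K × ListWire s n b → Bool}

/-- The integer threshold belonging to the level `k`, in units of `2 ^ (-f)`. -/
noncomputable def threshold (N f : ℕ) (δ : ℝ) (k : Fin (2 * N)) : ℤ :=
  ⌈((k : ℝ) - N + 1) * δ * 2 ^ f⌉

/-- The real or imaginary part of a complex number. -/
def part (im : Bool) (w : ℂ) : ℝ := if im then w.im else w.re

lemma abs_part_le (im : Bool) (w : ℂ) : |part im w| ≤ ‖w‖ := by
  cases im
  · exact Complex.abs_re_le_norm w
  · exact Complex.abs_im_le_norm w

lemma part_sub (im : Bool) (w w' : ℂ) : part im (w - w') = part im w - part im w' := by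
  cases im <;> simp [part]

lemma part_value (im : Bool) (y : ListWire s n b → Bool) (r : Fin s) :
    part im (value f y r) = intPart im y r / 2 ^ f := by
  cases im <;> rfl

lemma threshold_le_intPart_iff (im : Bool) (k : Fin (2 * N)) (y : ListWire s n b → Bool) (r : Fin s) :
    threshold N f δ k ≤ intPart im y r ↔ ((k : ℝ) - N + 1) * δ ≤ part im (value f y r) := by
  rw [part_value, threshold, Int.ceil_le, le_div_iff₀ (by positivity)]

/-- More than half of the lists are correct for the `i`-th row. -/
def Good (f : ℕ) (H : Matrix (Fin n → Bool) (Fin n → Bool) ℂ) (i : Fin n → Bool) (δ : ℝ)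
    (z : Fin K × ListWire s n b → Bool) : Prop :=
  Maj fun m => IsRowList f H i δ (run z m)

/-- The correct lists, being a majority, meet the lists that contain `j`. -/
lemma Good.inMajority_iff (h : Good f H i δ z) : InMajority z j ↔ H i j ≠ 0 := by
  constructor
  · intro hj
    obtain ⟨m, ⟨-, hm⟩, r, hr, rfl, -⟩ := h.and hj
    exact (hm r hr).1
  · intro hj
    refine h.mono fun m hm => ?_
    obtain ⟨r, ⟨hr, hrj⟩, -⟩ := hm.1 j hj
    exact ⟨r, hr, hrj, trivial⟩

lemma Good.above (h : Good f H i δ z) (hj : H i j ≠ 0) {im : Bool} {k : Fin (2 * N)}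
    (hk : ((k : ℝ) - N + 1) * δ ≤ part im (H i j) - δ) : Above im (threshold N f δ k) z j := by
  refine h.mono fun m hm => ?_
  obtain ⟨r, ⟨hr, rfl⟩, -⟩ := hm.1 j hj
  refine ⟨r, hr, rfl, (threshold_le_intPart_iff im k _ r).2 ?_⟩
  have h1 := (abs_le.1 ((abs_part_le im _).trans (hm.2 r hr).2)).1
  rw [part_sub] at h1
  linarith

lemma Good.le_of_above (h : Good f H i δ z) {im : Bool} {k : Fin (2 * N)}
    (hk : Above im (threshold N f δ k) z j) : ((k : ℝ) - N + 1) * δ ≤ part im (H i j) + δ := by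
  obtain ⟨m, hm, r, hr, rfl, hle⟩ := h.and hk
  have h1 := (abs_le.1 ((abs_part_le im _).trans (hm.2 r hr).2)).2
  rw [part_sub] at h1
  have h2 := (threshold_le_intPart_iff im k _ r).1 hle
  linarith

open Classical in
/-- The real or imaginary part, in units of `δ`, of the estimate for the entry in column `j`. -/
noncomputable def partEstimate (N f : ℕ) (δ : ℝ) (z : Fin K × ListWire s n b → Bool)
    (j : Fin n → Bool) (im : Bool) : ℝ :=
  (∑ k, if Above im (threshold N f δ k) z j then (1 : ℝ) else 0) - N

lemma Good.abs_partEstimate_sub_le (h : Good f H i δ z) (hδ : 0 < δ) (hj : H i j ≠ 0)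
    (hN : ‖H i j‖ ≤ N * δ) (im : Bool) :
    |partEstimate N f δ z j im - part im (H i j) / δ| ≤ 2 := by
  refine abs_sum_levels_sub_le ?_ (fun k hk => h.above hj ?_) fun k hk => ?_
  · rw [abs_div, abs_of_pos hδ, div_le_iff₀ hδ]
    exact (abs_part_le im _).trans hN
  · have := mul_le_mul_of_nonneg_right hk hδ.le
    rwa [sub_mul, one_mul, div_mul_cancel₀ _ hδ.ne'] at this
  · have := h.le_of_above hk
    rw [← le_div_iff₀ hδ, add_div, div_self hδ.ne'] at this
    exact this

/-- The estimate for the complex conjugate of the entry in column `j`. -/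
noncomputable def estimate (N f : ℕ) (δ : ℝ) (z : Fin K × ListWire s n b → Bool)
    (j : Fin n → Bool) : ℂ :=
  δ * (partEstimate N f δ z j false - Complex.I * partEstimate N f δ z j true)

lemma Good.norm_estimate_sub_le (h : Good f H i δ z) (hδ : 0 < δ) (hj : H i j ≠ 0)
    (hN : ‖H i j‖ ≤ N * δ) : ‖estimate N f δ z j - star (H i j)‖ ≤ 4 * δ := by
  have h1 := h.abs_partEstimate_sub_le hδ hj hN false
  have h2 := h.abs_partEstimate_sub_le hδ hj hN true
  have hδ' : (δ : ℂ) ≠ 0 := by exact_mod_cast hδ.ne'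
  have hstar : star (H i j) = (part false (H i j) : ℂ) - Complex.I * (part true (H i j) : ℂ) := by
    apply Complex.ext <;> simp [part]
  have : estimate N f δ z j - star (H i j) =
      δ * (((partEstimate N f δ z j false - part false (H i j) / δ : ℝ) : ℂ) -
        Complex.I * ((partEstimate N f δ z j true - part true (H i j) / δ : ℝ) : ℂ)) := by
    rw [estimate, hstar]
    push_cast
    field_simp
    ring
  rw [this, norm_mul, Complex.norm_real, Real.norm_of_nonneg hδ.le]
  refine (mul_le_mul_of_nonneg_left (norm_sub_le _ _) hδ.le).trans ?_
  rw [norm_mul, Complex.norm_I, one_mul, Complex.norm_real, Complex.norm_real, Real.norm_eq_abs,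
    Real.norm_eq_abs]
  nlinarith

lemma norm_estimate_le (hδ : 0 < δ) (z : Fin K × ListWire s n b → Bool) :
    ‖estimate N f δ z j‖ ≤ 2 * (N * δ) := by
  have h1 : |partEstimate N f δ z j false| ≤ N := abs_sum_levels_le _
  have h2 : |partEstimate N f δ z j true| ≤ N := abs_sum_levels_le _
  rw [estimate, norm_mul, Complex.norm_real, Real.norm_of_nonneg hδ.le]
  refine (mul_le_mul_of_nonneg_left (norm_sub_le _ _) hδ.le).trans ?_
  rw [norm_mul, Complex.norm_I, one_mul, Complex.norm_real, Complex.norm_real, Real.norm_eq_abs,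
    Real.norm_eq_abs]
  nlinarith

/-- A level consists of a threshold and the information whether it is compared with the real or with
the imaginary part. For a positive threshold it is reached if the part is above it, for a
non-positive one if the part is not above it. -/
def Reached (f : ℕ) (δ : ℝ) (l : Bool × Fin (2 * N)) (z : Fin K × ListWire s n b → Bool)
    (j : Fin n → Bool) : Prop :=
  if N ≤ (l.2 : ℕ) then Above l.1 (threshold N f δ l.2) z j
    else ¬ Above l.1 (threshold N f δ l.2) z j

/-- The contribution of a level, in units of `δ`. -/
noncomputable def levelUnit (l : Bool × Fin (2 * N)) : ℂ :=
  (if l.1 then -Complex.I else 1) * if N ≤ (l.2 : ℕ) then 1 else -1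

lemma levelUnit_mul_star (l : Bool × Fin (2 * N)) : levelUnit l * star (levelUnit l) = 1 := by
  unfold levelUnit
  split_ifs <;> simp

open Classical in
/-- The `-N` in the estimate is absorbed by the non-positive thresholds: there `1 - 1` is `0` if the
part is above the threshold, and `0 - 1` is `-1` otherwise, which is what `Reached` counts. -/
lemma sum_reached (z : Fin K × ListWire s n b → Bool) (j : Fin n → Bool) :
    ∑ l : Bool × Fin (2 * N), (δ : ℂ) * levelUnit l * (if Reached f δ l z j then 1 else 0) =
      estimate N f δ z j := by
  have key : ∀ im, ∑ k : Fin (2 * N), (if N ≤ (k : ℕ) then (1 : ℂ) else -1) *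
      (if Reached f δ (im, k) z j then 1 else 0) = (partEstimate N f δ z j im : ℂ) := by
    intro im
    have h0 : ∑ k : Fin (2 * N), (if N ≤ (k : ℕ) then (0 : ℂ) else 1) = N := by
      rw [Fin.sum_univ_eq_sum_range (fun k => if N ≤ k then (0 : ℂ) else 1), two_mul,
        Finset.sum_range_add]
      rw [Finset.sum_congr rfl fun k hk => if_neg (not_le.2 (Finset.mem_range.1 hk))]
      simp
    rw [partEstimate]
    push_cast
    rw [← h0, ← Finset.sum_sub_distrib]
    refine Finset.sum_congr rfl fun k _ => ?_
    unfold Reached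
    by_cases hk : N ≤ (k : ℕ) <;>
      by_cases ha : Above im (threshold N f δ k) z j <;> simp [hk, ha]
  rw [Fintype.sum_prod_type, Fintype.sum_bool, estimate, ← key, ← key, mul_sub, Finset.mul_sum,
    Finset.mul_sum, Finset.mul_sum, add_comm, sub_eq_add_neg, ← Finset.sum_neg_distrib]
  congr 1 <;> refine Finset.sum_congr rfl fun k _ => ?_
  · simp [levelUnit]
  · by_cases hk : N ≤ (k : ℕ) <;> by_cases hr : Reached f δ (true, k) z j <;>
      simp [levelUnit, hk, hr]

/-- The cost of testing that an item is the leading one of its column, and a level is reached. -/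
def levelCost (Z : ℕ) : ℕ := 4 * (leadCost Z + (majCost Z (listedCost Z) + 1)) + 6

lemma Comp.lead_and_reached {Z : ℕ} (hn : n ≤ Z) (hs : s ≤ Z) (hb : b ≤ Z) (hK : 2 ^ K ≤ Z)
    (κ : Fin K × Fin s) (l : Bool × Fin (2 * N)) :
    Comp (fun z : Fin K × ListWire s n b → Bool => Lead κ z ∧
      Reached f δ l z (column (run z κ.1) κ.2)) (levelCost Z) := by
  refine (Comp.lead hn hs hK κ).and ?_
  have h := Comp.above hn hs hb hK l.1 (threshold N f δ l.2) κ
  unfold Reached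
  by_cases hl : N ≤ (l.2 : ℕ)
  · simp only [if_pos hl]
    exact h.mono (Nat.le_succ _)
  · simp only [if_neg hl]
    exact h.not

end Runs

/-! ### Averaging over several runs -/

section Runs

variable {K s n b m f N k : ℕ} {c : Op (Fin n ⊕ (ListWire s n b ⊕ Fin m))}
  {H : Matrix (Fin n → Bool) (Fin n → Bool) ℂ} {i j : Fin n → Bool} {δ ε : ℝ}

open Classical in
/-- A Chernoff bound: if each list is correct with probability at least `2 / 3`, it is unlikely that
at most half of the lists are correct. -/
lemma sum_not_good_le (hc : Circ c k)
    (h : 2 / 3 ≤ ∑ z with IsRowList f H i δ z, outcomeProb c i z) :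
    ∑ z : Fin K × ListWire s n b → Bool, (if Good f H i δ z then 0 else runsProb c i z) ≤
      (17 / 18) ^ K := by
  -- each wrong list contributes `3 / 2`, each correct one `2 / 3`; the mean is at most
  -- `3 / 2 - (5 / 6) * (2 / 3) = 17 / 18`, and the product is at least `1` without a majority
  let φ : (ListWire s n b → Bool) → ℝ := fun y => if IsRowList f H i δ y then 2 / 3 else 3 / 2
  have hφ : ∑ y, outcomeProb c i y * φ y ≤ 17 / 18 := by
    have h1 : ∀ y, outcomeProb c i y * φ y = 3 / 2 * outcomeProb c i y -
        5 / 6 * (if IsRowList f H i δ y then outcomeProb c i y else 0) := by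
      intro y
      simp only [φ]
      split_ifs <;> ring
    rw [Finset.sum_filter] at h
    simp only [h1]
    rw [Finset.sum_sub_distrib, ← Finset.mul_sum, ← Finset.mul_sum, sum_outcomeProb hc]
    linarith
  have hφ0 : 0 ≤ ∑ y, outcomeProb c i y * φ y := by
    refine Finset.sum_nonneg fun y _ => mul_nonneg (outcomeProb_nonneg _ _ _) ?_
    simp only [φ]
    split_ifs <;> norm_num
  refine le_trans ?_ (pow_le_pow_left₀ hφ0 hφ K)
  rw [← sum_runsProb_mul]
  refine Finset.sum_le_sum fun z _ => ?_
  have hprod : ∏ r, φ (fun w => z (r, w)) = (2 / 3) ^ (Finset.univ.filter fun r =>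
      IsRowList f H i δ (run z r)).card * (3 / 2) ^ (Finset.univ.filter fun r =>
      ¬ IsRowList f H i δ (run z r)).card := by
    rw [← Finset.prod_const, ← Finset.prod_const, ← Finset.prod_ite]
    rfl
  split_ifs with hg
  · refine mul_nonneg (runsProb_nonneg _ _ _) ?_
    rw [hprod]
    positivity
  · refine le_mul_of_one_le_right (runsProb_nonneg _ _ _) ?_
    rw [hprod]
    have hcard := Finset.card_filter_add_card_filter_not (s := (Finset.univ : Finset (Fin K)))
      fun r => IsRowList f H i δ (run z r)
    rw [Finset.card_univ, Fintype.card_fin] at hcard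
    set v := (Finset.univ.filter fun r => IsRowList f H i δ (run z r)).card
    set w := (Finset.univ.filter fun r => ¬ IsRowList f H i δ (run z r)).card
    have hv : v ≤ w := by
      by_contra hlt
      exact hg ⟨Finset.univ.filter fun r => IsRowList f H i δ (run z r), by omega,
        fun r hr => (Finset.mem_filter.1 hr).2⟩
    calc (1 : ℝ) = (2 / 3) ^ v * (3 / 2) ^ v := by rw [← mul_pow]; norm_num
      _ ≤ (2 / 3) ^ v * (3 / 2) ^ w := by
        gcongr
        norm_num

open Classical in
/-- The probability that `K` runs with input `i` find the column `j` in a majority of the lists. -/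
noncomputable def foundProb (K : ℕ) (c : Op (Fin n ⊕ (ListWire s n b ⊕ Fin m)))
    (i j : Fin n → Bool) : ℝ :=
  ∑ z : Fin K × ListWire s n b → Bool, if InMajority z j then runsProb c i z else 0

open Classical in
/-- The probability that column `j` is found although at most half of the lists are correct. -/
noncomputable def errorProb (K f : ℕ) (H : Matrix (Fin n → Bool) (Fin n → Bool) ℂ) (δ : ℝ)
    (c : Op (Fin n ⊕ (ListWire s n b ⊕ Fin m))) (i j : Fin n → Bool) : ℝ :=
  ∑ z : Fin K × ListWire s n b → Bool,
    if Good f H i δ z then 0 else if InMajority z j then runsProb c i z else 0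

open Classical in
/-- The expected estimate of the conjugate entry in row `i` and column `j`. -/
noncomputable def meanEstimate (K N f : ℕ) (δ : ℝ) (c : Op (Fin n ⊕ (ListWire s n b ⊕ Fin m)))
    (i j : Fin n → Bool) : ℂ :=
  ∑ z : Fin K × ListWire s n b → Bool,
    if InMajority z j then (runsProb c i z : ℂ) * estimate N f δ z j else 0

lemma foundProb_nonneg : 0 ≤ foundProb K c i j :=
  Finset.sum_nonneg fun z _ => by split_ifs <;> simp [runsProb_nonneg]

lemma foundProb_le_one (hc : Circ c k) : foundProb K c i j ≤ 1 := by
  rw [← sum_runsProb (K := K) hc i]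
  exact Finset.sum_le_sum fun z _ => by split_ifs <;> simp [runsProb_nonneg]

lemma foundProb_eq_errorProb (h : H i j = 0) : foundProb K c i j = errorProb K f H δ c i j := by
  refine Finset.sum_congr rfl fun z _ => ?_
  by_cases hg : Good f H i δ z
  · rw [if_pos hg, if_neg fun hj => hg.inMajority_iff.1 hj h]
  · rw [if_neg hg]

lemma errorProb_nonneg : 0 ≤ errorProb K f H δ c i j :=
  Finset.sum_nonneg fun z _ => by split_ifs <;> simp [runsProb_nonneg]

open Classical in
lemma one_sub_foundProb_le (hc : Circ c k) (h : H i j ≠ 0) : 1 - foundProb K c i j ≤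
    ∑ z : Fin K × ListWire s n b → Bool, (if Good f H i δ z then 0 else runsProb c i z) := by
  rw [← sum_runsProb (K := K) hc i, foundProb, ← Finset.sum_sub_distrib]
  refine Finset.sum_le_sum fun z _ => ?_
  have := runsProb_nonneg c i z
  by_cases hg : Good f H i δ z
  · rw [if_pos hg, if_pos (hg.inMajority_iff.2 h), sub_self]
  · rw [if_neg hg]
    split_ifs <;> linarith

open Classical in
lemma norm_meanEstimate_sub_le (hc : Circ c k) (hδ : 0 < δ) (hN : ‖H i j‖ ≤ N * δ) (h : H i j ≠ 0) :
    ‖meanEstimate K N f δ c i j - star (H i j)‖ ≤ 4 * δ + 3 * (N * δ) *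
      ∑ z : Fin K × ListWire s n b → Bool, (if Good f H i δ z then 0 else runsProb c i z) := by
  have h1 : star (H i j) = ∑ z : Fin K × ListWire s n b → Bool,
      (runsProb c i z : ℂ) * star (H i j) := by
    rw [← Finset.sum_mul, ← Complex.ofReal_sum, sum_runsProb hc, Complex.ofReal_one, one_mul]
  have h2 : 4 * δ = ∑ z : Fin K × ListWire s n b → Bool, runsProb c i z * (4 * δ) := by
    rw [← Finset.sum_mul, sum_runsProb hc, one_mul]
  rw [h1, h2, meanEstimate, ← Finset.sum_sub_distrib, Finset.mul_sum, ← Finset.sum_add_distrib]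
  refine (norm_sum_le _ _).trans (Finset.sum_le_sum fun z _ => ?_)
  have hp := runsProb_nonneg c i z
  have hstar : ‖star (H i j)‖ ≤ N * δ := by rwa [norm_star]
  by_cases hg : Good f H i δ z
  · rw [if_pos hg, if_pos (hg.inMajority_iff.2 h), ← mul_sub, norm_mul, Complex.norm_real,
      Real.norm_of_nonneg hp, mul_zero, add_zero]
    exact mul_le_mul_of_nonneg_left (hg.norm_estimate_sub_le hδ h hN) hp
  · rw [if_neg hg]
    have h3 : ‖(if InMajority z j then (runsProb c i z : ℂ) * estimate N f δ z j else 0) -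
        (runsProb c i z : ℂ) * star (H i j)‖ ≤ runsProb c i z * (3 * (N * δ)) := by
      split_ifs
      · rw [← mul_sub, norm_mul, Complex.norm_real, Real.norm_of_nonneg hp]
        refine mul_le_mul_of_nonneg_left ((norm_sub_le _ _).trans ?_) hp
        have := norm_estimate_le (f := f) (N := N) (j := j) hδ z
        linarith
      · rw [zero_sub, norm_neg, norm_mul, Complex.norm_real, Real.norm_of_nonneg hp]
        refine mul_le_mul_of_nonneg_left ?_ hp
        linarith [norm_nonneg (star (H i j))]
    nlinarith

lemma norm_meanEstimate_le (hδ : 0 < δ) :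
    ‖meanEstimate K N f δ c i j‖ ≤ 2 * (N * δ) * foundProb K c i j := by
  rw [meanEstimate, foundProb, Finset.mul_sum]
  refine (norm_sum_le _ _).trans (Finset.sum_le_sum fun z _ => ?_)
  have hp := runsProb_nonneg c i z
  split_ifs
  · rw [norm_mul, Complex.norm_real, Real.norm_of_nonneg hp, mul_comm]
    exact mul_le_mul_of_nonneg_right (norm_estimate_le hδ z) hp
  · simp

open Classical in
/-- Every accepted column has a leading item, so there are at most `K * s` of them, and the factor
`2 ^ n` of a crude union bound is avoided. -/
lemma sum_errorProb_le :
    ∑ j, errorProb K f H δ c i j ≤ K * s *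
      ∑ z : Fin K × ListWire s n b → Bool, (if Good f H i δ z then 0 else runsProb c i z) := by
  unfold errorProb
  rw [Finset.sum_comm, Finset.mul_sum]
  refine Finset.sum_le_sum fun z _ => ?_
  by_cases hg : Good f H i δ z
  · simp [hg]
  · simp only [if_neg hg, ← sum_lead]
    rw [Finset.sum_comm]
    have hp := runsProb_nonneg c i z
    have : ∀ κ : Fin K × Fin s, ∑ j, (if Lead κ z ∧ column (run z κ.1) κ.2 = j
        then runsProb c i z else 0) ≤ runsProb c i z := by
      intro κ
      simp only [ite_and]
      split_ifs
      · rw [Finset.sum_ite_eq, if_pos (Finset.mem_univ _)]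
      · simpa using hp
    refine (Finset.sum_le_sum fun κ _ => this κ).trans_eq ?_
    simp

open Classical in
/-- The entrywise error made by the procedure, on and off the support of `H`. -/
lemma norm_found_mul_mean_sub_le (hc : Circ c k) (hH : H.IsHermitian) (hδ : 0 < δ)
    (hN : ‖H i j‖ ≤ N * δ)
    (hε : ∀ i, ∑ z : Fin K × ListWire s n b → Bool,
      (if Good f H i δ z then 0 else runsProb c i z) ≤ ε) :
    ‖(foundProb K c j i : ℂ) * meanEstimate K N f δ c i j - H j i‖ ≤
      (if H i j ≠ 0 then 4 * δ + 4 * (N * δ) * ε else 0) +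
        2 * (N * δ) * min (errorProb K f H δ c i j) (errorProb K f H δ c j i) := by
  have hΛ : 0 ≤ N * δ := by positivity
  have hji : H j i = star (H i j) := (hH.apply j i).symm
  have hP0 : 0 ≤ foundProb K c j i := foundProb_nonneg
  have hP1 : foundProb K c j i ≤ 1 := foundProb_le_one hc
  by_cases h : H i j = 0
  · have h' : H j i = 0 := by rw [hji, h, star_zero]
    rw [if_neg (not_not.2 h), h', sub_zero, zero_add, norm_mul, Complex.norm_real,
      Real.norm_of_nonneg hP0]
    have h1 := norm_meanEstimate_le (K := K) (N := N) (f := f) (c := c) (i := i) (j := j) hδ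
    have hQ0 : 0 ≤ foundProb K c i j := foundProb_nonneg
    have hQ1 : foundProb K c i j ≤ 1 := foundProb_le_one hc
    rw [← foundProb_eq_errorProb (f := f) (δ := δ) h, ← foundProb_eq_errorProb (f := f) (δ := δ) h']
    have h2 := norm_nonneg (meanEstimate K N f δ c i j)
    rcases min_cases (foundProb K c i j) (foundProb K c j i) with ⟨he, -⟩ | ⟨he, -⟩ <;> rw [he]
    · nlinarith
    · have : ‖meanEstimate K N f δ c i j‖ ≤ 2 * (N * δ) := by nlinarith
      nlinarith
  · have h' : H j i ≠ 0 := by rw [hji]; exact star_ne_zero.2 h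
    rw [if_pos h, hji]
    have h1 := norm_meanEstimate_sub_le (K := K) (f := f) hc hδ hN h
    have h2 := one_sub_foundProb_le (K := K) (f := f) (δ := δ) hc h'
    have h3 := hε i
    have h4 := hε j
    have hε0 : 0 ≤ ε := le_trans (Finset.sum_nonneg fun z _ => by
      split_ifs <;> simp [runsProb_nonneg]) (hε i)
    have h5 : 0 ≤ min (errorProb K f H δ c i j) (errorProb K f H δ c j i) :=
      le_min errorProb_nonneg errorProb_nonneg
    have heq : (foundProb K c j i : ℂ) * meanEstimate K N f δ c i j - star (H i j) =
        (foundProb K c j i : ℂ) * (meanEstimate K N f δ c i j - star (H i j)) -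
          ((1 - foundProb K c j i : ℝ) : ℂ) * star (H i j) := by
      push_cast; ring
    rw [heq]
    refine (norm_sub_le _ _).trans ?_
    rw [norm_mul, norm_mul, norm_star, Complex.norm_real, Complex.norm_real,
      Real.norm_of_nonneg hP0, Real.norm_of_nonneg (sub_nonneg.2 hP1)]
    have h6 : ‖meanEstimate K N f δ c i j - star (H i j)‖ ≤ 4 * δ + 3 * (N * δ) * ε :=
      h1.trans (by gcongr)
    have h7 : foundProb K c j i * ‖meanEstimate K N f δ c i j - star (H i j)‖ ≤
        4 * δ + 3 * (N * δ) * ε := by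
      nlinarith [norm_nonneg (meanEstimate K N f δ c i j - star (H i j))]
    have h8 : (1 - foundProb K c j i) * ‖H i j‖ ≤ ε * (N * δ) :=
      mul_le_mul (h2.trans h4) hN (norm_nonneg _) hε0
    have h9 : 0 ≤ 2 * (N * δ) * min (errorProb K f H δ c i j) (errorProb K f H δ c j i) := by
      positivity
    linarith

end Runs

/-! ### Product formulas -/

section Banach

variable {𝔸 : Type*} [NormedRing 𝔸] [NormOneClass 𝔸]

/-- Errors of contractions add up. -/
lemma norm_pow_sub_pow_le {a b : 𝔸} (ha : ‖a‖ ≤ 1) (hb : ‖b‖ ≤ 1) (r : ℕ) :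
    ‖a ^ r - b ^ r‖ ≤ r * ‖a - b‖ := by
  induction r with
  | zero => simp
  | succ r ih =>
    have h : a ^ (r + 1) - b ^ (r + 1) = a ^ r * (a - b) + (a ^ r - b ^ r) * b := by
      rw [pow_succ, pow_succ]; noncomm_ring
    rw [h]
    refine (norm_add_le _ _).trans ?_
    have h1 : ‖a ^ r * (a - b)‖ ≤ 1 * ‖a - b‖ := (norm_mul_le _ _).trans (by
      gcongr
      exact (norm_pow_le a r).trans (pow_le_one₀ (norm_nonneg _) ha))
    have h2 : ‖(a ^ r - b ^ r) * b‖ ≤ (r * ‖a - b‖) * 1 := (norm_mul_le _ _).trans (by gcongr)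
    push_cast
    linarith

/-- A product of contractions `A i ≈ 1 + X i` is `1 + ∑ X i` up to second order, in any order of the
factors. -/
lemma norm_prod_sub_one_sub_sum_le {ι : Type*} {A X : ι → 𝔸} {θ : ℝ} (h0 : 0 ≤ θ) (h1 : θ ≤ 1)
    (hA : ∀ i, ‖A i‖ ≤ 1) (hX : ∀ i, ‖X i‖ ≤ θ) (hAX : ∀ i, ‖A i - 1 - X i‖ ≤ θ ^ 2) (l : List ι) :
    ‖(l.map A).prod - 1 - (l.map X).sum‖ ≤ (l.length * θ) ^ 2 := by
  induction l with
  | nil => simp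
  | cons i l ih =>
    rw [List.map_cons, List.map_cons, List.prod_cons, List.sum_cons, List.length_cons]
    set P := (l.map A).prod
    set s := (l.map X).sum with hs
    have hsum : ‖s‖ ≤ l.length * θ := by
      rw [hs]
      clear ih hs s P
      induction l with
      | nil => simp
      | cons j l ih =>
        rw [List.map_cons, List.sum_cons, List.length_cons]
        push_cast
        linarith [norm_add_le (X j) (l.map X).sum, hX j]
    have h : A i * P - 1 - (X i + s) = A i * (P - 1 - s) + (A i - 1 - X i) + (A i - 1) * s := by
      noncomm_ring
    have hA1 : ‖A i - 1‖ ≤ 2 * θ := by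
      have : A i - 1 = (A i - 1 - X i) + X i := by abel
      rw [this]
      refine (norm_add_le _ _).trans ?_
      nlinarith [hX i, hAX i]
    have e1 : ‖A i * (P - 1 - s)‖ ≤ 1 * (l.length * θ) ^ 2 := (norm_mul_le _ _).trans (by
      gcongr; exact hA i)
    have e2 : ‖(A i - 1) * s‖ ≤ (2 * θ) * (l.length * θ) := (norm_mul_le _ _).trans (by gcongr)
    rw [h]
    refine (norm_add₃_le).trans ?_
    push_cast
    nlinarith [hAX i]

lemma norm_exp_sub_one_sub_le [NormedAlgebra ℂ 𝔸] [CompleteSpace 𝔸] {x : 𝔸} (hx : ‖x‖ ≤ 1) :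
    ‖NormedSpace.exp x - 1 - x‖ ≤ ‖x‖ ^ 2 := by
  have h1 := (hasSum_nat_add_iff' 2).2 (NormedSpace.exp_series_hasSum_exp' (𝕂 := ℂ) x)
  have h2 := (hasSum_nat_add_iff' 2).2 (NormedSpace.exp_series_hasSum_exp' (𝕂 := ℝ) ‖x‖)
  simp only [Finset.sum_range_succ, Finset.sum_range_zero, Nat.factorial_zero, Nat.factorial_one,
    Nat.cast_one, inv_one, one_smul, pow_zero, pow_one, zero_add, ← sub_sub] at h1 h2
  refine (h1.norm_le_of_bounded h2 fun r => ?_).trans ?_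
  · rw [norm_smul, norm_inv, RCLike.norm_natCast, smul_eq_mul]
    gcongr
    exact norm_pow_le _ _
  · rw [← Real.exp_eq_exp_ℝ]
    have := Real.norm_exp_sub_one_sub_id_le (x := ‖x‖) (by rwa [norm_norm])
    rw [norm_norm] at this
    exact (le_abs_self _).trans this

lemma exp_neg_I_smul_mem_unitary [NormedAlgebra ℂ 𝔸] [CompleteSpace 𝔸] [StarRing 𝔸] [CStarRing 𝔸]
    [StarModule ℂ 𝔸] {a : 𝔸} (ha : IsSelfAdjoint a) (t : ℝ) :
    NormedSpace.exp ((-(Complex.I * (t : ℂ))) • a) ∈ unitary 𝔸 := by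
  have h : IsSelfAdjoint ((-t : ℂ) • a) := by
    rw [IsSelfAdjoint, star_smul, ha.star_eq]
    simp
  have := (selfAdjoint.expUnitary (⟨_, h⟩ : selfAdjoint 𝔸)).2
  rw [selfAdjoint.expUnitary_coe] at this
  simp only [smul_smul] at this
  rwa [mul_neg] at this

end Banach

open scoped Matrix.Norms.L2Operator

/-! ### The spectral norm and the entries of a matrix -/

section Matrix

variable {m n : Type*} [Fintype m] [DecidableEq m] [Fintype n] [DecidableEq n]

/-- Schur's test: the spectral norm is bounded by the row sums and column sums. -/
lemma l2_opNorm_le_of_sum_le {M : Matrix m n ℂ} {β : ℝ} (hβ : 0 ≤ β) (hr : ∀ j, ∑ i, ‖M j i‖ ≤ β)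
    (hc : ∀ i, ∑ j, ‖M j i‖ ≤ β) : ‖M‖ ≤ β := by
  rw [Matrix.l2_opNorm_def]
  refine ContinuousLinearMap.opNorm_le_bound _ hβ fun x => ?_
  rw [← sq_le_sq₀ (norm_nonneg _) (by positivity), mul_pow, EuclideanSpace.norm_sq_eq,
    EuclideanSpace.norm_sq_eq]
  have key : ∀ j, ‖∑ i, M j i * x i‖ ^ 2 ≤ β * ∑ i, ‖M j i‖ * ‖x i‖ ^ 2 := by
    intro j
    have h1 : ‖∑ i, M j i * x i‖ ≤ ∑ i, √‖M j i‖ * (√‖M j i‖ * ‖x i‖) := by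
      refine (norm_sum_le _ _).trans_eq (Finset.sum_congr rfl fun i _ => ?_)
      rw [norm_mul, ← mul_assoc, Real.mul_self_sqrt (norm_nonneg _)]
    have h2 := Finset.sum_mul_sq_le_sq_mul_sq Finset.univ (fun i => √‖M j i‖)
      fun i => √‖M j i‖ * ‖x i‖
    simp only [mul_pow, Real.sq_sqrt (norm_nonneg _)] at h2
    calc ‖∑ i, M j i * x i‖ ^ 2 ≤ (∑ i, √‖M j i‖ * (√‖M j i‖ * ‖x i‖)) ^ 2 := by gcongr
      _ ≤ _ := h2
      _ ≤ _ := by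
        gcongr
        exact hr j
  calc ∑ j, ‖∑ i, M j i * x i‖ ^ 2 ≤ ∑ j, β * ∑ i, ‖M j i‖ * ‖x i‖ ^ 2 :=
        Finset.sum_le_sum fun j _ => key j
    _ = β * ∑ i, (∑ j, ‖M j i‖) * ‖x i‖ ^ 2 := by
        rw [← Finset.mul_sum, Finset.sum_comm]
        simp only [Finset.sum_mul]
    _ ≤ β * ∑ i, β * ‖x i‖ ^ 2 := by
        gcongr with i
        exact hc i
    _ = β ^ 2 * ∑ i, ‖x i‖ ^ 2 := by rw [← Finset.mul_sum]; ring

lemma norm_apply_le (M : Matrix m n ℂ) (j : m) (i : n) : ‖M j i‖ ≤ ‖M‖ := by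
  have h := Matrix.l2_opNorm_mulVec M (EuclideanSpace.single i 1)
  rw [PiLp.norm_single, norm_one, mul_one] at h
  refine le_trans ?_ h
  refine le_trans (le_of_eq ?_) (PiLp.norm_apply_le _ j)
  simp

end Matrix

/-! ### From block encodings to circuits -/

section Sim

variable {W V A : Type} [Fintype W] [DecidableEq W] [Fintype V] [DecidableEq V]
  [Fintype A] [DecidableEq A]

lemma adjoinZeros_padZero (x : W → Bool) : adjoinZeros W A (padZero A x) x = 1 := if_pos rfl

lemma adjoinZeros_of_ne {y : W ⊕ A → Bool} {x : W → Bool} (h : y ≠ padZero A x) :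
    adjoinZeros W A y x = 0 := if_neg h

lemma mul_adjoinZeros_apply (M : Op (W ⊕ A)) (y : W ⊕ A → Bool) (x : W → Bool) :
    (M * adjoinZeros W A) y x = M y (padZero A x) := by
  rw [Matrix.mul_apply, Finset.sum_eq_single (padZero A x)]
  · rw [adjoinZeros_padZero, mul_one]
  · intro w _ hw
    rw [adjoinZeros_of_ne hw, mul_zero]
  · simp

lemma zeroBlock_eq (M : Op (W ⊕ A)) :
    zeroBlock M = (adjoinZeros W A).conjTranspose * (M * adjoinZeros W A) := by
  ext y x
  rw [Matrix.mul_apply, Finset.sum_eq_single (padZero A y)]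
  · rw [Matrix.conjTranspose_apply, adjoinZeros_padZero, star_one, one_mul, mul_adjoinZeros_apply]
    rfl
  · intro w _ hw
    rw [Matrix.conjTranspose_apply, adjoinZeros_of_ne hw, star_zero, zero_mul]
  · simp

lemma adjoinZeros_conjTranspose_mul :
    (adjoinZeros W A).conjTranspose * adjoinZeros W A = 1 := by
  have h := zeroBlock_eq (1 : Op (W ⊕ A))
  rw [Matrix.one_mul] at h
  rw [← h]
  ext y x
  rw [zeroBlock, Matrix.one_apply, Matrix.one_apply]
  exact ite_congr_inst ⟨fun h => congrArg (fun z => z ∘ Sum.inl) h, fun h => h ▸ rfl⟩ rfl rfl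

lemma norm_adjoinZeros_le : ‖adjoinZeros W A‖ ≤ 1 := by
  have h := Matrix.l2_opNorm_conjTranspose_mul_self (adjoinZeros W A)
  rw [adjoinZeros_conjTranspose_mul, CStarRing.norm_one] at h
  nlinarith [norm_nonneg (adjoinZeros W A)]

lemma norm_le_one_of_mem_unitary {n : Type*} [Fintype n] [DecidableEq n] {U : Matrix n n ℂ}
    (hU : U ∈ Matrix.unitaryGroup n ℂ) : ‖U‖ ≤ 1 := by
  have h := Matrix.l2_opNorm_conjTranspose_mul_self U
  rw [← Matrix.star_eq_conjTranspose, Matrix.mem_unitaryGroup_iff'.1 hU] at h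
  have h1 : ‖(1 : Matrix n n ℂ)‖ ≤ 1 :=
    l2_opNorm_le_of_sum_le zero_le_one (fun j => by simp [Matrix.one_apply, apply_ite norm])
      fun j => by simp [Matrix.one_apply, apply_ite norm]
  nlinarith [norm_nonneg U]

lemma Enc.norm_le_one {M : Op W} {S : ℕ} (h : Enc M S) : ‖M‖ ≤ 1 := by
  obtain ⟨A, _, _, C, k, hC, -, rfl⟩ := h
  rw [zeroBlock_eq]
  have h1 := norm_adjoinZeros_le (W := W) (A := A)
  calc ‖(adjoinZeros W A).conjTranspose * (C * adjoinZeros W A)‖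
      ≤ ‖(adjoinZeros W A).conjTranspose‖ * ‖C * adjoinZeros W A‖ := Matrix.l2_opNorm_mul _ _
    _ ≤ 1 * (1 * 1) := by
        gcongr
        · rwa [Matrix.l2_opNorm_conjTranspose]
        · refine (Matrix.l2_opNorm_mul _ _).trans ?_
          gcongr
          exact norm_le_one_of_mem_unitary hC.mem_unitary
    _ = 1 := by norm_num

/-- If the block of a circuit is close to a unitary, then the circuit nearly returns its ancillas
to zero: nothing of the norm is left for the other blocks. -/
lemma Enc.exists_circuit {M U : Op W} {S : ℕ} (h : Enc M S)
    (hU : U ∈ Matrix.unitaryGroup (W → Bool) ℂ) {η : ℝ} (hη : ‖M - U‖ ≤ η) :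
    ∃ (m : ℕ) (c : List (Gate (W ⊕ Fin m))), circuitSize c ≤ Fintype.card W + S ∧
      ‖circuitMatrix c * adjoinZeros W (Fin m) - adjoinZeros W (Fin m) * U‖ ^ 2 ≤ 2 * η := by
  obtain ⟨A, _, _, C', k, hC', hS, rfl⟩ := h
  let e : W ⊕ A ≃ W ⊕ Fin (Fintype.card A) := (Equiv.refl W).sumCongr (Fintype.equivFin A)
  obtain ⟨c, hc, hck⟩ := hC'.lift e.toEmbedding
  refine ⟨Fintype.card A, c, ?_, ?_⟩
  · simp only [circuitSize, Fintype.card_sum, Fintype.card_fin]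
    omega
  set C := circuitMatrix c with hCdef
  have hCu : C ∈ Matrix.unitaryGroup _ ℂ := Circ.mem_unitary ⟨c, rfl, le_rfl⟩
  have hM : SparseHamiltonian.zeroBlock C = SparseHamiltonian.zeroBlock C' := by
    rw [hc]
    ext y x
    rw [SparseHamiltonian.zeroBlock, lift_equiv_apply, SparseHamiltonian.zeroBlock]
    congr 1 <;> · funext u; rcases u with u | u <;> rfl
  rw [← hM] at hη
  set J := adjoinZeros W (Fin (Fintype.card A))
  set M := SparseHamiltonian.zeroBlock C
  have hMJ : M = J.conjTranspose * (C * J) := zeroBlock_eq C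
  have hJJ : J.conjTranspose * J = 1 := adjoinZeros_conjTranspose_mul
  have hCC : C.conjTranspose * C = 1 := by
    rw [← Matrix.star_eq_conjTranspose]; exact Matrix.mem_unitaryGroup_iff'.1 hCu
  have hUU : U.conjTranspose * U = 1 := by
    rw [← Matrix.star_eq_conjTranspose]; exact Matrix.mem_unitaryGroup_iff'.1 hU
  have hMs : M.conjTranspose = J.conjTranspose * (C.conjTranspose * J) := by
    rw [hMJ, Matrix.conjTranspose_mul, Matrix.conjTranspose_mul, Matrix.conjTranspose_conjTranspose,
      Matrix.mul_assoc]
  -- `C J` and `J U` are isometries, and their inner products are given by the block `M`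
  have key : (C * J - J * U).conjTranspose * (C * J - J * U) =
      (U - M).conjTranspose * U + U.conjTranspose * (U - M) := by
    have e1 : (C * J).conjTranspose * (C * J) = 1 := by
      rw [Matrix.conjTranspose_mul, Matrix.mul_assoc, ← Matrix.mul_assoc _ C, hCC, Matrix.one_mul, hJJ]
    have e2 : (J * U).conjTranspose * (J * U) = 1 := by
      rw [Matrix.conjTranspose_mul, Matrix.mul_assoc, ← Matrix.mul_assoc _ J, hJJ, Matrix.one_mul, hUU]
    have e3 : (C * J).conjTranspose * (J * U) = M.conjTranspose * U := by
      rw [hMs, Matrix.conjTranspose_mul]; simp only [Matrix.mul_assoc]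
    have e4 : (J * U).conjTranspose * (C * J) = U.conjTranspose * M := by
      rw [hMJ, Matrix.conjTranspose_mul]; simp only [Matrix.mul_assoc]
    rw [Matrix.conjTranspose_sub, Matrix.conjTranspose_sub, Matrix.sub_mul, Matrix.sub_mul,
      Matrix.mul_sub, Matrix.mul_sub, Matrix.mul_sub, e1, e2, e3, e4, hUU]
    abel
  have hU1 := norm_le_one_of_mem_unitary hU
  rw [pow_two, ← Matrix.l2_opNorm_conjTranspose_mul_self, key]
  rw [norm_sub_rev] at hη
  refine (norm_add_le _ _).trans ?_
  have h1 : ‖(U - M).conjTranspose * U‖ ≤ ‖U - M‖ * 1 := (Matrix.l2_opNorm_mul _ _).trans (by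
    rw [Matrix.l2_opNorm_conjTranspose]; gcongr)
  have h2 : ‖U.conjTranspose * (U - M)‖ ≤ 1 * ‖U - M‖ := (Matrix.l2_opNorm_mul _ _).trans (by
    rw [Matrix.l2_opNorm_conjTranspose]; gcongr)
  linarith

/-- The Trotter formula: if `H` is nearly a sum of small multiples of block encoded operators, then
`e^{-iHt}` is nearly block encoded by `R` rounds of short rotations generated by these operators. -/
theorem Enc.trotter {T : Type} [Fintype T] {H : Op W} (hH : H.IsHermitian) {M : T → Op W} {u : T → ℂ}
    {S R : ℕ} {h β δ t : ℝ} (hM : ∀ τ, Enc (ctrl fun e : Unit → Bool => if e () then M τ else 1) S)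
    (hM1 : ∀ τ, ‖M τ‖ ≤ 1) (hu : ∀ τ, u τ * star (u τ) = 1)
    (hsum : ‖∑ τ, (δ * u τ : ℂ) • M τ - H‖ ≤ β) (hh : ‖H‖ ≤ h) (hδ : 0 ≤ δ) (ht : 0 ≤ t) (hR : 0 < R)
    (h1 : t / R * δ ≤ 1) (h2 : t / R * h ≤ 1) :
    ∃ A, Enc A (R * (Fintype.card T * (2 * S + 9))) ∧
      ‖A - NormedSpace.exp ((-(Complex.I * (t : ℂ))) • H)‖ ≤
        t ^ 2 * ((Fintype.card T * δ) ^ 2 + h ^ 2) / R + t * β := by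
  set φ := t / R with hφ
  have hφ0 : 0 ≤ φ := by positivity
  set θ := φ * δ with hθ
  have hθ0 : 0 ≤ θ := by positivity
  have hR' : (0 : ℝ) < R := by exact_mod_cast hR
  let G : T → Op W := fun τ => (1 / 2 : ℂ) • (u τ • M τ + star (u τ) • (M τ).conjTranspose)
  let B : T → Op W := fun τ => (Real.cos θ : ℂ) • (1 : Op W) -
      (Complex.I * Real.sin θ / 2) • (u τ • M τ + star (u τ) • (M τ).conjTranspose)
  let X : T → Op W := fun τ => (-(Complex.I * (θ : ℂ))) • G τ
  have hB : ∀ τ, Enc (B τ) (2 * S + 9) := fun τ => (hM τ).rotation θ (hu τ)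
  have hun : ∀ τ, ‖u τ‖ = 1 := by
    intro τ
    have := congrArg norm (hu τ)
    rw [norm_mul, norm_star, norm_one] at this
    nlinarith [norm_nonneg (u τ)]
  have hG : ∀ τ, ‖G τ‖ ≤ 1 := by
    intro τ
    have e1 : ‖u τ • M τ‖ ≤ 1 := by rw [norm_smul, hun, one_mul]; exact hM1 τ
    have e2 : ‖star (u τ) • (M τ).conjTranspose‖ ≤ 1 := by
      rw [norm_smul, norm_star, hun, one_mul, Matrix.l2_opNorm_conjTranspose]; exact hM1 τ
    rw [show ‖G τ‖ = _ from norm_smul _ _]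
    have e3 := norm_add_le (u τ • M τ) (star (u τ) • (M τ).conjTranspose)
    rw [show ‖(1 / 2 : ℂ)‖ = 1 / 2 by norm_num]
    linarith
  have hX : ∀ τ, ‖X τ‖ ≤ θ := by
    intro τ
    rw [show ‖X τ‖ = _ from norm_smul _ _, norm_neg, norm_mul, Complex.norm_I, one_mul,
      Complex.norm_real, Real.norm_of_nonneg hθ0]
    exact mul_le_of_le_one_right hθ0 (hG τ)
  have hBX : ∀ τ, ‖B τ - 1 - X τ‖ ≤ θ ^ 2 := by
    intro τ
    have e : B τ - 1 - X τ = ((Real.cos θ - 1 : ℝ) : ℂ) • (1 : Op W) +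
        (Complex.I * ((θ - Real.sin θ : ℝ) : ℂ)) • G τ := by
      simp only [B, X, G]
      push_cast
      module
    have e1 : ‖((Real.cos θ - 1 : ℝ) : ℂ) • (1 : Op W)‖ ≤ θ ^ 2 / 2 := by
      rw [norm_smul, CStarRing.norm_one, mul_one, Complex.norm_real, Real.norm_eq_abs, abs_le]
      have := Real.one_sub_sq_div_two_le_cos (x := θ)
      have := Real.cos_le_one θ
      constructor <;> nlinarith [sq_nonneg θ]
    have e2 : ‖(Complex.I * ((θ - Real.sin θ : ℝ) : ℂ)) • G τ‖ ≤ θ ^ 2 / 6 := by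
      rw [norm_smul, norm_mul, Complex.norm_I, one_mul, Complex.norm_real, Real.norm_eq_abs]
      have e3 := Real.abs_sub_sin_le θ
      rw [abs_of_nonneg hθ0] at e3
      have e4 : θ ^ 3 ≤ θ ^ 2 := pow_le_pow_of_le_one hθ0 h1 (by norm_num)
      have := mul_le_of_le_one_right (abs_nonneg (θ - Real.sin θ)) (hG τ)
      linarith
    rw [e]
    refine (norm_add_le _ _).trans ?_
    nlinarith [sq_nonneg θ]
  let A₁ : Op W := (Finset.univ.toList.map B).prod
  have hA₁ : Enc A₁ (Fintype.card T * (2 * S + 9)) := by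
    have := Enc.list_prod (l := Finset.univ.toList.map B) (S := 2 * S + 9) (by
      intro N hN
      obtain ⟨τ, -, rfl⟩ := List.mem_map.1 hN
      exact hB τ)
    simpa using this
  refine ⟨A₁ ^ R, hA₁.pow R, ?_⟩
  set Y : Op W := (-(Complex.I * (φ : ℂ))) • H with hY
  have hexp : NormedSpace.exp ((-(Complex.I * (t : ℂ))) • H) = NormedSpace.exp Y ^ R := by
    let +nondep : NormedAlgebra ℚ (Op W) := .restrictScalars ℚ ℂ (Op W)
    rw [← NormedSpace.exp_nsmul]
    congr 1
    rw [hY, ← Nat.cast_smul_eq_nsmul ℂ, smul_smul]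
    congr 1
    have : (R : ℂ) ≠ 0 := by exact_mod_cast hR.ne'
    rw [hφ]
    push_cast
    field_simp
  have hYu : ‖NormedSpace.exp Y‖ ≤ 1 :=
    norm_le_one_of_mem_unitary (exp_neg_I_smul_mem_unitary (a := H) hH φ)
  have hYn : ‖Y‖ ≤ φ * h := by
    rw [hY, norm_smul, norm_neg, norm_mul, Complex.norm_I, one_mul, Complex.norm_real,
      Real.norm_of_nonneg hφ0]
    gcongr
  set D : Op W := ∑ τ, (δ * u τ : ℂ) • M τ - H with hD
  -- `H` is Hermitian, so it is also close to the Hermitian part of the sum of the `u τ • M τ`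
  have hXY : ∑ τ, X τ - Y = (-(Complex.I * (φ : ℂ)) * (1 / 2)) • (D + D.conjTranspose) := by
    have e1 : D.conjTranspose = ∑ τ, (δ * star (u τ) : ℂ) • (M τ).conjTranspose - H := by
      rw [hD, Matrix.conjTranspose_sub, Matrix.conjTranspose_sum, hH.eq]
      congr 1
      refine Finset.sum_congr rfl fun τ _ => ?_
      rw [Matrix.conjTranspose_smul, star_mul, mul_comm]
      simp
    have e2 : ∀ τ, X τ = (-(Complex.I * (φ : ℂ)) * (1 / 2)) • ((δ * u τ : ℂ) • M τ +
        (δ * star (u τ) : ℂ) • (M τ).conjTranspose) := by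
      intro τ
      simp only [X, G, hθ]
      push_cast
      module
    rw [Finset.sum_congr rfl fun τ _ => e2 τ, ← Finset.smul_sum, Finset.sum_add_distrib, e1, hD, hY]
    module
  have hXY' : ‖∑ τ, X τ - Y‖ ≤ φ * β := by
    rw [hXY, norm_smul, norm_mul, norm_neg, norm_mul, Complex.norm_I, one_mul, Complex.norm_real,
      Real.norm_of_nonneg hφ0]
    have e1 := norm_add_le D D.conjTranspose
    rw [Matrix.l2_opNorm_conjTranspose] at e1
    have e2 : ‖D + D.conjTranspose‖ ≤ 2 * β := by linarith
    have e3 : ‖(1 / 2 : ℂ)‖ = 1 / 2 := by norm_num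
    rw [e3]
    nlinarith
  have hprod : ‖A₁ - 1 - ∑ τ, X τ‖ ≤ (Fintype.card T * θ) ^ 2 := by
    have := norm_prod_sub_one_sub_sum_le hθ0 h1 (fun τ => (hB τ).norm_le_one) hX hBX
      Finset.univ.toList
    rwa [Finset.sum_map_toList, Finset.length_toList, Finset.card_univ] at this
  have hE := norm_exp_sub_one_sub_le (hYn.trans h2)
  have hstep : ‖A₁ - NormedSpace.exp Y‖ ≤ (Fintype.card T * θ) ^ 2 + φ * β + (φ * h) ^ 2 := by
    have e : A₁ - NormedSpace.exp Y = (A₁ - 1 - ∑ τ, X τ) + (∑ τ, X τ - Y) -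
        (NormedSpace.exp Y - 1 - Y) := by abel
    rw [e]
    refine (norm_sub_le _ _).trans (add_le_add ((norm_add_le _ _).trans (add_le_add hprod hXY')) ?_)
    exact hE.trans (by gcongr)
  rw [hexp]
  refine (norm_pow_sub_pow_le hA₁.norm_le_one hYu R).trans ?_
  calc R * ‖A₁ - NormedSpace.exp Y‖ ≤ R * ((Fintype.card T * θ) ^ 2 + φ * β + (φ * h) ^ 2) := by
        gcongr
    _ = _ := by
        rw [hθ, hφ]
        field_simp
        ring

end Sim

/-! ### Block encoding the steps of the walk -/

section Runs

variable {K s n b m f N k Z : ℕ} {c : Op (Fin n ⊕ (ListWire s n b ⊕ Fin m))}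
  {H : Matrix (Fin n → Bool) (Fin n → Bool) ℂ} {i j : Fin n → Bool} {δ ε : ℝ}

open Classical in
/-- The probability that `K` runs with input `i` satisfy `F` and have `j` as the column of the
item `κ`. -/
noncomputable def itemProb (c : Op (Fin n ⊕ (ListWire s n b ⊕ Fin m)))
    (F : (Fin K × ListWire s n b → Bool) → Prop) (κ : Fin K × Fin s) (i j : Fin n → Bool) : ℝ :=
  ∑ z, if F z ∧ z ∘ columnWires κ = j then runsProb c i z else 0

lemma itemProb_nonneg (F : (Fin K × ListWire s n b → Bool) → Prop) (κ : Fin K × Fin s) :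
    0 ≤ itemProb c F κ i j :=
  Finset.sum_nonneg fun z _ => by split_ifs <;> simp [runsProb_nonneg]

lemma sum_itemProb_le (hc : Circ c k) (F : (Fin K × ListWire s n b → Bool) → Prop)
    (κ : Fin K × Fin s) (i : Fin n → Bool) : ∑ j, itemProb c F κ i j ≤ 1 := by
  unfold itemProb
  rw [Finset.sum_comm, ← sum_runsProb (K := K) hc i]
  refine Finset.sum_le_sum fun z _ => ?_
  simp only [ite_and]
  split_ifs
  · rw [Finset.sum_ite_eq, if_pos (Finset.mem_univ _)]
  · simpa using runsProb_nonneg c i z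

lemma itemProb_le_one (hc : Circ c k) (F : (Fin K × ListWire s n b → Bool) → Prop)
    (κ : Fin K × Fin s) (i j : Fin n → Bool) : itemProb c F κ i j ≤ 1 :=
  (Finset.single_le_sum (f := fun j => itemProb c F κ i j) (fun _ _ => itemProb_nonneg F κ)
    (Finset.mem_univ j)).trans (sum_itemProb_le hc F κ i)

/-- A step goes from `i` to `j` if, among the items found for the row `i`, `κ` is a leading one
with column `j` whose value reaches a level, and among those found for the row `j`, `κ'` is a leading
one with column `i`. -/
structure StepIndex (K s N : ℕ) where
  /-- the item `κ` -/
  item : Fin K × Fin s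
  /-- the item `κ'` -/
  back : Fin K × Fin s
  /-- the level that the value is compared with -/
  level : Bool × Fin (2 * N)

/-- The indices of the steps as triples. -/
def StepIndex.equiv (K s N : ℕ) :
    StepIndex K s N ≃ ((Fin K × Fin s) × (Bool × Fin (2 * N))) × (Fin K × Fin s) where
  toFun τ := ((τ.item, τ.level), τ.back)
  invFun x := ⟨x.1.1, x.2, x.1.2⟩

noncomputable instance : Fintype (StepIndex K s N) := Fintype.ofEquiv _ (StepIndex.equiv K s N).symm

lemma StepIndex.card : Fintype.card (StepIndex K s N) = (K * s) ^ 2 * (4 * N) := by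
  rw [Fintype.card_congr (StepIndex.equiv K s N)]
  simp only [Fintype.card_prod, Fintype.card_fin, Fintype.card_bool]
  ring

/-- The weights of the first half of a step. -/
noncomputable def StepIndex.forward (τ : StepIndex K s N)
    (c : Op (Fin n ⊕ (ListWire s n b ⊕ Fin m))) (f : ℕ) (δ : ℝ) : (Fin n → Bool) → (Fin n → Bool) → ℝ :=
  itemProb c (fun z => Lead τ.item z ∧
    Reached f δ τ.level z (column (run z τ.item.1) τ.item.2)) τ.item

/-- The operator that makes a step; `τ.op j i` is the probability of going from `i` to `j` and of
passing the test of the way back. -/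
noncomputable def StepIndex.op (τ : StepIndex K s N) (c : Op (Fin n ⊕ (ListWire s n b ⊕ Fin m)))
    (f : ℕ) (δ : ℝ) : Op (Fin n) :=
  fun j i => ((itemProb c (Lead τ.back) τ.back j i * τ.forward c f δ i j : ℝ) : ℂ)

/-- An item has only one column, so both factors of an entry are substochastic. -/
lemma StepIndex.norm_op_le (hc : Circ c k) (τ : StepIndex K s N) : ‖τ.op c f δ‖ ≤ 1 := by
  have h0 : ∀ F κ i j, 0 ≤ itemProb (K := K) c F κ i j := fun F κ i j => itemProb_nonneg F κ
  have hn : ∀ j i, ‖τ.op c f δ j i‖ = itemProb c (Lead τ.back) τ.back j i * τ.forward c f δ i j := by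
    intro j i
    unfold StepIndex.op
    rw [Complex.norm_real]
    exact Real.norm_of_nonneg (mul_nonneg (h0 _ _ _ _) (h0 _ _ _ _))
  refine l2_opNorm_le_of_sum_le zero_le_one (fun j => ?_) fun i => ?_
  · simp only [hn]
    exact (Finset.sum_le_sum fun i _ => mul_le_of_le_one_right (h0 _ _ _ _)
      (itemProb_le_one hc _ _ _ _)).trans (sum_itemProb_le hc _ _ j)
  · simp only [hn]
    exact (Finset.sum_le_sum fun j _ => mul_le_of_le_one_left (h0 _ _ _ _)
      (itemProb_le_one hc _ _ _ _)).trans (sum_itemProb_le hc _ _ i)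

/-- The cost of a step. -/
def stepCost (Z : ℕ) : ℕ := 2 * ((4 * levelCost Z + 17) + 18 * Z + Z * (3 * Z)) + 2 * Z

/-- The bound `Z` serves for all the sizes that occur. The lists may be empty (`s = 0`), and then `b`
is not bounded; but then there are no steps. -/
lemma StepIndex.enc (hc : Circ c k) (hZ : Fintype.card (Fin n ⊕ (ListWire s n b ⊕ Fin m)) + k ≤ Z)
    (hK : 2 ^ K ≤ Z) (τ : StepIndex K s N) :
    Enc (ctrl fun e : Unit → Bool => if e () then τ.op c f δ else 1) (stepCost Z) := by
  have hs1 : 1 ≤ s := Nat.succ_le_of_lt (Fin.pos τ.item.2)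
  have hZ' := hZ
  simp only [Fintype.card_sum, Fintype.card_prod, Fintype.card_fin, Fintype.card_unit] at hZ'
  have hn : n ≤ Z := by omega
  have hs : s ≤ Z := by nlinarith
  have hb : b ≤ Z := by nlinarith
  have hKZ : K ≤ Z := Nat.lt_two_pow_self.le.trans hK
  have h1 := Enc.rowOp hc (Comp.lead_and_reached (f := f) (δ := δ) hn hs hb hK τ.item τ.level)
    (columnWires τ.item)
  have h2 := Enc.rowOp hc (Comp.lead (b := b) hn hs hK τ.back) (columnWires τ.back)
  refine (h1.walk h2).mono ?_
  have hle : leadCost Z ≤ levelCost Z := by unfold levelCost; omega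
  have hprod : K * (3 * Fintype.card (Fin n ⊕ (ListWire s n b ⊕ Fin m)) + 2 * k) ≤ Z * (3 * Z) :=
    Nat.mul_le_mul hKZ (by omega)
  unfold stepCost
  rw [Fintype.card_fin]
  omega

open Classical in
/-- The sum over the items for the row `j` gives the probability of finding `i` there, the sum over
the items and levels for the row `i` gives the expected estimate of the entry. -/
lemma sum_step_op : ∑ τ : StepIndex K s N, (δ * levelUnit τ.level : ℂ) • τ.op c f δ =
    fun j i => (foundProb K c j i : ℂ) * meanEstimate K N f δ c i j := by
  ext j i
  have hback : (foundProb K c j i : ℂ) =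
      ∑ κ : Fin K × Fin s, (itemProb c (Lead κ) κ j i : ℂ) := by
    rw [← Complex.ofReal_sum]
    congr 1
    unfold itemProb foundProb
    rw [Finset.sum_comm]
    exact Finset.sum_congr rfl fun z _ => (sum_lead _).symm
  have hforth : meanEstimate K N f δ c i j = ∑ x : (Fin K × Fin s) × (Bool × Fin (2 * N)),
      (δ * levelUnit x.2 : ℂ) * (itemProb c (fun z => Lead x.1 z ∧
        Reached f δ x.2 z (column (run z x.1.1) x.1.2)) x.1 i j : ℂ) := by
    have hitem : ∀ x : (Fin K × Fin s) × (Bool × Fin (2 * N)), itemProb c (fun z => Lead x.1 z ∧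
        Reached f δ x.2 z (column (run z x.1.1) x.1.2)) x.1 i j = ∑ z : Fin K × ListWire s n b → Bool,
        if Reached f δ x.2 z j ∧ (Lead x.1 z ∧ column (run z x.1.1) x.1.2 = j)
          then runsProb c i z else 0 := by
      intro x
      refine Finset.sum_congr rfl fun z _ => ite_congr_inst ?_ rfl rfl
      rw [comp_columnWires]
      constructor
      · rintro ⟨⟨h1, h2⟩, rfl⟩; exact ⟨h2, h1, rfl⟩
      · rintro ⟨h2, h1, rfl⟩; exact ⟨⟨h1, h2⟩, rfl⟩
    unfold meanEstimate
    simp only [hitem]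
    rw [Fintype.sum_prod_type, Finset.sum_comm]
    simp only [Complex.ofReal_sum, Finset.mul_sum]
    rw [Finset.sum_congr rfl fun l _ => Finset.sum_comm, Finset.sum_comm]
    refine Finset.sum_congr rfl fun z _ => ?_
    have key : ∀ l : Bool × Fin (2 * N), ∑ κ : Fin K × Fin s, (δ * levelUnit l : ℂ) *
        ((if Reached f δ l z j ∧ (Lead κ z ∧ column (run z κ.1) κ.2 = j)
          then runsProb c i z else 0 : ℝ) : ℂ) =
        (δ * levelUnit l : ℂ) * (if Reached f δ l z j then 1 else 0) *
          ((if InMajority z j then runsProb c i z else 0 : ℝ) : ℂ) := by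
      intro l
      rw [← Finset.mul_sum, ← Complex.ofReal_sum, mul_assoc (δ * levelUnit l : ℂ)]
      refine congrArg (fun w => (δ * levelUnit l : ℂ) * w) ?_
      by_cases hr : Reached f δ l z j
      · rw [if_pos hr, one_mul, ← sum_lead]
        congr 1
        exact Finset.sum_congr rfl fun κ _ => ite_congr_inst (and_iff_right hr) rfl rfl
      · simp [hr]
    rw [Finset.sum_congr rfl fun l _ => key l, ← Finset.sum_mul, sum_reached]
    split_ifs
    · rw [mul_comm]
    · simp
  rw [Matrix.sum_apply, hback, hforth, mul_comm, Fintype.sum_mul_sum]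
  rw [← (StepIndex.equiv K s N).symm.sum_comp, Fintype.sum_prod_type]
  refine Finset.sum_congr rfl fun x _ => Finset.sum_congr rfl fun κ' _ => ?_
  rw [Matrix.smul_apply, StepIndex.op, StepIndex.forward, smul_eq_mul]
  push_cast
  simp only [StepIndex.equiv, Equiv.coe_fn_symm_mk]
  ring

open Classical in
/-- The steps add up to `H`, up to a small error. Here `N * δ` bounds the entries, `d` the number of
non-zero entries in a row, and `ε` the probability that correct lists are no majority. -/
theorem norm_sum_step_op_sub_le {d : ℝ} (hc : Circ c k) (hH : H.IsHermitian) (hδ : 0 < δ)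
    (hN : ‖H‖ ≤ N * δ) (hε0 : 0 ≤ ε)
    (hε : ∀ i, ∑ z : Fin K × ListWire s n b → Bool,
      (if Good f H i δ z then 0 else runsProb c i z) ≤ ε)
    (hd : ∀ i, (({j | H i j ≠ 0} : Set _).ncard : ℝ) ≤ d) :
    ‖∑ τ : StepIndex K s N, (δ * levelUnit τ.level : ℂ) • τ.op c f δ - H‖ ≤
      d * (4 * δ + 4 * (N * δ) * ε) + 2 * (N * δ) * (K * s * ε) := by
  have hd0 : 0 ≤ d := (Nat.cast_nonneg _).trans (hd fun _ => false)
  have hentry : ∀ j i, ‖(foundProb K c j i : ℂ) * meanEstimate K N f δ c i j - H j i‖ ≤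
      (if H i j ≠ 0 then 4 * δ + 4 * (N * δ) * ε else 0) +
        2 * (N * δ) * min (errorProb K f H δ c i j) (errorProb K f H δ c j i) := fun j i =>
    norm_found_mul_mean_sub_le hc hH hδ ((norm_apply_le H i j).trans hN) hε
  have hsupp : ∀ i, ∑ j, (if H i j ≠ 0 then 4 * δ + 4 * (N * δ) * ε else 0) ≤
      d * (4 * δ + 4 * (N * δ) * ε) := by
    intro i
    rw [← Finset.sum_filter, Finset.sum_const, nsmul_eq_mul]
    have := hd i
    rw [Set.ncard_eq_toFinset_card', Set.toFinset_ofPred] at this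
    gcongr
  have herr : ∀ i, ∑ j, 2 * (N * δ) * errorProb K f H δ c i j ≤ 2 * (N * δ) * (K * s * ε) := by
    intro i
    rw [← Finset.mul_sum]
    have h1 := sum_errorProb_le (K := K) (f := f) (H := H) (δ := δ) (c := c) (i := i)
    have h2 := hε i
    refine mul_le_mul_of_nonneg_left (h1.trans ?_) (by positivity)
    gcongr
  rw [sum_step_op]
  have hΛ : 0 ≤ 2 * (N * δ) := by positivity
  refine l2_opNorm_le_of_sum_le (by positivity) (fun j => ?_) fun i => ?_
  · have hsymm : ∀ i, (H i j ≠ 0) ↔ (H j i ≠ 0) := by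
      intro i
      rw [← hH.apply j i]
      exact not_congr star_eq_zero.symm
    calc _ ≤ ∑ i, ((if H j i ≠ 0 then 4 * δ + 4 * (N * δ) * ε else 0) +
          2 * (N * δ) * errorProb K f H δ c j i) := by
          refine Finset.sum_le_sum fun i _ => (hentry j i).trans (add_le_add ?_ ?_)
          · simp only [hsymm, le_refl]
          · exact mul_le_mul_of_nonneg_left (min_le_right _ _) hΛ
      _ ≤ _ := by
          rw [Finset.sum_add_distrib]
          exact add_le_add (hsupp j) (herr j)
  · calc _ ≤ ∑ j, ((if H i j ≠ 0 then 4 * δ + 4 * (N * δ) * ε else 0) +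
          2 * (N * δ) * errorProb K f H δ c i j) := by
          refine Finset.sum_le_sum fun j _ => (hentry j i).trans (add_le_add le_rfl ?_)
          exact mul_le_mul_of_nonneg_left (min_le_left _ _) hΛ
      _ ≤ _ := by
          rw [Finset.sum_add_distrib]
          exact add_le_add (hsupp i) (herr i)

end Runs

/-! ### The choice of the parameters -/

/-- The inverse of the accuracy at which the entries of `H` are needed. -/
def accuracyInv (D Y : ℕ) : ℕ := 48 * D * Y ^ 3

/-- The inverse of the failure probability that can be tolerated. -/
def failureInv (D Y S₀ : ℕ) : ℕ := 600 * D ^ 2 * S₀ * Y ^ 3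

/-- The number of rounds, when the row circuit is run `K` times in each step. -/
def rounds (D Y S₀ K : ℕ) : ℕ := 4 * Y ^ 4 * (((K * S₀) ^ 2 * (4 * D)) ^ 2 + D ^ 2)

/-- The cost of `rounds` rounds, when the row circuit is run `K` times in each step. -/
def simulationCost (D Y S₀ K Z : ℕ) : ℕ :=
  rounds D Y S₀ K * ((K * S₀) ^ 2 * (4 * (D * accuracyInv D Y)) * (2 * stepCost Z + 9))

/-- The errors in the values, in the entries that are missed, and in those found by mistake, summed
over the time `Y`, stay below half of the total error `1 / (2 * Y ^ 2)`. The other half is left to the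
product formula. -/
lemma error_budget {D S Y : ℝ} (hD : 1 ≤ D) (hS : 1 ≤ S) (hY : 1 ≤ Y) :
    Y * (D * (4 * (1 / (48 * D * Y ^ 3)) + 4 * D * (1 / (600 * D ^ 2 * S * Y ^ 3))) +
      2 * D * (25 * S / (600 * D ^ 2 * S * Y ^ 3))) ≤ 1 / (4 * Y ^ 2) := by
  have e2 : D * (4 * (1 / (48 * D * Y ^ 3))) * Y = 1 / (12 * Y ^ 2) := by
    field_simp; norm_num
  have e3 : D * (4 * D * (1 / (600 * D ^ 2 * S * Y ^ 3))) * Y ≤ 1 / (150 * Y ^ 2) := by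
    have : D * (4 * D * (1 / (600 * D ^ 2 * S * Y ^ 3))) * Y = 1 / (150 * Y ^ 2) * (1 / S) := by
      field_simp; norm_num
    rw [this]
    exact mul_le_of_le_one_right (by positivity) (by rw [div_le_one (by positivity)]; exact hS)
  have e4 : 2 * D * (25 * S / (600 * D ^ 2 * S * Y ^ 3)) * Y ≤ 1 / (12 * Y ^ 2) := by
    have : 2 * D * (25 * S / (600 * D ^ 2 * S * Y ^ 3)) * Y = 1 / (12 * Y ^ 2) * (1 / D) := by
      field_simp; norm_num
    rw [this]
    exact mul_le_of_le_one_right (by positivity) (by rw [div_le_one (by positivity)]; exact hD)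
  have e5 : (1 : ℝ) / (4 * Y ^ 2) - (1 / (12 * Y ^ 2) + 1 / (150 * Y ^ 2) + 1 / (12 * Y ^ 2)) =
      23 / (300 * Y ^ 2) := by field_simp; norm_num
  have e6 : 0 ≤ 23 / (300 * Y ^ 2) := by positivity
  linarith

lemma mul_le_rounds (D Y S₀ K : ℕ) : Y * D ≤ rounds D Y S₀ K := by
  unfold rounds
  have e1 : Y ≤ Y ^ 4 := Nat.le_self_pow (by norm_num) Y
  have e2 : D ≤ D ^ 2 := Nat.le_self_pow (by norm_num) D
  calc Y * D ≤ Y ^ 4 * D ^ 2 := Nat.mul_le_mul e1 e2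
    _ ≤ 4 * Y ^ 4 * (((K * S₀) ^ 2 * (4 * D)) ^ 2 + D ^ 2) :=
      Nat.mul_le_mul (by omega) (Nat.le_add_left _ _)

lemma simulationCost_mono {D Y S₀ K K' Z : ℕ} (h : K ≤ K') :
    simulationCost D Y S₀ K Z ≤ simulationCost D Y S₀ K' Z := by
  unfold simulationCost
  refine Nat.mul_le_mul ?_ (Nat.mul_le_mul_right _ (Nat.mul_le_mul_right _ ?_))
  · unfold rounds; gcongr
  · gcongr

section Core

variable {n s b m f k D Y S₀ : ℕ} {c : Op (Fin n ⊕ (ListWire s n b ⊕ Fin m))}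
  {H : Matrix (Fin n → Bool) (Fin n → Bool) ℂ} {t α : ℝ}

open Classical in
/-- The simulation with explicit parameters: `D` bounds the norm of `H` and the number of entries in
a row, `S₀` the size of the row circuit, and `Y` the time `t` and the inverse accuracy. -/
theorem exists_enc_near_exp (hY : 1 ≤ Y) (hD : 1 ≤ D) (hS : 1 ≤ S₀) (hH : H.IsHermitian)
    (hHn : ‖H‖ ≤ D) (hd : ∀ i, (({j | H i j ≠ 0} : Set _).ncard : ℝ) ≤ D) (hc : Circ c k)
    (hcS : Fintype.card (Fin n ⊕ (ListWire s n b ⊕ Fin m)) + k ≤ S₀)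
    (hprob : ∀ i, 2 / 3 ≤ ∑ z with IsRowList f H i (1 / accuracyInv D Y) z, outcomeProb c i z)
    (ht : 0 < t) (htY : t ≤ Y) (hαY : 1 ≤ α * Y) :
    ∃ A, Enc A (simulationCost D Y S₀ (50 * failureInv D Y S₀) (S₀ + (2 * failureInv D Y S₀) ^ 25)) ∧
      ‖A - NormedSpace.exp ((-(Complex.I * (t : ℂ))) • H)‖ ≤ α ^ 2 / 2 := by
  set M := accuracyInv D Y with hM
  clear_value M
  set E := failureInv D Y S₀ with hE
  clear_value E
  set δ : ℝ := 1 / M with hδ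
  clear_value δ
  set N := D * M with hN
  clear_value N
  have hM1 : 1 ≤ M := by
    rw [hM, accuracyInv]
    exact Nat.one_le_iff_ne_zero.2 (by positivity)
  have hE1 : 1 ≤ E := by
    rw [hE, failureInv]
    exact Nat.one_le_iff_ne_zero.2 (by positivity)
  have hM0 : (0 : ℝ) < M := by exact_mod_cast hM1
  have hE0 : (0 : ℝ) < E := by exact_mod_cast hE1
  have hD0 : (1 : ℝ) ≤ D := by exact_mod_cast hD
  have hS0 : (1 : ℝ) ≤ S₀ := by exact_mod_cast hS
  have hY0 : (1 : ℝ) ≤ Y := by exact_mod_cast hY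
  have hδ0 : 0 < δ := by rw [hδ]; positivity
  have hNδ : (N : ℝ) * δ = D := by
    rw [hN, hδ]; push_cast; field_simp
  -- the failure probability will be at most `4 ^ (-L) ≤ 1 / E ^ 2`
  set L := Nat.log 2 E + 1 with hL
  clear_value L
  have hEL : E < 2 ^ L := hL ▸ Nat.lt_pow_succ_log_self (by norm_num) E
  have hLE : 2 ^ L ≤ 2 * E := by
    rw [hL, pow_succ, mul_comm]
    exact Nat.mul_le_mul_left 2 (Nat.pow_log_le_self 2 (by omega))
  -- `25` runs decrease the failure probability by a factor of `4`, as `(17 / 18) ^ 25 ≤ 1 / 4`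
  set K := 25 * L with hK
  clear_value K
  have hKE : K ≤ 50 * E := by have : L < 2 ^ L := Nat.lt_two_pow_self; omega
  set Z := S₀ + (2 * E) ^ 25 with hZ
  clear_value Z
  have hKZ : 2 ^ K ≤ Z := by
    rw [hK, mul_comm, pow_mul]
    exact (Nat.pow_le_pow_left hLE 25).trans (hZ ▸ Nat.le_add_left _ _)
  set ε : ℝ := 1 / (2 ^ L * 2 ^ L) with hε
  clear_value ε
  have hε0 : 0 ≤ ε := by rw [hε]; positivity
  have hbad : ∀ i, ∑ z : Fin K × ListWire s n b → Bool,
      (if Good f H i δ z then 0 else runsProb c i z) ≤ ε := by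
    intro i
    refine (sum_not_good_le hc (hprob i)).trans ?_
    rw [hK, pow_mul, hε, ← mul_pow, ← one_div_pow]
    refine pow_le_pow_left₀ (by positivity) ?_ L
    norm_num
  have hs : s ≤ S₀ := by
    simp only [Fintype.card_sum, Fintype.card_prod, Fintype.card_fin, Fintype.card_unit] at hcS
    have : s ≤ s * (1 + (n + (b + b))) := Nat.le_mul_of_pos_right s (by omega)
    omega
  have hs' : (s : ℝ) ≤ S₀ := by exact_mod_cast hs
  have hEL' : (E : ℝ) ≤ 2 ^ L := by exact_mod_cast hEL.le
  have hεE : ε ≤ 1 / E := by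
    rw [hε]
    refine one_div_le_one_div_of_le hE0 (hEL'.trans ?_)
    exact le_mul_of_one_le_left (by positivity) (one_le_pow₀ (by norm_num))
  have hKε : K * s * ε ≤ 25 * S₀ / E := by
    have hL2 : (L : ℝ) ≤ 2 ^ L := by exact_mod_cast Nat.lt_two_pow_self.le
    have e1 : L * ε ≤ 1 / E := by
      calc L * ε ≤ 2 ^ L * ε := by gcongr
        _ = 1 / 2 ^ L := by rw [hε]; field_simp
        _ ≤ 1 / E := one_div_le_one_div_of_le hE0 hEL'
    calc (K : ℝ) * s * ε = 25 * s * (L * ε) := by rw [hK]; push_cast; ring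
      _ ≤ 25 * S₀ * (1 / E) := by gcongr
      _ = _ := by ring
  set β : ℝ := D * (4 * δ + 4 * (N * δ) * ε) + 2 * (N * δ) * (K * s * ε) with hβ
  clear_value β
  have hsum := norm_sum_step_op_sub_le (K := K) (N := N) (ε := ε) hc hH hδ0
    (by rw [hNδ]; exact hHn) hε0 hbad hd
  rw [← hβ] at hsum
  have hYβ : Y * β ≤ 1 / (4 * Y ^ 2) := by
    have e1 : β ≤ D * (4 * δ + 4 * D * (1 / E)) + 2 * D * (25 * S₀ / E) := by
      rw [hβ, hNδ]
      gcongr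
    have eM : (M : ℝ) = 48 * D * Y ^ 3 := by rw [hM, accuracyInv]; push_cast; ring
    have eE : (E : ℝ) = 600 * D ^ 2 * S₀ * Y ^ 3 := by rw [hE, failureInv]; push_cast; ring
    refine (mul_le_mul_of_nonneg_left e1 (by positivity)).trans ?_
    rw [hδ, eM, eE]
    exact error_budget hD0 hS0 hY0
  set R := rounds D Y S₀ K with hR
  clear_value R
  have hR0 : 0 < R := lt_of_lt_of_le (Nat.mul_pos hY hD) ((hR ▸ mul_le_rounds D Y S₀ K))
  have hR' : (0 : ℝ) < R := by exact_mod_cast hR0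
  have eR : (R : ℝ) = 4 * Y ^ 4 * (((K * S₀) ^ 2 * (4 * D)) ^ 2 + D ^ 2) := by
    rw [hR, rounds]; push_cast; ring
  have hYDR : Y * D ≤ R := hR ▸ mul_le_rounds D Y S₀ K
  have hRD : (Y : ℝ) * D ≤ R := by exact_mod_cast hYDR
  have hδ1 : δ ≤ D := by
    have : δ ≤ 1 := by rw [hδ, div_le_one hM0]; exact_mod_cast hM1
    linarith
  have htR : t / R * D ≤ 1 := by
    rw [div_mul_eq_mul_div, div_le_one hR']
    exact (mul_le_mul_of_nonneg_right htY (zero_le_one.trans hD0)).trans hRD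
  have htR' : t / R * δ ≤ 1 := (mul_le_mul_of_nonneg_left hδ1 (div_nonneg ht.le hR'.le)).trans htR
  obtain ⟨A, hA, hAn⟩ := Enc.trotter (T := StepIndex K s N) (t := t) (R := R) hH
    (fun τ => τ.enc hc (hcS.trans (hZ ▸ Nat.le_add_right _ _)) hKZ)
    (fun τ => τ.norm_op_le hc) (fun τ => levelUnit_mul_star τ.level) hsum hHn hδ0.le ht.le hR0 htR' htR
  refine ⟨A, hA.mono ?_, hAn.trans ?_⟩
  · refine le_trans ?_ (simulationCost_mono hKE)
    rw [StepIndex.card, simulationCost, hR, hN, hM]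
    refine Nat.mul_le_mul_left _ (Nat.mul_le_mul_right _ (Nat.mul_le_mul_right _ ?_))
    exact Nat.pow_le_pow_left (Nat.mul_le_mul_left _ hs) 2
  · have e1 : t * β ≤ 1 / (4 * Y ^ 2) := by
      have hβ0 : 0 ≤ β := (norm_nonneg _).trans hsum
      exact (mul_le_mul_of_nonneg_right htY hβ0).trans hYβ
    have e2 : t ^ 2 * ((Fintype.card (StepIndex K s N) * δ) ^ 2 + (D : ℝ) ^ 2) / R ≤
        1 / (4 * Y ^ 2) := by
      have e3 : (Fintype.card (StepIndex K s N) : ℝ) * δ ≤ (K * S₀) ^ 2 * (4 * D) := by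
        rw [StepIndex.card]
        push_cast
        calc ((K : ℝ) * s) ^ 2 * (4 * N) * δ = (K * s) ^ 2 * (4 * (N * δ)) := by ring
          _ ≤ _ := by rw [hNδ]; gcongr
      have hY2 : (0 : ℝ) < 4 * Y ^ 2 := by positivity
      rw [div_le_div_iff₀ hR' hY2, one_mul, eR]
      calc t ^ 2 * ((Fintype.card (StepIndex K s N) * δ) ^ 2 + (D : ℝ) ^ 2) * (4 * Y ^ 2)
          ≤ Y ^ 2 * (((K * S₀) ^ 2 * (4 * D)) ^ 2 + (D : ℝ) ^ 2) * (4 * Y ^ 2) := by gcongr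
        _ = _ := by ring
    have e4 : 1 / (2 * Y ^ 2) ≤ α ^ 2 / 2 := by
      have hY2 : (0 : ℝ) < 2 * Y ^ 2 := by positivity
      rw [div_le_div_iff₀ hY2 (by norm_num)]
      have := one_le_pow₀ (n := 2) hαY
      rw [mul_pow] at this
      linarith
    have e5 : (1 : ℝ) / (4 * Y ^ 2) + 1 / (4 * Y ^ 2) = 1 / (2 * Y ^ 2) := by field_simp; norm_num
    linarith

end Core

/-! ### Polynomial bounds -/

/-- A function of natural numbers is polynomially bounded (except at zero). -/
def PolyBdd (g : ℕ → ℕ) : Prop := ∃ A B : ℕ, ∀ Y, 1 ≤ Y → g Y ≤ A * Y ^ B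

namespace PolyBdd

variable {g h : ℕ → ℕ}

lemma const (a : ℕ) : PolyBdd fun _ => a := ⟨a, 0, fun Y _ => by simp⟩

lemma id : PolyBdd fun Y => Y := ⟨1, 1, fun Y _ => by simp⟩

lemma add (hg : PolyBdd g) (hh : PolyBdd h) : PolyBdd fun Y => g Y + h Y := by
  obtain ⟨A, B, hg⟩ := hg
  obtain ⟨A', B', hh⟩ := hh
  refine ⟨A + A', B + B', fun Y hY => ?_⟩
  rw [add_mul]
  refine add_le_add ((hg Y hY).trans ?_) ((hh Y hY).trans ?_)
  · exact Nat.mul_le_mul_left _ (Nat.pow_le_pow_right hY (by omega))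
  · exact Nat.mul_le_mul_left _ (Nat.pow_le_pow_right hY (by omega))

lemma mul (hg : PolyBdd g) (hh : PolyBdd h) : PolyBdd fun Y => g Y * h Y := by
  obtain ⟨A, B, hg⟩ := hg
  obtain ⟨A', B', hh⟩ := hh
  refine ⟨A * A', B + B', fun Y hY => (Nat.mul_le_mul (hg Y hY) (hh Y hY)).trans_eq ?_⟩
  ring

lemma pow (hg : PolyBdd g) (k : ℕ) : PolyBdd fun Y => g Y ^ k := by
  obtain ⟨A, B, hg⟩ := hg
  refine ⟨A ^ k, B * k, fun Y hY => (Nat.pow_le_pow_left (hg Y hY) k).trans_eq ?_⟩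
  ring

lemma bigCost (hg : PolyBdd g) (hh : PolyBdd h) : PolyBdd fun Y => bigCost (g Y) (h Y) :=
  (((const 2).mul (hg.add (const 1))).pow 3).mul (hh.add (const 3))

lemma natCost (hg : PolyBdd g) : PolyBdd fun Y => natCost (g Y) :=
  (hg.bigCost (((const 4).mul ((const 2).add (hg.bigCost (const 4)))).add (const 7))).add (const 1)

lemma intCost (hg : PolyBdd g) : PolyBdd fun Y => intCost (g Y) :=
  ((const 4).mul ((const 2).mul (((const 4).mul (((const 2).mul hg.natCost).add (const 1))).add
    (const 6)))).add (const 15)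

lemma listedCost (hg : PolyBdd g) : PolyBdd fun Y => listedCost (g Y) :=
  hg.bigCost (((const 4).mul ((const 1).add (((const 4).mul ((hg.bigCost (const 3)).add
    hg.intCost)).add (const 6)))).add (const 6))

lemma majCost (hg : PolyBdd g) (hh : PolyBdd h) : PolyBdd fun Y => majCost (g Y) (h Y) :=
  hg.bigCost ((hg.bigCost (hh.add (const 1))).add (const 1))

lemma leadCost (hg : PolyBdd g) : PolyBdd fun Y => leadCost (g Y) :=
  ((const 4).mul ((const 1).add (((const 4).mul (((hg.mul hg).bigCost (((const 4).mul
    ((const 1).add (hg.bigCost (const 3)))).add (const 8))).add (hg.majCost hg.listedCost))).add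
    (const 6)))).add (const 6)

lemma levelCost (hg : PolyBdd g) : PolyBdd fun Y => levelCost (g Y) :=
  ((const 4).mul (hg.leadCost.add ((hg.majCost hg.listedCost).add (const 1)))).add (const 6)

lemma stepCost (hg : PolyBdd g) : PolyBdd fun Y => stepCost (g Y) :=
  ((const 2).mul (((((const 4).mul hg.levelCost).add (const 17)).add ((const 18).mul hg)).add
    (hg.mul ((const 3).mul hg)))).add ((const 2).mul hg)

lemma accuracyInv {D : ℕ → ℕ} (hD : PolyBdd D) : PolyBdd fun Y => accuracyInv (D Y) Y :=
  ((const 48).mul hD).mul (id.pow 3)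

lemma failureInv {D S₀ : ℕ → ℕ} (hD : PolyBdd D) (hS : PolyBdd S₀) :
    PolyBdd fun Y => failureInv (D Y) Y (S₀ Y) :=
  (((const 600).mul (hD.pow 2)).mul hS).mul (id.pow 3)

lemma rounds {D S₀ K : ℕ → ℕ} (hD : PolyBdd D) (hS : PolyBdd S₀) (hK : PolyBdd K) :
    PolyBdd fun Y => rounds (D Y) Y (S₀ Y) (K Y) :=
  ((const 4).mul (id.pow 4)).mul (((((hK.mul hS).pow 2).mul ((const 4).mul hD)).pow 2).add (hD.pow 2))

lemma simulationCost {D S₀ K Z : ℕ → ℕ} (hD : PolyBdd D) (hS : PolyBdd S₀) (hK : PolyBdd K)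
    (hZ : PolyBdd Z) : PolyBdd fun Y => simulationCost (D Y) Y (S₀ Y) (K Y) (Z Y) :=
  (hD.rounds hS hK).mul ((((hK.mul hS).pow 2).mul ((const 4).mul (hD.mul hD.accuracyInv))).mul
    (((const 2).mul hZ.stepCost).add (const 9)))

end PolyBdd

lemma exists_bound_polynomial (p : Polynomial ℝ) : ∃ C k : ℕ, 1 ≤ C ∧ ∀ n Y : ℕ, n ≤ Y → 1 ≤ Y →
    p.eval (n : ℝ) ≤ (C * Y ^ k : ℕ) := by
  refine ⟨⌈∑ i ∈ Finset.range (p.natDegree + 1), |p.coeff i|⌉₊ + 1, p.natDegree, by omega,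
    fun n Y hn hY => ?_⟩
  have hY' : (1 : ℝ) ≤ Y := by exact_mod_cast hY
  have hn' : (n : ℝ) ≤ Y := by exact_mod_cast hn
  rw [Polynomial.eval_eq_sum_range]
  calc ∑ i ∈ Finset.range (p.natDegree + 1), p.coeff i * (n : ℝ) ^ i
      ≤ ∑ i ∈ Finset.range (p.natDegree + 1), |p.coeff i| * (Y : ℝ) ^ p.natDegree := by
        refine Finset.sum_le_sum fun i hi => ?_
        have hi' : i ≤ p.natDegree := Nat.lt_succ_iff.1 (Finset.mem_range.1 hi)
        refine mul_le_mul (le_abs_self _) ?_ (by positivity) (abs_nonneg _)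
        exact (pow_le_pow_left₀ (by positivity) hn' i).trans (pow_le_pow_right₀ hY' hi')
    _ = (∑ i ∈ Finset.range (p.natDegree + 1), |p.coeff i|) * (Y : ℝ) ^ p.natDegree :=
        (Finset.sum_mul _ _ _).symm
    _ ≤ _ := by
        push_cast
        gcongr
        exact (Nat.le_ceil _).trans (by linarith)

lemma exists_bound_mvPolynomial {σ : Type*} [Fintype σ] (p : MvPolynomial σ ℝ) :
    ∃ C k : ℕ, 1 ≤ C ∧ ∀ (x : σ → ℝ) (Y : ℕ), (∀ i, 0 ≤ x i ∧ x i ≤ Y) → 1 ≤ Y →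
      MvPolynomial.eval x p ≤ (C * Y ^ k : ℕ) := by
  refine ⟨⌈∑ d ∈ p.support, |p.coeff d|⌉₊ + 1, p.totalDegree, by omega, fun x Y hx hY => ?_⟩
  have hY' : (1 : ℝ) ≤ Y := by exact_mod_cast hY
  rw [MvPolynomial.eval_eq']
  calc ∑ d ∈ p.support, p.coeff d * ∏ i, x i ^ d i
      ≤ ∑ d ∈ p.support, |p.coeff d| * (Y : ℝ) ^ p.totalDegree := by
        refine Finset.sum_le_sum fun d hd => ?_
        refine mul_le_mul (le_abs_self _) ?_
          (Finset.prod_nonneg fun i _ => pow_nonneg (hx i).1 _) (abs_nonneg _)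
        calc ∏ i, x i ^ d i ≤ ∏ i, (Y : ℝ) ^ d i :=
              Finset.prod_le_prod (fun i _ => pow_nonneg (hx i).1 _) fun i _ =>
                pow_le_pow_left₀ (hx i).1 (hx i).2 _
          _ = (Y : ℝ) ^ ∑ i, d i := Finset.prod_pow_eq_pow_sum _ _ _
          _ ≤ (Y : ℝ) ^ p.totalDegree := by
              refine pow_le_pow_right₀ hY' ?_
              have := MvPolynomial.le_totalDegree hd
              rwa [Finsupp.sum_fintype _ _ fun _ => rfl] at this
    _ = (∑ d ∈ p.support, |p.coeff d|) * (Y : ℝ) ^ p.totalDegree := (Finset.sum_mul _ _ _).symm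
    _ ≤ _ := by
        push_cast
        gcongr
        exact (Nat.le_ceil _).trans (by linarith)

/-- Polynomial bounds for the parameters of `exists_enc_near_exp`. The block is approximated up to
`α ^ 2 / 2`, as passing from the block to the circuit takes a square root. -/
theorem HamiltonianFamily.simulatable {ι : Type*} (F : HamiltonianFamily ι)
    (h_sparse : F.RowSparse) (h_comp : F.RowComputable) (h_norm : F.NormBounded) :
    F.Simulatable := by
  obtain ⟨ps, hs⟩ := h_sparse
  obtain ⟨pc, hc⟩ := h_comp
  obtain ⟨pn, hn⟩ := h_norm
  obtain ⟨C₁, k₁, hC₁, hb₁⟩ := exists_bound_polynomial ps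
  obtain ⟨C₂, k₂, hC₂, hb₂⟩ := exists_bound_polynomial pn
  obtain ⟨C₃, k₃, hC₃, hb₃⟩ := exists_bound_mvPolynomial pc
  -- `D` bounds both the norm and the number of entries in a row. It does not involve the size of the
  -- row circuit, whose accuracy depends on `D`; so `S₀` can be chosen after it
  let D : ℕ → ℕ := fun Y => C₁ * Y ^ k₁ + C₂ * Y ^ k₂
  let S₀ : ℕ → ℕ := fun Y => C₃ * (Y + accuracyInv (D Y) Y) ^ k₃
  have hD : PolyBdd D := ((PolyBdd.const _).mul (PolyBdd.id.pow _)).add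
    ((PolyBdd.const _).mul (PolyBdd.id.pow _))
  have hS₀ : PolyBdd S₀ := (PolyBdd.const _).mul ((PolyBdd.id.add hD.accuracyInv).pow _)
  have hE := hD.failureInv hS₀
  obtain ⟨A, B, hAB⟩ := PolyBdd.id.add (hD.simulationCost hS₀ ((PolyBdd.const 50).mul hE)
    (hS₀.add (((PolyBdd.const 2).mul hE).pow 25)))
  refine ⟨MvPolynomial.C (A : ℝ) * (MvPolynomial.X 0 + MvPolynomial.X 1 + MvPolynomial.X 2 + 1) ^ B,
    fun x t α ht hα hα1 => ?_⟩
  -- a single parameter that bounds `n`, `t` and `1 / α`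
  set Y : ℕ := ⌈(F.n x : ℝ) + t + 1 / α⌉₊ with hYdef
  have hsum : (F.n x : ℝ) + t + 1 / α ≤ Y := Nat.le_ceil _
  have hα' : 0 < 1 / α := by positivity
  have hn0 : (0 : ℝ) ≤ F.n x := Nat.cast_nonneg _
  have hnY : F.n x ≤ Y := by
    have : (F.n x : ℝ) ≤ Y := by linarith
    exact_mod_cast this
  have hY1 : 1 ≤ Y := Nat.one_le_ceil_iff.2 (by positivity)
  have hD1 : 1 ≤ D Y := (Nat.one_le_iff_ne_zero.2 (by positivity) : 1 ≤ C₁ * Y ^ k₁).trans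
    (Nat.le_add_right _ _)
  have hS1 : 1 ≤ S₀ Y := Nat.one_le_iff_ne_zero.2 (by positivity)
  have hM : 48 ≤ accuracyInv (D Y) Y := by
    unfold accuracyInv
    have : 1 ≤ Y ^ 3 := Nat.one_le_pow _ _ hY1
    nlinarith
  have hM' : (48 : ℝ) ≤ accuracyInv (D Y) Y := by exact_mod_cast hM
  obtain ⟨s, b, f, m, c, hcsize, hprob⟩ := hc x (1 / accuracyInv (D Y) Y) (by positivity)
    (by rw [div_lt_one (by positivity)]; linarith)
  rw [one_div_one_div] at hcsize
  have hcS : circuitSize c ≤ S₀ Y := by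
    have := hcsize.trans (hb₃ _ (Y + accuracyInv (D Y) Y) (fun i => ?_) (by omega))
    · exact_mod_cast this
    · fin_cases i
      · refine ⟨hn0, ?_⟩
        have : (F.n x : ℝ) ≤ Y := by exact_mod_cast hnY
        push_cast
        exact this.trans (by simp)
      · refine ⟨Nat.cast_nonneg _, ?_⟩
        push_cast
        simp
  obtain ⟨M, hM, hMn⟩ := exists_enc_near_exp (H := F.H x) (c := circuitMatrix c) (k := c.length)
    (t := t) (α := α) hY1 hD1 hS1 (F.isHermitian x)
    ((hn x).trans ((hb₂ _ Y hnY hY1).trans (by exact_mod_cast Nat.le_add_left _ _)))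
    (fun i => (hs x i).trans ((hb₁ _ Y hnY hY1).trans (by exact_mod_cast Nat.le_add_right _ _)))
    ⟨c, rfl, le_rfl⟩ hcS hprob ht (by linarith) (by
      have : 1 / α ≤ Y := by linarith
      rwa [div_le_iff₀ hα, mul_comm] at this)
  obtain ⟨m', c', hsize', hnorm'⟩ := hM.exists_circuit
    (exp_neg_I_smul_mem_unitary (a := F.H x) (F.isHermitian x) t) hMn
  refine ⟨m', c', ?_, ?_⟩
  · have h1 : circuitSize c' ≤ A * Y ^ B := by
      refine hsize'.trans (le_trans ?_ (hAB Y hY1))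
      rw [Fintype.card_fin]
      exact Nat.add_le_add_right hnY _
    have h2 : (Y : ℝ) ≤ F.n x + t + 1 / α + 1 := (Nat.ceil_lt_add_one (by positivity)).le
    have h3 : (circuitSize c' : ℝ) ≤ A * (Y : ℝ) ^ B := by exact_mod_cast h1
    simp only [map_mul, map_pow, map_add, map_one, MvPolynomial.eval_C, MvPolynomial.eval_X]
    refine h3.trans ?_
    change (A : ℝ) * (Y : ℝ) ^ B ≤ A * ((F.n x : ℝ) + t + 1 / α + 1) ^ B
    gcongr
  · rw [mul_div_cancel₀ _ (two_ne_zero' ℝ)] at hnorm'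
    exact (sq_le_sq₀ (norm_nonneg _) hα.le).1 hnorm'

end SparseHamiltonian

theorem lemma1 {ι : Type*} (F : SparseHamiltonian.HamiltonianFamily ι)
    (h_sparse : F.RowSparse) (h_comp : F.RowComputable) (h_norm : F.NormBounded) :
    F.Simulatable :=
  F.simulatable h_sparse h_comp h_norm
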